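/- All graphs are finite, simple and undirected; a graph class is closed under isomorphism. A class $\mathcal C$ is hereditary if it is closed under vertex deletion, and robust if a graph belongs to $\mathcal C$ if and only if all its connected components do. The elimination distance $\mathrm{ed}_{\mathcal C}(G)$ is $0$ if $G\in\mathcal C$; it is $1+\min_{v\in V(G)}\mathrm{ed}_{\mathcal C}(G-v)$ if $G\notin\mathcal C$ is connected; and it is the maximum of $\mathrm{ed}_{\mathcal C}$ over the connected components of $G$ otherwise. A blocking set of $G$ is a set $Y\subseteq V(G)$ that is contained in no minimum vertex cover of $G$. Let $\beta_{\mathcal C}$ be the supremum of the sizes of inclusion-minimal blocking sets of graphs in $\mathcal C$, and let $\beta_{\mathcal C}(i)$ be the same quantity for the class $\mathcal C_i$ of graphs $G$ with $\mathrm{ed}_{\mathcal C}(G)\le i$. For a graph class $\mathcal D$, Vertex Cover parameterized by the size of a $\mathcal D$-modulator is the parameterized problem consisting of the pairs $((G,k,X),\ell)$ with $X\subseteq V(G)$, $|X|=\ell$, $G-X\in\mathcal D$, such that $G$ has a vertex cover of size at most $k$. A kernel of size $f(\ell)$ for a parameterized problem $Q\subseteq\Sigma^*\times\mathbb N$ is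 an algorithm that on input $(x,\ell)\in\Sigma^*\times\mathbb N$ takes time polynomial in $|x|+\ell$ and outputs a pair $(x',\ell')$ with $|x'|,\ell'\le f(\ell)$ and $(x',\ell')\in Q\iff(x,\ell)\in Q$; it is a polynomial kernel if $f$ is a polynomial. A randomized kernel with error probability at most $\varepsilon$ may also use polynomially many random bits; it obeys the bounds on time and size for all outcomes of these bits, and on each input the equivalence holds with probability at least $1-\varepsilon$. **Theorem.** Let $\mathcal C$ be a hereditary and robust graph class with $\beta_{\mathcal C}<\infty$, and let $d\ge 0$. Then $\beta_{\mathcal C}(i)<\infty$ for $1\le i\le d$; put $b=\prod_{i=1}^d\beta_{\mathcal C}(i)$. Let $f$ and $g$ be polynomials. If Vertex Cover parameterized by the size of a $\mathcal C$-modulator has a polynomial kernel of size $f(\ell)$ whose outputs have at most $g(\ell)$ vertices, then Vertex Cover parameterized by the size of a $\mathcal C_d$-modulator $X$ has a polynomial kernel of size $\mathcal O(f(|X|^b))$ whose outputs have $\mathcal O(g(|X|^b))$ vertices. The same holds for randomized kernels: if the given kernel has error probability at most $\varepsilon<\tfrac12$, then the resulting kernel can be chosen, with the same bounds, to have error probability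 at most $\varepsilon'$, for any prescribed $\varepsilon'>\varepsilon$. -/

import Mathlib

open Filter Asymptotics

/-! ### Graph classes -/

/-- A class of finite simple graphs. -/
abbrev GraphClass : Type 1 := ∀ (V : Type) [Finite V], SimpleGraph V → Prop

namespace GraphClass

/-- Graph classes are understood up to isomorphism. -/
def IsoInvariant (C : GraphClass) : Prop :=
  ∀ (V W : Type) [Finite V] [Finite W] (G : SimpleGraph V) (H : SimpleGraph W),
    Nonempty (G ≃g H) → C V G → C W H

/-- Closed under deletion of vertices. -/
def Hereditary (C : GraphClass) : Prop :=
  ∀ (V : Type) [Finite V] (G : SimpleGraph V) (S : Set V), C V G → C S (G.induce S)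

/-- A graph belongs to the class if and only if all its connected components do. -/
def Robust (C : GraphClass) : Prop :=
  ∀ (V : Type) [Finite V] (G : SimpleGraph V),
    C V G ↔ ∀ c : G.ConnectedComponent, C c.supp (G.induce c.supp)

end GraphClass

theorem card_compl_singleton_lt {V : Type} [Finite V] (v : V) :
    Nat.card (({v} : Set V)ᶜ : Set V) < Nat.card V :=
  Finite.card_subtype_lt (p := fun x => x ∈ (({v} : Set V)ᶜ : Set V)) (x := v) (by simp)

theorem card_supp_lt {V : Type} [Finite V] (G : SimpleGraph V) (h : ¬ G.Connected)
    (c : G.ConnectedComponent) : Nat.card c.supp < Nat.card V := by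
  by_contra hlt
  have hall : ∀ v : V, v ∈ c.supp := by
    intro v
    by_contra hv
    exact hlt (Finite.card_subtype_lt (p := fun x => x ∈ c.supp) hv)
  apply h
  have : Nonempty V := ⟨c.out⟩
  refine ⟨fun u v => ?_⟩
  have hu := hall u
  have hv := hall v
  rw [SimpleGraph.ConnectedComponent.mem_supp_iff] at hu hv
  exact SimpleGraph.ConnectedComponent.exact (hu.trans hv.symm)

open Classical in
/-- The elimination distance of a finite graph to the class `C`: `0` on `C`; one more than the
minimum over all vertex deletions for connected graphs outside `C`; the maximum over the connected
components otherwise. -/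
noncomputable def elimDist (C : GraphClass) (V : Type) [Finite V] (G : SimpleGraph V) : ℕ :=
  if C V G then 0
  else if h : G.Connected then
    (⨅ v : V, elimDist C (({v} : Set V)ᶜ : Set V) (G.induce ({v} : Set V)ᶜ)) + 1
  else
    ⨆ c : G.ConnectedComponent, elimDist C c.supp (G.induce c.supp)
termination_by Nat.card V
decreasing_by
  · exact card_compl_singleton_lt v
  · exact card_supp_lt G h c

/-- The class of graphs of elimination distance at most `d` to `C`. -/
def GraphClass.elim (C : GraphClass) (d : ℕ) : GraphClass :=
  fun V _ G => elimDist C V G ≤ d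

/-! ### Vertex covers and blocking sets -/

/-- `S` is a vertex cover of minimum cardinality. -/
def IsOptVertexCover {V : Type} (G : SimpleGraph V) (S : Set V) : Prop :=
  G.IsVertexCover S ∧ ∀ T : Set V, G.IsVertexCover T → S.ncard ≤ T.ncard

/-- `Y` is not contained in any minimum vertex cover. -/
def IsBlockingSet {V : Type} (G : SimpleGraph V) (Y : Set V) : Prop :=
  ¬ ∃ S : Set V, IsOptVertexCover G S ∧ Y ⊆ S

/-- The largest size of an inclusion-minimal blocking set in a graph of the class
(`⊤` if these sizes are unbounded). -/
noncomputable def GraphClass.beta (C : GraphClass) : ℕ∞ :=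
  sSup {m : ℕ∞ | ∃ (V : Type) (_ : Finite V) (G : SimpleGraph V) (Y : Set V),
    C V G ∧ Minimal (IsBlockingSet G) Y ∧ m = Y.ncard}

/-! ### Vertex Cover parameterized by the size of a given modulator -/

/-- A graph on `n` vertices, an integer `k`, and a set `X` of vertices. -/
structure VCInstance where
  n : ℕ
  G : SimpleGraph (Fin n)
  k : ℕ
  X : Finset (Fin n)

open Classical in
/-- Encoding by a bit string: `n` and `k` in unary (each ended by `0`), the characteristic vector of
`X`, and the adjacency matrix row by row. -/
noncomputable def VCInstance.encode (I : VCInstance) : List Bool :=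
  List.replicate I.n true ++ [false] ++ List.replicate I.k true ++ [false] ++
    List.ofFn (fun i : Fin I.n => decide (i ∈ I.X)) ++
    (List.ofFn fun i : Fin I.n => List.ofFn fun j : Fin I.n => decide (I.G.Adj i j)).flatten

/-- A parameterized problem over the alphabet `{0, 1}`. -/
abbrev ParamProblem : Type := Set (List Bool × ℕ)

/-- Vertex Cover parameterized by the size of a `C`-modulator: the modulator is part of the input,
and pairs that do not encode a graph with a `C`-modulator of size `ℓ` are not in the problem. -/
def vertexCoverByModulator (C : GraphClass) : ParamProblem :=
  {p | ∃ I : VCInstance, I.encode = p.1 ∧ I.X.card = p.2 ∧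
    C ((I.X : Set (Fin I.n))ᶜ : Set (Fin I.n)) (I.G.induce (I.X : Set (Fin I.n))ᶜ) ∧
    ∃ S : Finset (Fin I.n), I.G.IsVertexCover (S : Set (Fin I.n)) ∧ S.card ≤ I.k}

/-! ### Algorithms: while programs on binary trees, with running times -/

/-- Binary trees, the values on which programs work. -/
inductive Data : Type
  | nil : Data
  | pair : Data → Data → Data

namespace Data

/-- Number of nodes. -/
def size : Data → ℕ
  | nil => 1
  | pair a b => a.size + b.size + 1

/-- The left subtree. -/
def fst : Data → Data
  | nil => nil
  | pair a _ => a

/-- The right subtree. -/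
def snd : Data → Data
  | nil => nil
  | pair _ b => b

/-- A bit string as a list of trees. -/
def ofBits : List Bool → Data
  | [] => nil
  | false :: l => pair nil (ofBits l)
  | true :: l => pair (pair nil nil) (ofBits l)

/-- A natural number in unary. -/
def ofNat : ℕ → Data
  | 0 => nil
  | n + 1 => pair nil (ofNat n)

/-- A pair of a bit string and a number. -/
def ofInput (p : List Bool × ℕ) : Data := pair (ofBits p.1) (ofNat p.2)

end Data

/-- While programs in variable-free form. A program transforms one tree into another. -/
inductive Prog : Type
  | id : Prog
  | nil : Prog
  | fst : Prog
  | snd : Prog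
  | pair : Prog → Prog → Prog
  | comp : Prog → Prog → Prog
  | ite : Prog → Prog → Prog → Prog
  | loop : Prog → Prog → Prog

/-- `Runs P v w t`: on input `v` the program `P` halts with output `w` after time `t`. Every
elementary operation on a value, including copying it, takes time equal to its size.
`comp P Q` runs `P` and then `Q`; `ite c P Q` and `loop c P` (while `c` do `P`) test whether
the output of `c` differs from `nil`. -/
inductive Runs : Prog → Data → Data → ℕ → Prop
  | id (v : Data) : Runs .id v v v.size
  | nil (v : Data) : Runs .nil v .nil v.size
  | fst (v : Data) : Runs .fst v v.fst v.size
  | snd (v : Data) : Runs .snd v v.snd v.size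
  | pair {P Q : Prog} {v a b : Data} {s t : ℕ} :
      Runs P v a s → Runs Q v b t → Runs (.pair P Q) v (.pair a b) (v.size + s + t)
  | comp {P Q : Prog} {v w u : Data} {s t : ℕ} :
      Runs P v w s → Runs Q w u t → Runs (.comp P Q) v u (v.size + s + t)
  | ite_true {c P Q : Prog} {v a b w : Data} {s t : ℕ} :
      Runs c v (.pair a b) s → Runs P v w t → Runs (.ite c P Q) v w (v.size + s + t)
  | ite_false {c P Q : Prog} {v w : Data} {s t : ℕ} :
      Runs c v .nil s → Runs Q v w t → Runs (.ite c P Q) v w (v.size + s + t)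
  | loop_true {c P : Prog} {v a b w u : Data} {s t r : ℕ} :
      Runs c v (.pair a b) s → Runs P v w t → Runs (.loop c P) w u r →
        Runs (.loop c P) v u (v.size + s + t + r)
  | loop_false {c P : Prog} {v : Data} {s : ℕ} :
      Runs c v .nil s → Runs (.loop c P) v v (v.size + s)

/-! ### Kernels -/

/-- The output `y` has size at most `f` (string and parameter), and at most `g` vertices. -/
def OutputBound (f g : ℕ) (y : List Bool × ℕ) : Prop :=
  y.1.length ≤ f ∧ y.2 ≤ f ∧ ∀ I : VCInstance, I.encode = y.1 → I.n ≤ g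

/-- `Q` has a (deterministic) kernel of size `f(ℓ)` with at most `g(ℓ)` vertices: an algorithm that
on input `(x, ℓ)` takes time polynomial in `|x| + ℓ`, and outputs an equivalent instance. -/
def HasKernel (Q : ParamProblem) (f g : ℕ → ℕ) : Prop :=
  ∃ (P : Prog) (A : List Bool × ℕ → List Bool × ℕ) (p : Polynomial ℕ),
    ∀ (x : List Bool) (l : ℕ),
      (∃ t ≤ p.eval (x.length + l), Runs P (Data.ofInput (x, l)) (Data.ofInput (A (x, l))) t) ∧
      OutputBound (f l) (g l) (A (x, l)) ∧
      (A (x, l) ∈ Q ↔ (x, l) ∈ Q)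

/-- `Q` has a randomized kernel of size `f(ℓ)` with at most `g(ℓ)` vertices and error probability at
most `ε`: the algorithm also gets `q(|x| + ℓ)` uniformly random bits, where `q` is a polynomial. The
bounds on time and size hold for all outcomes of the random bits, and the output is equivalent to
the input with probability at least `1 - ε`. -/
def HasRandomizedKernel (Q : ParamProblem) (f g : ℕ → ℕ) (ε : ℝ) : Prop :=
  ∃ (P : Prog) (A : List Bool × ℕ → List Bool → List Bool × ℕ) (p q : Polynomial ℕ),
    ∀ (x : List Bool) (l : ℕ),
      (∀ r : Fin (q.eval (x.length + l)) → Bool,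
        (∃ t ≤ p.eval (x.length + l),
          Runs P (.pair (Data.ofInput (x, l)) (Data.ofBits (List.ofFn r)))
            (Data.ofInput (A (x, l) (List.ofFn r))) t) ∧
        OutputBound (f l) (g l) (A (x, l) (List.ofFn r))) ∧
      (1 - ε) * 2 ^ (q.eval (x.length + l)) ≤
        (({r : Fin (q.eval (x.length + l)) → Bool |
          A (x, l) (List.ofFn r) ∈ Q ↔ (x, l) ∈ Q}.ncard : ℕ) : ℝ)

/-- `f : ℕ → ℕ` is given by a polynomial. -/
def IsPolynomialFun (f : ℕ → ℕ) : Prop :=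
  ∃ p : Polynomial ℝ, ∀ n : ℕ, (f n : ℝ) = p.eval (n : ℝ)

/-- `f' ∈ O(f(ℓ ^ b))`. -/
def IsBigOPow (f' f : ℕ → ℕ) (b : ℕ) : Prop :=
  (fun l : ℕ => (f' l : ℝ)) =O[atTop] (fun l : ℕ => (f (l ^ b) : ℝ))

/-- The exponent `∏_{i = 1}^{d} β_C(i)`, where `β_C(i)` refers to the graphs of elimination distance
at most `i` to `C`. -/
noncomputable def kernelExponent (C : GraphClass) (d : ℕ) : ℕ :=
  ∏ i ∈ Finset.Icc 1 d, (C.elim i).beta.toNat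

/-! ### Polynomial-time functions -/

/-! The elimination distance is lowered one level at a time. Let G − X have elimination distance at
most i + 1, and let H be a component of G − X. A vertex cover avoiding Z ⊆ X contains the neighbours
of Z in H; if these form a blocking set of H, the cover spends more than the optimum on H. A
blocking set of H contains one of size at most b = β(i + 1), so every such conflict is already
caused by b vertices of X, and only the |X|^b tuples over X matter. Components are matched to tuples
that block them, each component to at most one tuple and each tuple to at most one component.
Unmatched components are deleted and their cover numbers are charged to the budget.

Deletion is safe because the matching comes with a closed set of tuples (`exists_closed_keys`): all
of them are matched, and every tuple blocking a deleted component, or a component matched to the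
set, belongs to the set. If a cover of the remaining graph misses some of these tuples completely,
one vertex of each is added to the cover, and the matched component, where a vertex was wasted, pays
for it (`coverNum_delete_pieces`). At most |X|^b components survive. Each is in C or has a vertex
whose deletion lowers its distance to i, and this vertex moves into the modulator
(`levelStep_spec`). The modulator grows to at most |X| + |X|^b vertices, hence after d levels to
O(|X|^∏β(i)), and the given kernel is applied to the result.

Finiteness of β(i) follows by induction on i: a blocking set of a connected graph is treated
separately for covers with and without an elimination vertex, which turns a bound b into 2b + 1
(`blockBound_elim_succ`).

The algorithm needs cover numbers. At parameter 0 the given kernel has only finitely many possible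
outputs, so a table decides Vertex Cover on C together with membership in C. From there `optNum`
computes cover numbers at distance i by branching to constant depth. A final check (`postCheck`)
discards kernel outputs whose modulator is not one to C, since these could be positive for the
larger class.

For randomized kernels the table lookup is replaced by majority votes, numerous enough that for most
outcomes all short queries are answered correctly at once (`exists_good_votes`). A separate block of
random bits serves the kernel, and the two errors add up to at most ε' (`ncard_assemble_ge`).

Running times are handled by `PolyTime`, a predicate closed under composition, branching, and folds
with polynomially bounded accumulators. -/

theorem Polynomial.eval_nat_mono (p : Polynomial ℕ) {a b : ℕ} (h : a ≤ b) :
    p.eval a ≤ p.eval b := by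
  rw [Polynomial.eval_eq_sum, Polynomial.eval_eq_sum]
  exact Finset.sum_le_sum fun i _ => Nat.mul_le_mul_left _ (Nat.pow_le_pow_left h i)

/-- Every elementary operation is charged the size of the value it works on, so a program cannot
output more than it has paid for. A time bound is therefore also a size bound, which is what makes
polynomial bounds compose. -/
theorem Runs.size_le {P : Prog} {v w : Data} {t : ℕ} (h : Runs P v w t) : w.size ≤ t := by
  have pos : ∀ d : Data, 1 ≤ d.size := by intro d; cases d <;> simp [Data.size]
  induction h with
  | id v => exact le_rfl
  | nil v => exact pos v
  | fst v => cases v <;> simp [Data.fst, Data.size]; omega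
  | snd v => cases v <;> simp [Data.snd, Data.size]; omega
  | @pair P Q v a b s t _ _ h1 h2 => have := pos v; simp only [Data.size]; omega
  | comp _ _ h1 h2 => omega
  | ite_true _ _ h1 h2 => omega
  | ite_false _ _ h1 h2 => omega
  | loop_true _ _ _ h1 h2 h3 => omega
  | loop_false _ _ => omega

/-! ### Encodings by binary trees and their sizes -/

/-- Encodings of a type by binary trees. -/
class Enc (α : Type) where
  enc : α → Data
  enc_injective : Function.Injective enc

namespace Enc

instance : Enc Unit := ⟨fun _ => .nil, fun _ _ _ => rfl⟩

instance : Enc Bool where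
  enc b := cond b (.pair .nil .nil) .nil
  enc_injective a b h := by cases a <;> cases b <;> simp_all

instance : Enc ℕ where
  enc := Data.ofNat
  enc_injective := by
    intro a
    induction a with
    | zero => intro b h; cases b <;> simp_all [Data.ofNat]
    | succ n ih =>
      intro b h
      cases b with
      | zero => simp [Data.ofNat] at h
      | succ m => simp only [Data.ofNat, Data.pair.injEq, true_and] at h; rw [ih h]

variable {α β : Type} [Enc α] [Enc β]

instance : Enc (α × β) where
  enc p := .pair (enc p.1) (enc p.2)
  enc_injective a b h := by
    simp only [Data.pair.injEq] at h
    exact Prod.ext (enc_injective h.1) (enc_injective h.2)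

/-- The extra node separates `some a` from `none` even if `a` is encoded by `nil`, so a test for
`nil` distinguishes the cases. -/
instance : Enc (Option α) where
  enc o := o.elim .nil fun a => .pair .nil (enc a)
  enc_injective a b h := by
    cases a <;> cases b <;> simp_all
    exact enc_injective h

/-- The encoding of lists. -/
def encList : List α → Data
  | [] => .nil
  | a :: l => .pair (enc a) (encList l)

instance : Enc (List α) where
  enc := encList
  enc_injective := by
    intro a
    induction a with
    | nil => intro b h; cases b <;> simp_all [encList]
    | cons x l ih =>
      intro b h
      cases b with
      | nil => simp [encList] at h
      | cons y m =>
        simp only [encList, Data.pair.injEq] at h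
        rw [ih h.2, enc_injective h.1]

/-- The size of the encoding. -/
def sz (a : α) : ℕ := (enc a).size

theorem sz_pos (a : α) : 1 ≤ sz a := by
  unfold sz; cases enc a <;> simp [Data.size]

theorem sz_bool_le (b : Bool) : sz b ≤ 3 := by cases b <;> decide
@[simp] theorem sz_nat (n : ℕ) : sz n = 2 * n + 1 := by
  induction n with
  | zero => rfl
  | succ n ih =>
    have : sz (n + 1) = 1 + sz n + 1 := rfl
    omega
@[simp] theorem sz_mk (a : α) (b : β) : sz (a, b) = sz a + sz b + 1 := rfl
theorem sz_prod (p : α × β) : sz p = sz p.1 + sz p.2 + 1 := rfl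
@[simp] theorem sz_none : sz (none : Option α) = 1 := rfl
@[simp] theorem sz_some (a : α) : sz (some a) = sz a + 2 := by
  change 1 + sz a + 1 = _; omega
@[simp] theorem sz_nil : sz ([] : List α) = 1 := rfl
@[simp] theorem sz_cons (a : α) (l : List α) : sz (a :: l) = sz a + sz l + 1 := rfl

theorem sz_append (l m : List α) : sz (l ++ m) + 1 = sz l + sz m := by
  induction l with
  | nil => simp; omega
  | cons a l ih => simp; omega

theorem length_le_sz (l : List α) : l.length + 1 ≤ sz l := by
  induction l with
  | nil => simp
  | cons a l ih => simp; omega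

theorem sz_mem_le {l : List α} {a : α} (h : a ∈ l) : sz a + 2 ≤ sz l := by
  induction l with
  | nil => simp at h
  | cons b l ih =>
    have := sz_pos l
    have := sz_pos b
    rcases List.mem_cons.1 h with rfl | h
    · simp; omega
    · have := ih h; simp; omega

theorem sz_sublist_le {l m : List α} (h : l.Sublist m) : sz l ≤ sz m := by
  induction h with
  | slnil => exact le_rfl
  | cons a _ ih => simp; omega
  | cons_cons a _ ih => simp; omega

theorem enc_bits (l : List Bool) : enc l = Data.ofBits l := by
  induction l with
  | nil => rfl
  | cons b l ih => cases b <;> (change Data.pair _ (enc l) = _; rw [ih]; rfl)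

theorem enc_input (p : List Bool × ℕ) : enc p = Data.ofInput p := by
  change Data.pair (enc p.1) _ = _; rw [enc_bits]; rfl

theorem sz_bits_le (l : List Bool) : sz l ≤ 4 * l.length + 1 := by
  induction l with
  | nil => simp
  | cons b l ih => have := sz_bool_le b; simp; omega

/-- A unary number and a list of that many units are the same tree. Iterating n times thus becomes a
fold, and the length of a list is read off after replacing its entries by `()`. -/
theorem enc_replicate_unit (n : ℕ) : enc (List.replicate n ()) = enc n := by
  induction n with
  | zero => rfl
  | succ n ih => change Data.pair _ (enc (List.replicate n ())) = _; rw [ih]; rfl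

end Enc

/-! ### Closure properties of polynomial-time functions -/

section Programs

open Enc

variable {α β γ σ : Type} [Enc α] [Enc β] [Enc γ] [Enc σ]

/-- Functions computed by a program in time polynomial in the size of the input. -/
@[fun_prop]
def PolyTime (f : α → β) : Prop :=
  ∃ (P : Prog) (p : Polynomial ℕ), ∀ a, ∃ t ≤ p.eval (sz a), Runs P (enc a) (enc (f a)) t

namespace PolyTime

theorem exists_size_le {f : α → β} (hf : PolyTime f) :
    ∃ p : Polynomial ℕ, ∀ a, sz (f a) ≤ p.eval (sz a) := by
  obtain ⟨P, p, h⟩ := hf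
  refine ⟨p, fun a => ?_⟩
  obtain ⟨t, ht, hr⟩ := h a
  exact hr.size_le.trans ht

@[fun_prop]
theorem id' : PolyTime (fun a : α => a) :=
  ⟨.id, Polynomial.X, fun a => ⟨_, by simp [sz], Runs.id _⟩⟩

@[fun_prop]
theorem comp' {g : β → γ} {f : α → β} (hg : PolyTime g) (hf : PolyTime f) :
    PolyTime (fun a => g (f a)) := by
  obtain ⟨P, p, hP⟩ := hf
  obtain ⟨Q, q, hQ⟩ := hg
  refine ⟨.comp P Q, Polynomial.X + p + q.comp p, fun a => ?_⟩
  obtain ⟨s, hs, h1⟩ := hP a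
  obtain ⟨t, ht, h2⟩ := hQ (f a)
  refine ⟨_, ?_, Runs.comp h1 h2⟩
  have : q.eval (sz (f a)) ≤ q.eval (p.eval (sz a)) :=
    q.eval_nat_mono (h1.size_le.trans hs)
  simp only [Polynomial.eval_add, Polynomial.eval_X, Polynomial.eval_comp]
  change sz a + s + t ≤ _
  omega

theorem _root_.exists_const_prog (d : Data) : ∃ (P : Prog) (p : Polynomial ℕ), ∀ v : Data,
    ∃ t ≤ p.eval v.size, Runs P v d t := by
  induction d with
  | nil => exact ⟨.nil, Polynomial.X, fun v => ⟨_, by simp, Runs.nil v⟩⟩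
  | pair a b iha ihb =>
    obtain ⟨P, p, hP⟩ := iha
    obtain ⟨Q, q, hQ⟩ := ihb
    refine ⟨.pair P Q, Polynomial.X + p + q, fun v => ?_⟩
    obtain ⟨s, hs, h1⟩ := hP v
    obtain ⟨t, ht, h2⟩ := hQ v
    exact ⟨_, by simp only [Polynomial.eval_add, Polynomial.eval_X]; omega, Runs.pair h1 h2⟩

@[fun_prop]
theorem const' (b : β) : PolyTime (fun _ : α => b) := by
  obtain ⟨P, p, h⟩ := exists_const_prog (enc b)
  exact ⟨P, p, fun a => h _⟩

@[fun_prop]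
theorem prodMk {f : α → β} {g : α → γ} (hf : PolyTime f) (hg : PolyTime g) :
    PolyTime (fun a => (f a, g a)) := by
  obtain ⟨P, p, hP⟩ := hf
  obtain ⟨Q, q, hQ⟩ := hg
  refine ⟨.pair P Q, Polynomial.X + p + q, fun a => ?_⟩
  obtain ⟨s, hs, h1⟩ := hP a
  obtain ⟨t, ht, h2⟩ := hQ a
  refine ⟨_, ?_, Runs.pair h1 h2⟩
  simp only [Polynomial.eval_add, Polynomial.eval_X]
  change sz a + s + t ≤ _
  omega

theorem prim_fst : PolyTime (fun p : α × β => p.1) :=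
  ⟨.fst, Polynomial.X, fun a => ⟨_, by simp [sz], Runs.fst (enc a)⟩⟩

theorem prim_snd : PolyTime (fun p : α × β => p.2) :=
  ⟨.snd, Polynomial.X, fun a => ⟨_, by simp [sz], Runs.snd (enc a)⟩⟩

@[fun_prop]
theorem fst' {f : α → β × γ} (hf : PolyTime f) : PolyTime (fun a => (f a).1) :=
  prim_fst.comp' hf

@[fun_prop]
theorem snd' {f : α → β × γ} (hf : PolyTime f) : PolyTime (fun a => (f a).2) :=
  prim_snd.comp' hf

/-- A function that acts as the identity on encodings. -/
theorem of_enc_eq {f : α → β} (h : ∀ a, enc (f a) = enc a) : PolyTime f :=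
  ⟨.id, Polynomial.X, fun a => ⟨sz a, by simp, by rw [h]; exact Runs.id _⟩⟩

theorem of_enc_eq_snd {f : α → β} (h : ∀ a, enc (f a) = (enc a).snd) : PolyTime f :=
  ⟨.snd, Polynomial.X, fun a => ⟨sz a, by simp, by rw [h]; exact Runs.snd _⟩⟩

/-- Branching on whether the encoding of a value is `nil`. -/
theorem branch {c : α → γ} {f g h : α → β} (hc : PolyTime c) (hf : PolyTime f) (hg : PolyTime g)
    (h1 : ∀ a u v, enc (c a) = .pair u v → h a = f a) (h2 : ∀ a, enc (c a) = .nil → h a = g a) :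
    PolyTime h := by
  obtain ⟨R, r, hR⟩ := hc
  obtain ⟨P, p, hP⟩ := hf
  obtain ⟨Q, q, hQ⟩ := hg
  refine ⟨.ite R P Q, Polynomial.X + r + p + q, fun a => ?_⟩
  obtain ⟨s, hs, hrs⟩ := hR a
  simp only [Polynomial.eval_add, Polynomial.eval_X]
  cases hcase : enc (c a) with
  | nil =>
    obtain ⟨t, ht, hrt⟩ := hQ a
    rw [hcase] at hrs
    rw [h2 a hcase]
    exact ⟨_, by change sz a + s + t ≤ _; omega, Runs.ite_false hrs hrt⟩
  | pair u v =>
    obtain ⟨t, ht, hrt⟩ := hP a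
    rw [hcase] at hrs
    rw [h1 a u v hcase]
    exact ⟨_, by change sz a + s + t ≤ _; omega, Runs.ite_true hrs hrt⟩

@[fun_prop]
theorem cond' {c : α → Bool} {f g : α → β} (hc : PolyTime c) (hf : PolyTime f)
    (hg : PolyTime g) : PolyTime (fun a => cond (c a) (f a) (g a)) := by
  refine branch hc hf hg (fun a u v h => ?_) (fun a h => ?_) <;> cases hca : c a <;>
    simp_all [enc]

@[fun_prop]
theorem and' {f g : α → Bool} (hf : PolyTime f) (hg : PolyTime g) :
    PolyTime (fun a => f a && g a) := by
  have : (fun a => f a && g a) = fun a => cond (f a) (g a) false := by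
    funext a; cases f a <;> rfl
  rw [this]; fun_prop

@[fun_prop]
theorem or' {f g : α → Bool} (hf : PolyTime f) (hg : PolyTime g) :
    PolyTime (fun a => f a || g a) := by
  have : (fun a => f a || g a) = fun a => cond (f a) true (g a) := by
    funext a; cases f a <;> rfl
  rw [this]; fun_prop

@[fun_prop]
theorem not' {f : α → Bool} (hf : PolyTime f) : PolyTime (fun a => !f a) := by
  have : (fun a => !f a) = fun a => cond (f a) false true := by
    funext a; cases f a <;> rfl
  rw [this]; fun_prop

@[fun_prop]
theorem some' {f : α → β} (hf : PolyTime f) : PolyTime (fun a => some (f a)) :=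
  (of_enc_eq (f := fun p : Unit × β => some p.2) fun _ => rfl).comp' ((const' ()).prodMk hf)

theorem option_elim {o : α → Option β} {n : α → γ} {s : α → β → γ} (ho : PolyTime o)
    (hn : PolyTime n) (hs : PolyTime fun p : α × β => s p.1 p.2) :
    PolyTime (fun a => (o a).elim (n a) (s a)) := by
  obtain ⟨R, r, hR⟩ := ho
  obtain ⟨P, p, hP⟩ := hs
  obtain ⟨Q, q, hQ⟩ := hn
  -- A test does not pass on the tested value, so `R` runs a second time, and `.snd` strips the
  -- marker of `some`.
  refine ⟨.ite R (.comp (.pair .id (.comp R .snd)) P) Q,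
    10 * Polynomial.X + 10 * r + p.comp (Polynomial.X + r + 1) + q, fun a => ?_⟩
  obtain ⟨s', hs', hrs⟩ := hR a
  simp only [Polynomial.eval_add, Polynomial.eval_X, Polynomial.eval_comp, Polynomial.eval_one,
    Polynomial.eval_mul, Polynomial.eval_ofNat]
  cases hcase : o a with
  | none =>
    obtain ⟨t, ht, hrt⟩ := hQ a
    rw [hcase] at hrs
    exact ⟨_, by change sz a + s' + t ≤ _; omega, Runs.ite_false hrs hrt⟩
  | some b =>
    obtain ⟨t, ht, hrt⟩ := hP (a, b)
    rw [hcase] at hrs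
    have hsz : sz b + 2 ≤ s' := by
      have := hrs.size_le
      change sz (some b) ≤ s' at this
      simpa using this
    refine ⟨_, ?_, Runs.ite_true hrs (Runs.comp (Runs.pair (Runs.id _)
      (Runs.comp hrs (Runs.snd _))) hrt)⟩
    have h2 := sz_some b
    have h1 : p.eval (sz (a, b)) ≤ p.eval (sz a + r.eval (sz a) + 1) := by
      apply Polynomial.eval_nat_mono; simp; omega
    change sz a + s' + (sz a + (sz a + sz a + (sz a + s' + sz (some b))) + t) ≤ _
    omega

/-- The test runs N + 1 times and the body N times, always on states of size at most B. The size
bound has to be assumed, because a polynomial-time body might square the state in every round. -/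
theorem iterate_loop {c : σ → Bool} {f : σ → σ} {P Q : Prog} {p q : Polynomial ℕ}
    (hQ : ∀ a, ∃ t ≤ q.eval (sz a), Runs Q (enc a) (enc (c a)) t)
    (hP : ∀ a, ∃ t ≤ p.eval (sz a), Runs P (enc a) (enc (f a)) t) (B N : ℕ) :
    ∀ s : σ, (∀ j < N, c (f^[j] s) = true) → c (f^[N] s) = false →
      (∀ j ≤ N, sz (f^[j] s) ≤ B) →
      ∃ t ≤ (N + 1) * (B + p.eval B + q.eval B), Runs (.loop Q P) (enc s) (enc (f^[N] s)) t := by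
  induction N with
  | zero =>
    intro s _ h2 h3
    obtain ⟨t, ht, hr⟩ := hQ s
    rw [show c s = false from h2] at hr
    have hs : sz s ≤ B := h3 0 le_rfl
    have := q.eval_nat_mono hs
    refine ⟨_, ?_, Runs.loop_false hr⟩
    change sz s + t ≤ _
    simp only [zero_add, one_mul]
    omega
  | succ N ih =>
    intro s h1 h2 h3
    obtain ⟨t, ht, hr⟩ := hQ s
    rw [show c s = true from h1 0 (by omega)] at hr
    have hs : sz s ≤ B := h3 0 (by omega)
    have hq := q.eval_nat_mono hs
    have hp := p.eval_nat_mono hs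
    obtain ⟨t', ht', hr'⟩ := hP s
    obtain ⟨t'', ht'', hr''⟩ := ih (f s) (fun j hj => h1 (j + 1) (by omega)) h2
      (fun j hj => h3 (j + 1) (by omega))
    refine ⟨_, ?_, Runs.loop_true hr hr' hr''⟩
    change sz s + t + t' + t'' ≤ _
    rw [show (N + 1 + 1) * (B + p.eval B + q.eval B) =
      (N + 1) * (B + p.eval B + q.eval B) + (B + p.eval B + q.eval B) by ring]
    omega

theorem list_isEmpty_aux : PolyTime (fun l : List β => !l.isEmpty) := by
  refine branch (c := fun l : List β => l) id' (const' true) (const' false)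
    (fun a u v h => ?_) (fun a h => ?_) <;> cases a <;> simp_all [enc, encList]

theorem list_tail_aux : PolyTime (fun l : List β => l.tail) :=
  of_enc_eq_snd fun l => by cases l <;> rfl

theorem list_headD_aux : PolyTime (fun p : List β × β => p.1.headD p.2) := by
  obtain ⟨P, p, h⟩ := (list_isEmpty_aux (β := β)).comp' (prim_fst (α := List β) (β := β))
  refine ⟨.ite P (.comp .fst .fst) .snd, 10 * Polynomial.X + p, fun a => ?_⟩
  obtain ⟨s, hs, hr⟩ := h a
  obtain ⟨l, b⟩ := a
  simp only [Polynomial.eval_add, Polynomial.eval_X, Polynomial.eval_mul, Polynomial.eval_ofNat]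
  cases l with
  | nil =>
    exact ⟨_, by change sz (([] : List β), b) + s + sz (([] : List β), b) ≤ _; omega,
      Runs.ite_false hr (Runs.snd _)⟩
  | cons x l =>
    refine ⟨_, ?_, Runs.ite_true hr (Runs.comp (Runs.fst _) (Runs.fst _))⟩
    change sz (x :: l, b) + s + (sz (x :: l, b) + sz (x :: l, b) + sz (x :: l)) ≤ _
    simp only [sz_mk] at *
    omega

theorem list_head?_aux : PolyTime (fun l : List β => l.head?) := by
  obtain ⟨P, p, h⟩ := (list_isEmpty_aux (β := β))
  refine ⟨.ite P (.pair .nil .fst) .nil, 10 * Polynomial.X + p, fun l => ?_⟩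
  obtain ⟨s, hs, hr⟩ := h l
  simp only [Polynomial.eval_add, Polynomial.eval_X, Polynomial.eval_mul, Polynomial.eval_ofNat]
  cases l with
  | nil => exact ⟨_, by change sz ([] : List β) + s + sz ([] : List β) ≤ _; omega,
      Runs.ite_false hr (Runs.nil _)⟩
  | cons x l =>
    refine ⟨_, ?_, Runs.ite_true hr (Runs.pair (Runs.nil _) (Runs.fst _))⟩
    change sz (x :: l) + s + (sz (x :: l) + sz (x :: l) + sz (x :: l)) ≤ _
    omega

@[fun_prop]
theorem list_isEmpty {l : α → List β} (hl : PolyTime l) : PolyTime (fun a => (l a).isEmpty) := by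
  have := (list_isEmpty_aux.comp' hl).not'
  simpa using this

@[fun_prop]
theorem list_tail {l : α → List β} (hl : PolyTime l) : PolyTime (fun a => (l a).tail) :=
  list_tail_aux.comp' hl

@[fun_prop]
theorem list_headD {l : α → List β} {b : α → β} (hl : PolyTime l) (hb : PolyTime b) :
    PolyTime (fun a => (l a).headD (b a)) :=
  list_headD_aux.comp' (hl.prodMk hb)

@[fun_prop]
theorem list_head? {l : α → List β} (hl : PolyTime l) : PolyTime (fun a => (l a).head?) :=
  list_head?_aux.comp' hl

@[fun_prop]
theorem list_cons {b : α → β} {l : α → List β} (hb : PolyTime b) (hl : PolyTime l) :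
    PolyTime (fun a => b a :: l a) :=
  (of_enc_eq (f := fun p : β × List β => p.1 :: p.2) fun _ => rfl).comp' (hb.prodMk hl)

/-- A fold is a loop whose state carries the context, the remaining list and the accumulator. Only
accumulators of prefixes occur, so a polynomial bound on these bounds all states. -/
theorem foldl_of_bound {l : α → List β} {s : α → σ} {f : α → σ → β → σ} (hl : PolyTime l)
    (hs : PolyTime s) (hf : PolyTime fun p : α × σ × β => f p.1 p.2.1 p.2.2)
    (q : Polynomial ℕ)
    (hq : ∀ a l', l' <+: l a → sz (l'.foldl (f a) (s a)) ≤ q.eval (sz a)) :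
    PolyTime (fun a => (l a).foldl (f a) (s a)) := by
  -- the state is: context, rest of the list, accumulator
  let step : α × List β × σ → α × List β × σ := fun p =>
    (p.1, p.2.1.tail, (p.2.1.head?).elim p.2.2 (fun b => f p.1 p.2.2 b))
  have hstep : PolyTime step := by
    refine prodMk (by fun_prop) (prodMk (by fun_prop) (option_elim (by fun_prop) (by fun_prop) ?_))
    exact hf.comp' (f := fun p : (α × List β × σ) × β => (p.1.1, p.1.2.2, p.2)) (by fun_prop)
  have hcond : PolyTime (fun p : α × List β × σ => !p.2.1.isEmpty) := by fun_prop
  have hiter : ∀ (a : α) (l₁ l₂ : List β) (s : σ),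
      step^[l₁.length] (a, l₁ ++ l₂, s) = (a, l₂, l₁.foldl (f a) s) := by
    intro a l₁ l₂
    induction l₁ with
    | nil => intro s; rfl
    | cons b l₁ ih =>
      intro s
      simp only [List.length_cons, Function.iterate_succ, Function.comp_apply, List.cons_append,
        List.foldl_cons]
      exact ih _
  obtain ⟨ps, hps⟩ := exists_size_le hl
  have hinit : PolyTime (fun a => (a, l a, s a)) := by fun_prop
  obtain ⟨P, p, hP⟩ := hstep
  obtain ⟨Q, q', hQ⟩ := hcond
  suffices hmain : PolyTime (fun a => ((a, [], (l a).foldl (f a) (s a)) : α × List β × σ)) by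
    exact (hmain.snd').snd'
  obtain ⟨I, i, hI⟩ := hinit
  -- Context, remaining list and accumulator, plus the two pair nodes of the triple.
  let B : Polynomial ℕ := Polynomial.X + ps + q + 2
  refine ⟨.comp I (.loop Q P), Polynomial.X + i + ps * (B + p.comp B + q'.comp B), fun a => ?_⟩
  obtain ⟨t, ht, hr⟩ := hI a
  have hsize : ∀ j ≤ (l a).length, sz (step^[j] (a, l a, s a)) ≤ B.eval (sz a) := by
    intro j hj
    have h1 := hiter a ((l a).take j) ((l a).drop j) (s a)
    rw [List.length_take, min_eq_left hj, List.take_append_drop] at h1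
    rw [h1]
    have h2 := hq a _ (List.take_prefix j (l a))
    have h3 := sz_sublist_le (List.drop_sublist j (l a))
    have h4 := hps a
    simp only [B, sz_mk, Polynomial.eval_add, Polynomial.eval_X, Polynomial.eval_ofNat]
    omega
  obtain ⟨t', ht', hr'⟩ := iterate_loop hQ hP (B.eval (sz a)) (l a).length (a, l a, s a)
    (by
      intro j hj
      have h1 := hiter a ((l a).take j) ((l a).drop j) (s a)
      rw [List.length_take, min_eq_left hj.le, List.take_append_drop] at h1
      rw [h1]
      simp; omega)
    (by
      have h1 := hiter a (l a) [] (s a)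
      rw [List.append_nil] at h1
      rw [h1]; rfl) hsize
  have h1 := hiter a (l a) [] (s a)
  rw [List.append_nil] at h1
  rw [h1] at hr'
  refine ⟨_, ?_, Runs.comp hr hr'⟩
  have h5 : (l a).length + 1 ≤ ps.eval (sz a) := (length_le_sz _).trans (hps a)
  have h6 := Nat.mul_le_mul_right (B.eval (sz a) + p.eval (B.eval (sz a)) +
    q'.eval (B.eval (sz a))) h5
  simp only [Polynomial.eval_add, Polynomial.eval_X, Polynomial.eval_mul, Polynomial.eval_comp]
    at *
  change sz a + t + t' ≤ _
  omega

/-- When the increment depends on the context and the list entry but not on the accumulator, the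
increments merely add up along the list. -/
theorem foldl_of_growth {l : α → List β} {s : α → σ} {f : α → σ → β → σ} (hl : PolyTime l)
    (hs : PolyTime s) (hf : PolyTime fun p : α × σ × β => f p.1 p.2.1 p.2.2)
    (q : Polynomial ℕ) (hq : ∀ a s b, sz (f a s b) ≤ sz s + q.eval (sz a + sz b)) :
    PolyTime (fun a => (l a).foldl (f a) (s a)) := by
  obtain ⟨ps, hps⟩ := exists_size_le hs
  obtain ⟨pl, hpl⟩ := exists_size_le hl
  refine foldl_of_bound hl hs hf (ps + pl * q.comp (Polynomial.X + pl)) fun a l' hl' => ?_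
  have key : ∀ (l' : List β) (s : σ), (∀ b ∈ l', b ∈ l a) → sz (l'.foldl (f a) s) ≤
      sz s + l'.length * q.eval (sz a + pl.eval (sz a)) := by
    intro l'
    induction l' with
    | nil => intro s _; simp
    | cons b l' ih =>
      intro s hb
      have h1 := ih (f a s b) fun b hb' => hb b (List.mem_cons_of_mem _ hb')
      have h2 := hq a s b
      have h3 : q.eval (sz a + sz b) ≤ q.eval (sz a + pl.eval (sz a)) := by
        apply Polynomial.eval_nat_mono
        have := sz_mem_le (hb b (by simp))
        have := hpl a
        omega
      simp only [List.foldl_cons, List.length_cons, Nat.add_mul, one_mul]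
      omega
  have h1 := key l' (s a) fun b hb => hl'.subset hb
  have h2 : l'.length ≤ pl.eval (sz a) := by
    have := hl'.length_le
    have := length_le_sz (l a)
    have := hpl a
    omega
  have h3 := Nat.mul_le_mul_right (q.eval (sz a + pl.eval (sz a))) h2
  have h4 := hps a
  simp only [Polynomial.eval_add, Polynomial.eval_X, Polynomial.eval_mul, Polynomial.eval_comp]
  omega

theorem iterate_eq_foldl {σ : Type} (f : σ → σ) (n : ℕ) (s : σ) :
    f^[n] s = (List.replicate n ()).foldl (fun s _ => f s) s := by
  induction n generalizing s with
  | zero => rfl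
  | succ n ih => simp [List.replicate_succ, ih]

theorem replicate_unit {n : α → ℕ} (hn : PolyTime n) :
    PolyTime (fun a => List.replicate (n a) ()) :=
  (of_enc_eq enc_replicate_unit).comp' hn

theorem iterate_of_growth {n : α → ℕ} {s : α → σ} {f : α → σ → σ} (hn : PolyTime n)
    (hs : PolyTime s) (hf : PolyTime fun p : α × σ => f p.1 p.2)
    (q : Polynomial ℕ) (hq : ∀ a s, sz (f a s) ≤ sz s + q.eval (sz a)) :
    PolyTime (fun a => (f a)^[n a] (s a)) := by
  simp only [iterate_eq_foldl]
  refine foldl_of_growth (f := fun a s _ => f a s) (replicate_unit hn) hs ?_ q fun a s b => ?_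
  · exact hf.comp' (f := fun p : α × σ × Unit => (p.1, p.2.1)) (by fun_prop)
  · have := q.eval_nat_mono (Nat.le_add_right (sz a) (sz b))
    have := hq a s
    omega

theorem iterate_of_bound {n : α → ℕ} {s : α → σ} {f : α → σ → σ} (hn : PolyTime n)
    (hs : PolyTime s) (hf : PolyTime fun p : α × σ => f p.1 p.2)
    (q : Polynomial ℕ) (hq : ∀ a, ∀ j ≤ n a, sz ((f a)^[j] (s a)) ≤ q.eval (sz a)) :
    PolyTime (fun a => (f a)^[n a] (s a)) := by
  simp only [iterate_eq_foldl]
  refine foldl_of_bound (f := fun a s _ => f a s) (replicate_unit hn) hs ?_ q fun a l' hl' => ?_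
  · exact hf.comp' (f := fun p : α × σ × Unit => (p.1, p.2.1)) (by fun_prop)
  · have h1 := hl'.length_le
    rw [List.length_replicate] at h1
    have h2 : l' = List.replicate l'.length () := by simp [List.eq_replicate_iff]
    rw [h2, ← iterate_eq_foldl]
    exact hq a _ h1

end PolyTime

namespace PolyTime

/-! ### Lists -/

@[fun_prop]
theorem list_reverse {l : α → List β} (hl : PolyTime l) : PolyTime (fun a => (l a).reverse) := by
  have : (fun a => (l a).reverse) = fun a => (l a).foldl (fun s b => b :: s) [] := by
    funext a; simp
  rw [this]
  refine foldl_of_growth (f := fun _ s b => b :: s) hl (by fun_prop) (by fun_prop)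
    (Polynomial.X + 1) fun a s b => ?_
  simp; omega

@[fun_prop]
theorem list_append {l m : α → List β} (hl : PolyTime l) (hm : PolyTime m) :
    PolyTime (fun a => l a ++ m a) := by
  have : (fun a => l a ++ m a) = fun a => (l a).reverse.foldl (fun s b => b :: s) (m a) := by
    funext a; simp
  rw [this]
  refine foldl_of_growth (f := fun _ s b => b :: s) (by fun_prop) (by fun_prop) (by fun_prop)
    (Polynomial.X + 1) fun a s b => ?_
  simp; omega

@[fun_prop]
theorem list_flatMap {l : α → List β} {f : α → β → List γ} (hl : PolyTime l)
    (hf : PolyTime fun p : α × β => f p.1 p.2) : PolyTime (fun a => (l a).flatMap (f a)) := by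
  have aux : ∀ (g : β → List γ) (l : List β) (s : List γ),
      l.foldl (fun s b => s ++ g b) s = s ++ l.flatMap g := by
    intro g l
    induction l with
    | nil => simp
    | cons b l ih => intro s; simp [ih]
  have : (fun a => (l a).flatMap (f a)) = fun a => (l a).foldl (fun s b => s ++ f a b) [] := by
    funext a; simp [aux]
  rw [this]
  obtain ⟨p, hp⟩ := exists_size_le hf
  refine foldl_of_growth (f := fun a s b => s ++ f a b) hl (by fun_prop) ?_
    (p.comp (Polynomial.X + 1)) fun a s b => ?_
  · exact list_append (by fun_prop)
      (hf.comp' (f := fun p : α × List γ × β => (p.1, p.2.2)) (by fun_prop))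
  · have h1 := hp (a, b)
    have h2 := sz_append s (f a b)
    simp only [sz_mk] at h1
    simp only [Polynomial.eval_comp, Polynomial.eval_add, Polynomial.eval_X, Polynomial.eval_one]
    omega

@[fun_prop]
theorem list_map {l : α → List β} {f : α → β → γ} (hl : PolyTime l)
    (hf : PolyTime fun p : α × β => f p.1 p.2) : PolyTime (fun a => (l a).map (f a)) := by
  have : (fun a => (l a).map (f a)) = fun a => (l a).flatMap (fun b => [f a b]) := by
    funext a; exact List.map_eq_flatMap
  rw [this]
  exact list_flatMap (f := fun a b => [f a b]) hl (by fun_prop)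

@[fun_prop]
theorem list_filter {l : α → List β} {f : α → β → Bool} (hl : PolyTime l)
    (hf : PolyTime fun p : α × β => f p.1 p.2) : PolyTime (fun a => (l a).filter (f a)) := by
  have : (fun a => (l a).filter (f a)) =
      fun a => (l a).flatMap (fun b => cond (f a b) [b] []) := by
    funext a
    induction l a with
    | nil => rfl
    | cons b l ih => cases h : f a b <;> simp [h, ih]
  rw [this]
  exact list_flatMap (f := fun a b => cond (f a b) [b] []) hl (by fun_prop)

@[fun_prop]
theorem list_any {l : α → List β} {f : α → β → Bool} (hl : PolyTime l)
    (hf : PolyTime fun p : α × β => f p.1 p.2) : PolyTime (fun a => (l a).any (f a)) := by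
  have : (fun a => (l a).any (f a)) = fun a => !((l a).filter (f a)).isEmpty := by
    funext a
    induction l a with
    | nil => rfl
    | cons b l ih => cases h : f a b <;> simp [h, ih]
  rw [this]
  fun_prop

@[fun_prop]
theorem list_all {l : α → List β} {f : α → β → Bool} (hl : PolyTime l)
    (hf : PolyTime fun p : α × β => f p.1 p.2) : PolyTime (fun a => (l a).all (f a)) := by
  have : (fun a => (l a).all (f a)) = fun a => !(l a).any (fun b => !f a b) := by
    funext a
    induction l a with
    | nil => rfl
    | cons b l ih => cases h : f a b <;> simp [h, ih]
  rw [this]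
  exact not' (list_any (f := fun a b => !f a b) hl (by fun_prop))

/-! ### Unary numbers -/

@[fun_prop]
theorem nat_succ {n : α → ℕ} (hn : PolyTime n) : PolyTime (fun a => n a + 1) :=
  (of_enc_eq (f := fun p : Unit × ℕ => p.2 + 1) fun _ => rfl).comp' ((const' ()).prodMk hn)

@[fun_prop]
theorem nat_pred {n : α → ℕ} (hn : PolyTime n) : PolyTime (fun a => n a - 1) :=
  (of_enc_eq_snd (f := fun n : ℕ => n - 1) fun n => by cases n <;> rfl).comp' hn

@[fun_prop]
theorem nat_isZero {n : α → ℕ} (hn : PolyTime n) : PolyTime (fun a => (n a).beq 0) :=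
  branch (c := n) hn (const' false) (const' true)
    (fun a u v h => by cases hn : n a with
      | zero => simp [hn, enc, Data.ofNat] at h
      | succ k => rfl)
    (fun a h => by cases hn : n a <;> simp_all [enc, Data.ofNat])

@[fun_prop]
theorem nat_add {m n : α → ℕ} (hm : PolyTime m) (hn : PolyTime n) :
    PolyTime (fun a => m a + n a) := by
  have : (fun a => m a + n a) = fun a => (fun s => s + 1)^[n a] (m a) := by
    funext a; simp
  rw [this]
  exact iterate_of_growth (f := fun _ s => s + 1) hn hm (by fun_prop) 2
    fun a s => by simp; omega

@[fun_prop]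
theorem nat_sub {m n : α → ℕ} (hm : PolyTime m) (hn : PolyTime n) :
    PolyTime (fun a => m a - n a) := by
  have : (fun a => m a - n a) = fun a => (fun s => s - 1)^[n a] (m a) := by
    funext a; exact (Nat.pred_iterate _ _).symm
  rw [this]
  exact iterate_of_growth (f := fun _ s => s - 1) hn hm (by fun_prop) 0
    fun a s => by simp

@[fun_prop]
theorem nat_mul {m n : α → ℕ} (hm : PolyTime m) (hn : PolyTime n) :
    PolyTime (fun a => m a * n a) := by
  have : (fun a => m a * n a) = fun a => (fun s => s + m a)^[n a] 0 := by
    funext a; simp [mul_comm]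
  rw [this]
  obtain ⟨p, hp⟩ := exists_size_le hm
  exact iterate_of_growth (f := fun a s => s + m a) hn (by fun_prop) (by fun_prop) p
    fun a s => by have := hp a; simp at *; omega

@[fun_prop]
theorem nat_ble {m n : α → ℕ} (hm : PolyTime m) (hn : PolyTime n) :
    PolyTime (fun a => (m a).ble (n a)) := by
  have : (fun a => (m a).ble (n a)) = fun a => (m a - n a).beq 0 := by
    funext a; rw [Bool.eq_iff_iff]; simp; omega
  rw [this]; fun_prop

@[fun_prop]
theorem nat_beq {m n : α → ℕ} (hm : PolyTime m) (hn : PolyTime n) :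
    PolyTime (fun a => (m a).beq (n a)) := by
  have : (fun a => (m a).beq (n a)) = fun a => (m a).ble (n a) && (n a).ble (m a) := by
    funext a; rw [Bool.eq_iff_iff]; simp; omega
  rw [this]; fun_prop

@[fun_prop]
theorem nat_min {m n : α → ℕ} (hm : PolyTime m) (hn : PolyTime n) :
    PolyTime (fun a => min (m a) (n a)) := by
  have : (fun a => min (m a) (n a)) = fun a => cond ((m a).ble (n a)) (m a) (n a) := by
    funext a
    cases h : (m a).ble (n a) <;> simp [Nat.ble_eq, ← Bool.not_eq_true] at h ⊢ <;> omega
  rw [this]; fun_prop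

@[fun_prop]
theorem list_length {l : α → List β} (hl : PolyTime l) : PolyTime (fun a => (l a).length) := by
  have h : ∀ l : List Unit, enc l.length = enc l := fun l => by
    rw [← enc_replicate_unit]; congr 1; exact (List.eq_replicate_iff.2 ⟨rfl, by simp⟩).symm
  have := (of_enc_eq h).comp' (list_map (f := fun _ _ => ()) hl (by fun_prop))
  simpa using this

@[fun_prop]
theorem list_replicate {n : α → ℕ} {b : α → β} (hn : PolyTime n) (hb : PolyTime b) :
    PolyTime (fun a => List.replicate (n a) (b a)) := by
  have := list_map (f := fun a _ => b a) (replicate_unit hn) (by fun_prop)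
  simpa using this

@[fun_prop]
theorem list_drop {n : α → ℕ} {l : α → List β} (hn : PolyTime n) (hl : PolyTime l) :
    PolyTime (fun a => (l a).drop (n a)) := by
  have : (fun a => (l a).drop (n a)) = fun a => List.tail^[n a] (l a) := by
    funext a; exact (List.tail_iterate _ _).symm
  rw [this]
  exact iterate_of_growth (f := fun _ s => s.tail) hn hl (by fun_prop) 0
    fun a s => by simpa using sz_sublist_le (List.tail_sublist s)

@[fun_prop]
theorem list_take {n : α → ℕ} {l : α → List β} (hn : PolyTime n) (hl : PolyTime l) :
    PolyTime (fun a => (l a).take (n a)) := by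
  have : (fun a => (l a).take (n a)) = fun a =>
      ((l a).reverse.drop ((l a).length - n a)).reverse := by
    funext a
    rw [List.drop_reverse, List.reverse_reverse, List.take_eq_take_iff]
    omega
  rw [this]
  fun_prop

@[fun_prop]
theorem list_range {n : α → ℕ} (hn : PolyTime n) : PolyTime (fun a => List.range (n a)) := by
  have key : ∀ j : ℕ, (fun s : List ℕ => s ++ [s.length])^[j] [] = List.range j := by
    intro j
    induction j with
    | zero => rfl
    | succ j ih => rw [Function.iterate_succ_apply', ih, List.range_succ]; simp
  simp only [← key]
  obtain ⟨p, hp⟩ := exists_size_le hn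
  -- The appended number is the length of the state, so the growth per step is not bounded by the
  -- context alone; the states themselves are bounded instead.
  refine iterate_of_bound (f := fun _ s => s ++ [s.length]) hn (by fun_prop) (by fun_prop)
    (1 + p * (2 * p + 2)) fun a j hj => ?_
  rw [key]
  have h1 : ∀ i, i ≤ j → sz (List.range i) ≤ 1 + i * (2 * j + 2) := by
    intro i
    induction i with
    | zero => intro _; simp
    | succ i ih =>
      intro hi
      have := ih (by omega)
      have h2 := sz_append (List.range i) [i]
      rw [List.range_succ, Nat.add_mul]
      simp at h2
      omega
  have h2 := h1 j le_rfl
  have h3 : j ≤ p.eval (sz a) := by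
    have := hp a
    rw [sz_nat] at this
    omega
  have h4 : j * (2 * j + 2) ≤ p.eval (sz a) * (2 * p.eval (sz a) + 2) := by gcongr
  simp only [Polynomial.eval_add, Polynomial.eval_mul, Polynomial.eval_one,
    Polynomial.eval_ofNat]
  omega

@[fun_prop]
theorem list_sum {l : α → List ℕ} (hl : PolyTime l) : PolyTime (fun a => (l a).sum) := by
  simp only [List.sum_eq_foldl]
  exact foldl_of_growth (f := fun _ s b => s + b) hl (by fun_prop) (by fun_prop) Polynomial.X
    fun a s b => by simp; omega

theorem eval_nat (p : Polynomial ℕ) {n : α → ℕ} (hn : PolyTime n) :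
    PolyTime (fun a => p.eval (n a)) := by
  induction p using Polynomial.induction_on' with
  | add p q hp hq => simp only [Polynomial.eval_add]; fun_prop
  | monomial k c =>
    simp only [Polynomial.eval_monomial]
    have : PolyTime fun a => n a ^ k := by
      induction k with
      | zero => simp only [pow_zero]; fun_prop
      | succ k ih => simp only [pow_succ]; fun_prop
    fun_prop

/-! ### Options and equality -/

attribute [fun_prop] option_elim eval_nat

@[fun_prop]
theorem option_isSome {o : α → Option β} (ho : PolyTime o) : PolyTime (fun a => (o a).isSome) := by
  have : (fun a => (o a).isSome) = fun a => (o a).elim false (fun _ => true) := by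
    funext a; cases o a <;> rfl
  rw [this]; fun_prop

@[fun_prop]
theorem option_getD {o : α → Option β} {b : α → β} (ho : PolyTime o) (hb : PolyTime b) :
    PolyTime (fun a => (o a).getD (b a)) := by
  have : (fun a => (o a).getD (b a)) = fun a => (o a).elim (b a) (fun b => b) := by
    funext a; cases o a <;> rfl
  rw [this]; fun_prop

/-- Equality of bit strings. -/
def _root_.eqBits (l m : List Bool) : Bool :=
  l.length.beq m.length &&
    (List.range l.length).all fun i => !(((l.drop i).headD false) ^^ ((m.drop i).headD false))

theorem _root_.eqBits_iff (l m : List Bool) : eqBits l m = true ↔ l = m := by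
  simp only [eqBits, Bool.and_eq_true, Nat.beq_eq, List.all_eq_true, List.mem_range]
  constructor
  · rintro ⟨h1, h2⟩
    refine List.ext_getElem h1 fun i hi hi' => ?_
    have := h2 i hi
    simpa [List.head?_drop, hi, hi'] using this
  · rintro rfl; simp

@[fun_prop]
theorem xor' {f g : α → Bool} (hf : PolyTime f) (hg : PolyTime g) :
    PolyTime (fun a => f a ^^ g a) := by
  have : (fun a => f a ^^ g a) = fun a => cond (f a) (!g a) (g a) := by
    funext a; cases f a <;> cases g a <;> rfl
  rw [this]; fun_prop

@[fun_prop]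
theorem eqBits' {f g : α → List Bool} (hf : PolyTime f) (hg : PolyTime g) :
    PolyTime (fun a => eqBits (f a) (g a)) := by
  unfold eqBits; fun_prop

open Classical in
-- The finite set is wired into the program as a table, so nothing about it needs to be computable.
-- Applied to the positive kernel outputs of bounded size, this gives the oracle for the base class.
theorem decide_mem_finite {T : Set (List Bool × ℕ)} (hT : T.Finite)
    {f : α → List Bool × ℕ} (hf : PolyTime f) : PolyTime (fun a => decide (f a ∈ T)) := by
  induction T, hT using Set.Finite.induction_on with
  | empty => simp only [Set.mem_empty_iff_false, decide_false]; fun_prop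
  | @insert y T _ _ ih =>
    have : (fun a => decide (f a ∈ insert y T)) = fun a =>
        (eqBits (f a).1 y.1 && (f a).2.beq y.2) || decide (f a ∈ T) := by
      funext a
      rw [Bool.eq_iff_iff]
      simp [eqBits_iff, Prod.ext_iff]
    have h : PolyTime fun a => (eqBits (f a).1 y.1 && (f a).2.beq y.2) || decide (f a ∈ T) := by
      fun_prop
    rw [← this] at h
    convert h

end PolyTime

/-! ### Vertex covers inside a finite set of vertices -/

section Covers

set_option linter.unusedSectionVars false

variable {V W : Type} [DecidableEq V] [DecidableEq W] {G : SimpleGraph V} {H : SimpleGraph W}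
  {S T A B Y Z : Finset V}

/-- `T` is a vertex cover of the subgraph induced by `S`. -/
def CoversOn (G : SimpleGraph V) (S T : Finset V) : Prop :=
  T ⊆ S ∧ ∀ u ∈ S, ∀ v ∈ S, G.Adj u v → u ∈ T ∨ v ∈ T

/-- The vertex cover number of the subgraph induced by `S`. -/
noncomputable def coverNum (G : SimpleGraph V) (S : Finset V) : ℕ :=
  sInf {m | ∃ T, CoversOn G S T ∧ T.card = m}

/-- No minimum vertex cover of the subgraph induced by `S` contains `Y`. -/
def BlocksOn (G : SimpleGraph V) (S Y : Finset V) : Prop :=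
  ∀ T, CoversOn G S T → Y ⊆ T → coverNum G S < T.card

open Classical in
/-- The vertices of `S` with a neighbour in `Z`. -/
noncomputable def nbrsIn (G : SimpleGraph V) (S Z : Finset V) : Finset V :=
  S.filter fun u => ∃ z ∈ Z, G.Adj z u

/-- There are no edges between `A` and `B`. -/
def NoEdges (G : SimpleGraph V) (A B : Finset V) : Prop := ∀ a ∈ A, ∀ b ∈ B, ¬ G.Adj a b

theorem coversOn_self : CoversOn G S S := ⟨subset_rfl, fun _ h _ _ _ => Or.inl h⟩

theorem CoversOn.coverNum_le (h : CoversOn G S T) : coverNum G S ≤ T.card :=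
  Nat.sInf_le ⟨T, h, rfl⟩

theorem exists_coversOn_card_eq (G : SimpleGraph V) (S : Finset V) :
    ∃ T, CoversOn G S T ∧ T.card = coverNum G S :=
  Nat.sInf_mem (s := {m | ∃ T, CoversOn G S T ∧ T.card = m}) ⟨_, S, coversOn_self, rfl⟩

theorem coverNum_le_card : coverNum G S ≤ S.card := coversOn_self.coverNum_le

theorem CoversOn.inter (h : CoversOn G S T) (hA : A ⊆ S) : CoversOn G A (T ∩ A) :=
  ⟨Finset.inter_subset_right, fun u hu v hv huv => by
    simpa [hu, hv] using h.2 u (hA hu) v (hA hv) huv⟩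

theorem CoversOn.sdiff (h : CoversOn G S T) : CoversOn G (S \ Y) (T \ Y) :=
  ⟨Finset.sdiff_subset_sdiff h.1 subset_rfl, fun u hu v hv huv => by
    simp only [Finset.mem_sdiff] at *
    rcases h.2 u hu.1 v hv.1 huv with h | h <;> tauto⟩

theorem CoversOn.union_of_sdiff (h : CoversOn G (S \ Y) T) (hY : Y ⊆ S) :
    CoversOn G S (Y ∪ T) := by
  refine ⟨Finset.union_subset hY (h.1.trans Finset.sdiff_subset), fun u hu v hv huv => ?_⟩
  simp only [Finset.mem_union]
  by_cases h1 : u ∈ Y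
  · tauto
  by_cases h2 : v ∈ Y
  · tauto
  rcases h.2 u (by simp [hu, h1]) v (by simp [hv, h2]) huv with h | h <;> tauto

theorem BlocksOn.mono (h : BlocksOn G S Y) (hYZ : Y ⊆ Z) : BlocksOn G S Z :=
  fun T hT hZ => h T hT (hYZ.trans hZ)

theorem not_blocksOn_empty : ¬ BlocksOn G S ∅ := fun h => by
  obtain ⟨T, hT, hc⟩ := exists_coversOn_card_eq G S
  exact (h T hT (by simp)).ne' hc

theorem exists_of_not_blocksOn (h : ¬ BlocksOn G S Y) :
    ∃ T, CoversOn G S T ∧ Y ⊆ T ∧ T.card = coverNum G S := by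
  simp only [BlocksOn, not_forall, not_lt] at h
  obtain ⟨T, hT, hY, hc⟩ := h
  exact ⟨T, hT, hY, hc.antisymm hT.coverNum_le⟩

theorem coverNum_le_card_add_sdiff (hY : Y ⊆ S) :
    coverNum G S ≤ Y.card + coverNum G (S \ Y) := by
  obtain ⟨T, hT, hc⟩ := exists_coversOn_card_eq G (S \ Y)
  rw [← hc]
  exact (hT.union_of_sdiff hY).coverNum_le.trans (Finset.card_union_le _ _)

/-- A smallest cover containing Y consists of Y and a minimum cover of the rest. Blocking thus
becomes a comparison of cover numbers, which is how the algorithm tests it. -/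
theorem blocksOn_iff (hY : Y ⊆ S) :
    BlocksOn G S Y ↔ coverNum G S < Y.card + coverNum G (S \ Y) := by
  constructor
  · intro h
    obtain ⟨T, hT, hc⟩ := exists_coversOn_card_eq G (S \ Y)
    rw [← hc]
    exact (h _ (hT.union_of_sdiff hY) Finset.subset_union_left).trans_le
      (Finset.card_union_le _ _)
  · intro h T hT hYT
    have h1 := (hT.sdiff (Y := Y)).coverNum_le
    have h2 := Finset.card_sdiff_add_card_eq_card hYT
    omega

theorem coverNum_union (hd : Disjoint A B) (hn : NoEdges G A B) :
    coverNum G (A ∪ B) = coverNum G A + coverNum G B := by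
  apply le_antisymm
  · obtain ⟨T, hT, hc⟩ := exists_coversOn_card_eq G A
    obtain ⟨T', hT', hc'⟩ := exists_coversOn_card_eq G B
    have : CoversOn G (A ∪ B) (T ∪ T') := by
      refine ⟨Finset.union_subset_union hT.1 hT'.1, fun u hu v hv huv => ?_⟩
      simp only [Finset.mem_union] at *
      rcases hu with hu | hu <;> rcases hv with hv | hv
      · rcases hT.2 u hu v hv huv with h | h <;> tauto
      · exact absurd huv (hn u hu v hv)
      · exact absurd huv.symm (hn v hv u hu)
      · rcases hT'.2 u hu v hv huv with h | h <;> tauto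
    rw [← hc, ← hc']
    exact this.coverNum_le.trans (Finset.card_union_le _ _)
  · obtain ⟨T, hT, hc⟩ := exists_coversOn_card_eq G (A ∪ B)
    have h1 := (hT.inter (Finset.subset_union_left (s₁ := A))).coverNum_le
    have h2 := (hT.inter (Finset.subset_union_right (s₁ := A))).coverNum_le
    have h3 : (T ∩ A ∪ T ∩ B).card = (T ∩ A).card + (T ∩ B).card :=
      Finset.card_union_of_disjoint
        (hd.mono Finset.inter_subset_right Finset.inter_subset_right)
    have h4 : (T ∩ A ∪ T ∩ B).card ≤ T.card :=
      Finset.card_le_card (Finset.union_subset Finset.inter_subset_left Finset.inter_subset_left)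
    omega

theorem coverNum_biUnion {ι : Type} [DecidableEq ι] {J : Finset ι} {P : ι → Finset V}
    (hd : ∀ i ∈ J, ∀ j ∈ J, i ≠ j → Disjoint (P i) (P j))
    (hn : ∀ i ∈ J, ∀ j ∈ J, i ≠ j → NoEdges G (P i) (P j)) :
    coverNum G (J.biUnion P) = ∑ j ∈ J, coverNum G (P j) := by
  induction J using Finset.induction_on with
  | empty => simpa using coverNum_le_card (G := G) (S := ∅)
  | insert a J ha ih =>
    have hne : ∀ j ∈ J, a ≠ j := fun j hj h => ha (h ▸ hj)
    rw [Finset.biUnion_insert, Finset.sum_insert ha, coverNum_union, ih]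
    · exact fun i hi j hj => hd i (by simp [hi]) j (by simp [hj])
    · exact fun i hi j hj => hn i (by simp [hi]) j (by simp [hj])
    · rw [Finset.disjoint_biUnion_right]
      exact fun j hj => hd a (by simp) j (by simp [hj]) (hne j hj)
    · intro u hu v hv
      obtain ⟨j, hj, hv⟩ := Finset.mem_biUnion.1 hv
      exact hn a (by simp) j (by simp [hj]) (hne j hj) u hu v hv

theorem BlocksOn.union (hd : Disjoint A B) (hn : NoEdges G A B) (hYA : Y ⊆ A)
    (h : BlocksOn G A Y) : BlocksOn G (A ∪ B) Y := by
  intro T hT hY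
  rw [coverNum_union hd hn]
  have h1 := h _ (hT.inter (Finset.subset_union_left (s₁ := A))) (Finset.subset_inter hY hYA)
  have h2 := (hT.inter (Finset.subset_union_right (s₁ := A))).coverNum_le
  have h3 : (T ∩ A ∪ T ∩ B).card = (T ∩ A).card + (T ∩ B).card :=
    Finset.card_union_of_disjoint
      (hd.mono Finset.inter_subset_right Finset.inter_subset_right)
  have h4 : (T ∩ A ∪ T ∩ B).card ≤ T.card :=
    Finset.card_le_card (Finset.union_subset Finset.inter_subset_left Finset.inter_subset_left)
  omega

/-- If neither part is blocked, minimum covers of the two parts containing their shares of Y unite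
to a minimum cover containing Y. -/
theorem BlocksOn.of_union (hd : Disjoint A B) (hn : NoEdges G A B) (hY : Y ⊆ A ∪ B)
    (h : BlocksOn G (A ∪ B) Y) : BlocksOn G A (Y ∩ A) ∨ BlocksOn G B (Y ∩ B) := by
  by_contra hcon
  rw [not_or] at hcon
  obtain ⟨T, hT, hYT, hc⟩ := exists_of_not_blocksOn hcon.1
  obtain ⟨T', hT', hYT', hc'⟩ := exists_of_not_blocksOn hcon.2
  have : CoversOn G (A ∪ B) (T ∪ T') := by
    refine ⟨Finset.union_subset_union hT.1 hT'.1, fun u hu v hv huv => ?_⟩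
    simp only [Finset.mem_union] at *
    rcases hu with hu | hu <;> rcases hv with hv | hv
    · rcases hT.2 u hu v hv huv with h | h <;> tauto
    · exact absurd huv (hn u hu v hv)
    · exact absurd huv.symm (hn v hv u hu)
    · rcases hT'.2 u hu v hv huv with h | h <;> tauto
  have h1 := h _ this (by
    intro y hy
    rcases Finset.mem_union.1 (hY hy) with h | h
    · exact Finset.mem_union_left _ (hYT (Finset.mem_inter.2 ⟨hy, h⟩))
    · exact Finset.mem_union_right _ (hYT' (Finset.mem_inter.2 ⟨hy, h⟩)))
  have h2 := Finset.card_union_le T T'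
  rw [coverNum_union hd hn] at h1
  omega

/-! ### Branching on a vertex -/

/-- A blocking set is blocked within few vertices if this is so after deleting a vertex and after
deleting its closed neighbourhood. -/
theorem BlocksOn.exists_small_of_branch {v : V} (hv : v ∈ S) {b : ℕ}
    (h1 : ∀ Y ⊆ S.erase v, BlocksOn G (S.erase v) Y →
      ∃ Y' ⊆ Y, BlocksOn G (S.erase v) Y' ∧ Y'.card ≤ b)
    (h2 : ∀ Y ⊆ (S.erase v) \ nbrsIn G S {v}, BlocksOn G ((S.erase v) \ nbrsIn G S {v}) Y →
      ∃ Y' ⊆ Y, BlocksOn G ((S.erase v) \ nbrsIn G S {v}) Y' ∧ Y'.card ≤ b)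
    (hYS : Y ⊆ S) (hY : BlocksOn G S Y) :
    ∃ Y' ⊆ Y, BlocksOn G S Y' ∧ Y'.card ≤ 2 * b + 1 := by
  have hsv : S \ {v} = S.erase v := by ext; simp [and_comm]
  have memN : ∀ u, u ∈ nbrsIn G S {v} ↔ u ∈ S ∧ G.Adj v u := by intro u; simp [nbrsIn]
  -- Covers that contain v: the rest of such a cover is a cover of S − v.
  have part1 : ∃ Y' ⊆ Y, Y'.card ≤ b ∧
      ∀ T, CoversOn G S T → v ∈ T → Y' ⊆ T → coverNum G S < T.card := by
    have hle : coverNum G S ≤ 1 + coverNum G (S.erase v) := by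
      have := coverNum_le_card_add_sdiff (G := G) (Y := {v}) (S := S) (by simpa using hv)
      rwa [hsv, Finset.card_singleton] at this
    by_cases hb : BlocksOn G (S.erase v) (Y.erase v)
    · obtain ⟨Y', hY', hB, hc⟩ := h1 _ (Finset.erase_subset_erase v hYS) hb
      refine ⟨Y', hY'.trans (Finset.erase_subset _ _), hc, fun T hT hvT hYT => ?_⟩
      have h3 := hT.sdiff (Y := {v})
      rw [hsv] at h3
      have h4 := hB _ h3 (fun y hy => by
        have := Finset.mem_erase.1 (hY' hy)
        simp [hYT hy, this.1])
      have h5 := Finset.card_sdiff_add_card_eq_card (Finset.singleton_subset_iff.2 hvT)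
      rw [Finset.card_singleton] at h5
      omega
    -- Here v and a minimum cover of S − v form a cover containing Y. By `hY` it is not minimum, so
    -- no minimum cover contains v, and nothing has to be selected.
    · obtain ⟨T, hT, hYT, hc⟩ := exists_of_not_blocksOn hb
      refine ⟨∅, by simp, by simp, fun T' hT' hvT' _ => ?_⟩
      rw [← hsv] at hT
      have h3 := hY _ (hT.union_of_sdiff (by simpa using hv)) (fun y hy => by
        by_cases hyv : y = v
        · simp [hyv]
        · exact Finset.mem_union_right _ (hYT (by simp [hy, hyv])))
      have h4 := Finset.card_union_le {v} T
      have h5 := hT'.sdiff (Y := {v})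
      rw [hsv] at h5
      have h6 := h5.coverNum_le
      have h7 := Finset.card_sdiff_add_card_eq_card (Finset.singleton_subset_iff.2 hvT')
      rw [Finset.card_singleton] at h4 h7
      omega
  -- Covers that avoid v: they contain all neighbours of v, and what remains is a cover of S − N[v].
  have part2 : ∃ Y' ⊆ Y, Y'.card ≤ b + 1 ∧
      ∀ T, CoversOn G S T → v ∉ T → Y' ⊆ T → coverNum G S < T.card := by
    by_cases hvY : v ∈ Y
    -- If v lies in Y, it alone excludes these covers. As b may be 0, this is the reason for the +
    -- 1.
    · exact ⟨{v}, by simpa using hvY, by simp, fun T _ hvT hYT => absurd (hYT (by simp)) hvT⟩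
    set N := nbrsIn G S {v} with hN
    set S' := S.erase v \ N with hS'
    have hNS : N ⊆ S := fun u hu => ((memN u).1 hu).1
    have hcov : ∀ T, CoversOn G S' T → CoversOn G S (N ∪ T) := by
      intro T hT
      refine ⟨Finset.union_subset hNS (hT.1.trans ?_), fun u hu w hw huw => ?_⟩
      · exact Finset.sdiff_subset.trans (Finset.erase_subset _ _)
      simp only [Finset.mem_union]
      by_cases hu' : u ∈ N
      · tauto
      by_cases hw' : w ∈ N
      · tauto
      by_cases huv : u = v
      · subst huv; exact absurd ((memN w).2 ⟨hw, huw⟩) hw'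
      by_cases hwv : w = v
      · subst hwv; exact absurd ((memN u).2 ⟨hu, huw.symm⟩) hu'
      rcases hT.2 u (by simp [hS', hu, hu', huv]) w (by simp [hS', hw, hw', hwv]) huw with h | h <;>
        tauto
    have hNT : ∀ T, CoversOn G S T → v ∉ T → N ⊆ T := by
      intro T hT hvT u hu
      have := (memN u).1 hu
      exact (hT.2 v hv u this.1 this.2).resolve_left hvT
    have hrest : ∀ T, CoversOn G S T → v ∉ T → CoversOn G S' (T \ N) := by
      intro T hT hvT
      have h3 := hT.sdiff (Y := insert v N)
      have e1 : S \ insert v N = S' := by ext; simp [hS']; tauto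
      have e2 : T \ insert v N = T \ N := by
        ext x; simp; intro hx _ hxv; exact hvT (hxv ▸ hx)
      rwa [e1, e2] at h3
    have hYsub : Y \ N ⊆ S' := by
      intro y hy
      simp only [Finset.mem_sdiff] at hy
      simp only [hS', Finset.mem_sdiff, Finset.mem_erase]
      exact ⟨⟨fun h => hvY (h ▸ hy.1), hYS hy.1⟩, hy.2⟩
    by_cases hb : BlocksOn G S' (Y \ N)
    · obtain ⟨Y', hY', hB, hc⟩ := h2 _ hYsub hb
      refine ⟨Y', hY'.trans Finset.sdiff_subset, by omega, fun T hT hvT hYT => ?_⟩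
      have h3 := hB _ (hrest T hT hvT) (fun y hy => by
        have := Finset.mem_sdiff.1 (hY' hy)
        simp [hYT hy, this.2])
      have h4 := Finset.card_sdiff_add_card_eq_card (hNT T hT hvT)
      obtain ⟨T', hT', hc'⟩ := exists_coversOn_card_eq G S'
      have h5 := (hcov T' hT').coverNum_le
      have h6 := Finset.card_union_le N T'
      omega
    -- The neighbourhood with a minimum cover of the rest contains Y, so by `hY` no minimum cover
    -- avoids v.
    · obtain ⟨T', hT', hYT', hc'⟩ := exists_of_not_blocksOn hb
      refine ⟨∅, by simp, by simp, fun T hT hvT _ => ?_⟩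
      have h3 := hY _ (hcov T' hT') (fun y hy => by
        by_cases hyN : y ∈ N
        · simp [hyN]
        · exact Finset.mem_union_right _ (hYT' (by simp [hy, hyN])))
      have h4 := Finset.card_union_le N T'
      have h5 := (hrest T hT hvT).coverNum_le
      have h6 := Finset.card_sdiff_add_card_eq_card (hNT T hT hvT)
      omega
  obtain ⟨Y1, hY1, hc1, hB1⟩ := part1
  obtain ⟨Y2, hY2, hc2, hB2⟩ := part2
  refine ⟨Y1 ∪ Y2, Finset.union_subset hY1 hY2, fun T hT hYT => ?_,
    (Finset.card_union_le _ _).trans (by omega)⟩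
  by_cases hvT : v ∈ T
  · exact hB1 T hT hvT (Finset.subset_union_left.trans hYT)
  · exact hB2 T hT hvT (Finset.subset_union_right.trans hYT)

/-- A cover contains v, or it contains all neighbours of v and covers what is left. This is the
recursion evaluated by `branchNums`. -/
theorem coverNum_branch {v : V} (hv : v ∈ S) :
    coverNum G S = min (coverNum G (S.erase v) + 1)
      ((nbrsIn G S {v}).card + coverNum G ((S.erase v) \ nbrsIn G S {v})) := by
  have hsv : S \ {v} = S.erase v := by ext; simp [and_comm]
  have memN : ∀ u, u ∈ nbrsIn G S {v} ↔ u ∈ S ∧ G.Adj v u := by intro u; simp [nbrsIn]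
  have hvN : v ∉ nbrsIn G S {v} := fun h => G.loopless.irrefl v ((memN v).1 h).2
  apply le_antisymm
  · rw [le_min_iff]
    constructor
    · have := coverNum_le_card_add_sdiff (G := G) (Y := {v}) (S := S) (by simpa using hv)
      rw [hsv, Finset.card_singleton] at this
      omega
    · obtain ⟨T, hT, hc⟩ := exists_coversOn_card_eq G (S.erase v \ nbrsIn G S {v})
      rw [← hc]
      refine (CoversOn.coverNum_le (T := nbrsIn G S {v} ∪ T) ⟨?_, ?_⟩).trans
        (Finset.card_union_le _ _)
      · refine Finset.union_subset (fun u hu => ((memN u).1 hu).1) (hT.1.trans ?_)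
        exact Finset.sdiff_subset.trans (Finset.erase_subset _ _)
      · intro u hu w hw huw
        simp only [Finset.mem_union]
        by_cases hu' : u ∈ nbrsIn G S {v}
        · tauto
        by_cases hw' : w ∈ nbrsIn G S {v}
        · tauto
        by_cases huv : u = v
        · subst huv; exact absurd ((memN w).2 ⟨hw, huw⟩) hw'
        by_cases hwv : w = v
        · subst hwv; exact absurd ((memN u).2 ⟨hu, huw.symm⟩) hu'
        rcases hT.2 u (by simp [hu, hu', huv]) w (by simp [hw, hw', hwv]) huw with h | h <;>
          tauto
  · obtain ⟨T, hT, hc⟩ := exists_coversOn_card_eq G S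
    by_cases hvT : v ∈ T
    · refine (min_le_left _ _).trans ?_
      have h5 := hT.sdiff (Y := {v})
      rw [hsv] at h5
      have h6 := h5.coverNum_le
      have h7 := Finset.card_sdiff_add_card_eq_card (Finset.singleton_subset_iff.2 hvT)
      rw [Finset.card_singleton] at h7
      omega
    · refine (min_le_right _ _).trans ?_
      have hNT : nbrsIn G S {v} ⊆ T := by
        intro u hu
        have := (memN u).1 hu
        exact (hT.2 v hv u this.1 this.2).resolve_left hvT
      have h3 := hT.sdiff (Y := insert v (nbrsIn G S {v}))
      have e1 : S \ insert v (nbrsIn G S {v}) = S.erase v \ nbrsIn G S {v} := by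
        ext; simp; tauto
      have e2 : T \ insert v (nbrsIn G S {v}) = T \ nbrsIn G S {v} := by
        ext x; simp; intro hx _ hxv; exact hvT (hxv ▸ hx)
      rw [e1, e2] at h3
      have h4 := h3.coverNum_le
      have h6 := Finset.card_sdiff_add_card_eq_card hNT
      omega

/-! ### Transport along embeddings -/

theorem coversOn_map (f : V ↪ W) :
    CoversOn H (S.map f) (T.map f) ↔ CoversOn (H.comap f) S T := by
  simp only [CoversOn, Finset.map_subset_map, Finset.forall_mem_map, SimpleGraph.comap_adj,
    Finset.mem_map']

theorem exists_map_of_coversOn_map (f : V ↪ W) {T : Finset W} (h : CoversOn H (S.map f) T) :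
    ∃ T', T = T'.map f ∧ CoversOn (H.comap f) S T' := by
  obtain ⟨T', _, rfl⟩ := Finset.subset_map_iff.1 h.1
  exact ⟨T', rfl, (coversOn_map f).1 h⟩

theorem coverNum_map (f : V ↪ W) : coverNum H (S.map f) = coverNum (H.comap f) S := by
  apply le_antisymm
  · obtain ⟨T, hT, hc⟩ := exists_coversOn_card_eq (H.comap f) S
    have := ((coversOn_map f).2 hT).coverNum_le
    rwa [Finset.card_map, hc] at this
  · obtain ⟨T, hT, hc⟩ := exists_coversOn_card_eq H (S.map f)
    obtain ⟨T', rfl, hT'⟩ := exists_map_of_coversOn_map f hT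
    rw [Finset.card_map] at hc
    exact hc ▸ hT'.coverNum_le

theorem blocksOn_map (f : V ↪ W) :
    BlocksOn H (S.map f) (Y.map f) ↔ BlocksOn (H.comap f) S Y := by
  constructor
  · intro h T hT hY
    have := h _ ((coversOn_map f).2 hT) (Finset.map_subset_map.2 hY)
    rwa [coverNum_map, Finset.card_map] at this
  · intro h T hT hY
    obtain ⟨T', rfl, hT'⟩ := exists_map_of_coversOn_map f hT
    rw [coverNum_map, Finset.card_map]
    exact h _ hT' (Finset.map_subset_map.1 hY)

/-! ### Deleting pieces -/

/-- The deletion rule: pieces `P h`, `h ∈ U`, may be removed from the graph if there is a set `R` of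
subsets of `X` matched to other pieces which they block, such that every subset of `X` that blocks a
deleted piece, or a matched one, contains a member of `R`. -/
theorem coverNum_delete_pieces [Nonempty V] {ι κ : Type} [DecidableEq ι] [DecidableEq κ]
    {X : Finset V} {J U : Finset ι} {P : ι → Finset V} {R : Finset κ} {Z : κ → Finset V}
    {owner : κ → ι}
    (hd : ∀ i ∈ J, ∀ j ∈ J, i ≠ j → Disjoint (P i) (P j))
    (hn : ∀ i ∈ J, ∀ j ∈ J, i ≠ j → NoEdges G (P i) (P j))
    (hX : ∀ i ∈ J, Disjoint X (P i)) (hU : U ⊆ J)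
    (hinj : Set.InjOn owner R) (howner : ∀ j ∈ R, owner j ∈ J \ U)
    (hZX : ∀ j ∈ R, Z j ⊆ X)
    (hblock : ∀ j ∈ R, BlocksOn G (P (owner j)) (nbrsIn G (P (owner j)) (Z j)))
    (hclosed : ∀ h, h ∈ U ∨ h ∈ R.image owner → ∀ Y ⊆ X, BlocksOn G (P h) (nbrsIn G (P h) Y) →
      ∃ j ∈ R, Z j ⊆ Y) :
    coverNum G (X ∪ J.biUnion P) =
      coverNum G (X ∪ (J \ U).biUnion P) + ∑ h ∈ U, coverNum G (P h) := by
  have hmemP : ∀ h ∈ J, P h ⊆ X ∪ J.biUnion P := fun h hh =>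
    (Finset.subset_biUnion_of_mem P hh).trans Finset.subset_union_right
  apply le_antisymm
  · obtain ⟨T, hT, hc⟩ := exists_coversOn_card_eq G (X ∪ (J \ U).biUnion P)
    have hmemP' : ∀ h ∈ J \ U, P h ⊆ X ∪ (J \ U).biUnion P := fun h hh =>
      (Finset.subset_biUnion_of_mem P hh).trans Finset.subset_union_right
    -- The matched sets that T misses altogether. In the owner of such a set, T is forced to contain
    -- a blocking set, so it spends at least one vertex too many there.
    set Bad := R.filter fun j => Z j ⊆ X \ T with hBad
    have hne : ∀ j ∈ R, ∃ z, z ∈ Z j := by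
      intro j hj
      by_contra hcon
      push Not at hcon
      have hb := hblock j hj
      rw [Finset.eq_empty_of_forall_notMem hcon] at hb
      refine not_blocksOn_empty (hb.mono (Z := ∅) ?_)
      intro u; simp [nbrsIn]
    choose! z hz using hne
    -- One vertex of every missed set joins the cover; the vertex saved in the owner pays for it.
    set Tx := T ∩ X ∪ Bad.image z with hTx
    have hTxX : Tx ⊆ X := by
      refine Finset.union_subset Finset.inter_subset_right fun x hx => ?_
      obtain ⟨j, hj, rfl⟩ := Finset.mem_image.1 hx
      have := Finset.mem_filter.1 hj
      exact hZX j this.1 (hz j this.1)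
    -- A set outside Tx blocking such a piece would contain a matched set, by closedness. That set
    -- is missed by T, hence contains one of the added vertices, which lies in Tx.
    have hnot : ∀ h, h ∈ U ∨ h ∈ R.image owner →
        ¬ BlocksOn G (P h) (nbrsIn G (P h) (X \ Tx)) := by
      intro h hh hb
      obtain ⟨j, hj, hjY⟩ := hclosed h hh _ Finset.sdiff_subset hb
      have h1 : j ∈ Bad := Finset.mem_filter.2 ⟨hj, fun x hx => by
        have := Finset.mem_sdiff.1 (hjY hx)
        simp only [hTx, Finset.mem_union, Finset.mem_inter, not_or, not_and] at this
        exact Finset.mem_sdiff.2 ⟨this.1, fun hxT => this.2.1 hxT this.1⟩⟩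
      have h2 := Finset.mem_sdiff.1 (hjY (hz j hj))
      exact h2.2 (Finset.mem_union_right _ (Finset.mem_image_of_mem z h1))
    have hpiece : ∀ h ∈ J, ∃ T' ⊆ P h, CoversOn G (P h) T' ∧
        nbrsIn G (P h) (X \ Tx) ⊆ T' ∧
        (h ∈ U → T'.card = coverNum G (P h)) ∧
        (h ∉ U → T'.card + (if h ∈ Bad.image owner then 1 else 0) ≤ (T ∩ P h).card) := by
      intro h hh
      by_cases hcase : h ∈ U ∨ h ∈ R.image owner
      · obtain ⟨T', hT', hNT', hc'⟩ := exists_of_not_blocksOn (hnot h hcase)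
        refine ⟨T', hT'.1, hT', hNT', fun _ => hc', fun hhU => ?_⟩
        have h1 := hT.inter (hmemP' h (by simp [hh, hhU]))
        rw [hc']
        split_ifs with hbad
        · obtain ⟨j, hj, rfl⟩ := Finset.mem_image.1 hbad
          have h2 := Finset.mem_filter.1 hj
          refine hblock j h2.1 _ h1 fun u hu => ?_
          simp only [nbrsIn, Finset.mem_filter] at hu
          obtain ⟨hu, w, hw, hwu⟩ := hu
          have h3 := Finset.mem_sdiff.1 (h2.2 hw)
          have h4 := (hT.2 w (by simp [h3.1]) u (hmemP' _ (by simp [hh, hhU]) hu) hwu).resolve_left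
            h3.2
          simp [h4, hu]
        · exact h1.coverNum_le
      -- Pieces neither deleted nor matched keep their part of T, since Tx contains T ∩ X.
      · rw [not_or] at hcase
        have hhU : h ∈ J \ U := by simp [hh, hcase.1]
        refine ⟨T ∩ P h, Finset.inter_subset_right, hT.inter (hmemP' h hhU), fun u hu => ?_,
          fun h1 => absurd h1 hcase.1, fun _ => ?_⟩
        · simp only [nbrsIn, Finset.mem_filter] at hu
          obtain ⟨hu, w, hw, hwu⟩ := hu
          have h3 := Finset.mem_sdiff.1 hw
          have h4 := (hT.2 w (by simp [h3.1]) u (hmemP' _ hhU hu) hwu).resolve_left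
            (fun hwT => h3.2 (by simp [hTx, hwT, h3.1]))
          simp [h4, hu]
        · rw [if_neg, add_zero]
          exact fun hb => hcase.2 (Finset.image_subset_image (Finset.filter_subset _ _) hb)
    choose! T' hT'P hT'c hT'N hT'U hT'K using hpiece
    have hcov : CoversOn G (X ∪ J.biUnion P) (Tx ∪ J.biUnion T') := by
      have hxp : ∀ x ∈ X, ∀ h ∈ J, ∀ u ∈ P h, G.Adj x u → x ∈ Tx ∨ u ∈ J.biUnion T' := by
        intro x hx h hh u hu hxu
        by_cases hxT : x ∈ Tx
        · exact Or.inl hxT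
        · refine Or.inr (Finset.mem_biUnion.2 ⟨h, hh, hT'N h hh ?_⟩)
          simp only [nbrsIn, Finset.mem_filter]
          exact ⟨hu, x, by simp [hx, hxT], hxu⟩
      refine ⟨Finset.union_subset_union hTxX (Finset.biUnion_subset.2 fun h hh =>
        (hT'P h hh).trans (Finset.subset_biUnion_of_mem P hh)), fun u hu v hv huv => ?_⟩
      rw [Finset.mem_union] at hu hv
      refine Or.imp Finset.mem_union.2 Finset.mem_union.2
        (?_ : (u ∈ Tx ∨ u ∈ J.biUnion T') ∨ (v ∈ Tx ∨ v ∈ J.biUnion T'))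
      rcases hu with hu | hu <;> rcases hv with hv | hv
      · have := hT.2 u (by simp [hu]) v (by simp [hv]) huv
        simp only [hTx, Finset.mem_union, Finset.mem_inter]
        tauto
      · obtain ⟨h, hh, hv⟩ := Finset.mem_biUnion.1 hv
        have := hxp u hu h hh v hv huv
        tauto
      · obtain ⟨h, hh, hu⟩ := Finset.mem_biUnion.1 hu
        have := hxp v hv h hh u hu huv.symm
        tauto
      · obtain ⟨h, hh, hu⟩ := Finset.mem_biUnion.1 hu
        obtain ⟨h', hh', hv⟩ := Finset.mem_biUnion.1 hv
        by_cases heq : h = h'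
        · subst heq
          rcases (hT'c h hh).2 u hu v hv huv with h1 | h1
          · exact Or.inl (Or.inr (Finset.mem_biUnion.2 ⟨h, hh, h1⟩))
          · exact Or.inr (Or.inr (Finset.mem_biUnion.2 ⟨h, hh, h1⟩))
        · exact absurd huv (hn h hh h' hh' heq u hu v hv)
    have c1 := hcov.coverNum_le
    have c2 := Finset.card_union_le Tx (J.biUnion T')
    have c3 : (J.biUnion T').card ≤ ∑ h ∈ J, (T' h).card := Finset.card_biUnion_le
    have c4 : Tx.card ≤ (T ∩ X).card + Bad.card :=
      (Finset.card_union_le _ _).trans (Nat.add_le_add_left Finset.card_image_le _)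
    have c5 : ∑ h ∈ J, (T' h).card = ∑ h ∈ J \ U, (T' h).card + ∑ h ∈ U, (T' h).card :=
      (Finset.sum_sdiff hU).symm
    have c6 : ∑ h ∈ U, (T' h).card = ∑ h ∈ U, coverNum G (P h) :=
      Finset.sum_congr rfl fun h hh => hT'U h (hU hh) hh
    have c7 : ∑ h ∈ J \ U, ((T' h).card + (if h ∈ Bad.image owner then 1 else 0)) ≤
        ∑ h ∈ J \ U, (T ∩ P h).card :=
      Finset.sum_le_sum fun h hh => by
        rw [Finset.mem_sdiff] at hh
        exact hT'K h hh.1 hh.2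
    -- Distinct matched sets have distinct owners, and these are not deleted, so every added vertex
    -- is paid for.
    have c8 : ∑ h ∈ J \ U, (if h ∈ Bad.image owner then 1 else 0) = Bad.card := by
      rw [Finset.sum_ite_mem, Finset.sum_const, smul_eq_mul, mul_one,
        Finset.inter_eq_right.2, Finset.card_image_of_injOn]
      · exact hinj.mono fun j hj => (Finset.mem_filter.1 hj).1
      · intro h hh
        obtain ⟨j, hj, rfl⟩ := Finset.mem_image.1 hh
        exact howner j (Finset.mem_filter.1 hj).1
    have c9 : (T ∩ X).card + ∑ h ∈ J \ U, (T ∩ P h).card ≤ T.card := by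
      rw [← Finset.card_biUnion, ← Finset.card_union_of_disjoint]
      · refine Finset.card_le_card (Finset.union_subset Finset.inter_subset_left ?_)
        exact Finset.biUnion_subset.2 fun _ _ => Finset.inter_subset_left
      · rw [Finset.disjoint_biUnion_right]
        exact fun h hh => (hX h (Finset.mem_sdiff.1 hh).1).mono Finset.inter_subset_right
          Finset.inter_subset_right
      · intro i hi j hj hij
        exact (hd i (Finset.mem_sdiff.1 hi).1 j (Finset.mem_sdiff.1 hj).1 hij).mono
          Finset.inter_subset_right Finset.inter_subset_right
    rw [Finset.sum_add_distrib] at c7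
    omega
  -- Conversely, a cover of the whole graph restricts to the remaining part and to every deleted
  -- piece.
  · obtain ⟨T, hT, hc⟩ := exists_coversOn_card_eq G (X ∪ J.biUnion P)
    have h1 := (hT.inter (A := X ∪ (J \ U).biUnion P) (Finset.union_subset_union subset_rfl
      (Finset.biUnion_subset_biUnion_of_subset_left P Finset.sdiff_subset))).coverNum_le
    have h2 : ∑ h ∈ U, coverNum G (P h) ≤ ∑ h ∈ U, (T ∩ P h).card :=
      Finset.sum_le_sum fun h hh => (hT.inter (hmemP h (hU hh))).coverNum_le
    have h3 : (T ∩ (X ∪ (J \ U).biUnion P)).card + ∑ h ∈ U, (T ∩ P h).card ≤ T.card := by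
      rw [← Finset.card_biUnion, ← Finset.card_union_of_disjoint]
      · refine Finset.card_le_card (Finset.union_subset Finset.inter_subset_left ?_)
        exact Finset.biUnion_subset.2 fun _ _ => Finset.inter_subset_left
      · rw [Finset.disjoint_biUnion_right]
        intro h hh
        refine Disjoint.mono Finset.inter_subset_right Finset.inter_subset_right ?_
        rw [Finset.disjoint_union_left, Finset.disjoint_biUnion_left]
        refine ⟨hX h (hU hh), fun i hi => hd i (Finset.mem_sdiff.1 hi).1 h (hU hh) ?_⟩
        rintro rfl
        exact (Finset.mem_sdiff.1 hi).2 hh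
      · intro i hi j hj hij
        exact (hd i (hU hi) j (hU hj) hij).mono
          Finset.inter_subset_right Finset.inter_subset_right
    omega

end Covers

/-! ### Elimination distance -/

section Classes

set_option linter.unusedSectionVars false

variable {C D : GraphClass}

/-- An isomorphism restricts to induced subgraphs. -/
def inducedIso {V W : Type} {G : SimpleGraph V} {H : SimpleGraph W} (e : G ≃g H) {s : Set V}
    {t : Set W} (h : ∀ x, x ∈ s ↔ e x ∈ t) : G.induce s ≃g H.induce t where
  toEquiv := e.toEquiv.subtypeEquiv h
  map_rel_iff' := by
    intro a b
    exact e.map_rel_iff (a := a.1) (b := b.1)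

theorem elimDist_congr (hiso : C.IsoInvariant) {V W : Type} [Finite V] [Finite W]
    {G : SimpleGraph V} {H : SimpleGraph W} (e : G ≃g H) :
    elimDist C V G = elimDist C W H := by
  induction hn : Nat.card V using Nat.strong_induction_on generalizing V W with
  | _ n ih =>
  subst hn
  have hC : C V G ↔ C W H := ⟨hiso V W G H ⟨e⟩, hiso W V H G ⟨e.symm⟩⟩
  have hconn : G.Connected ↔ H.Connected := e.connected_iff
  rw [elimDist, elimDist]
  by_cases h1 : C V G
  · rw [if_pos h1, if_pos (hC.1 h1)]
  rw [if_neg h1, if_neg (mt hC.2 h1)]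
  by_cases h2 : G.Connected
  · rw [dif_pos h2, dif_pos (hconn.1 h2)]
    congr 1
    refine Equiv.iInf_congr e.toEquiv fun v => (ih _ (card_compl_singleton_lt v) ?_ rfl).symm
    exact inducedIso e fun x => by
      simp only [Set.mem_compl_iff, Set.mem_singleton_iff, not_iff_not]
      exact e.injective.eq_iff.symm
  · rw [dif_neg h2, dif_neg (mt hconn.2 h2)]
    refine Equiv.iSup_congr e.connectedComponentEquiv fun c =>
      (ih _ (card_supp_lt G h2 c) ?_ rfl).symm
    exact inducedIso e fun x => by
      induction c using SimpleGraph.ConnectedComponent.ind with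
      | _ v =>
      simp only [SimpleGraph.ConnectedComponent.mem_supp_iff, SimpleGraph.ConnectedComponent.eq,
        SimpleGraph.Iso.connectedComponentEquiv_apply, SimpleGraph.ConnectedComponent.map_mk]
      exact e.reachable_iff.symm

theorem isoInvariant_elim (hiso : C.IsoInvariant) (i : ℕ) : (C.elim i).IsoInvariant := by
  intro V W _ _ G H ⟨e⟩ h
  change elimDist C W H ≤ i
  rw [← elimDist_congr hiso e]
  exact h

theorem elimDist_le_succ_iff {V : Type} [Finite V] {G : SimpleGraph V} (hG : G.Connected)
    (i : ℕ) : elimDist C V G ≤ i + 1 ↔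
      C V G ∨ ∃ v : V, elimDist C _ (G.induce ({v} : Set V)ᶜ) ≤ i := by
  rw [elimDist]
  by_cases h1 : C V G
  · simp [h1]
  · rw [if_neg h1, dif_pos hG]
    have := hG.nonempty
    simp only [h1, false_or, add_le_add_iff_right]
    constructor
    · intro h
      obtain ⟨v, hv⟩ := exists_eq_ciInf_of_finite
        (f := fun v : V => elimDist C _ (G.induce ({v} : Set V)ᶜ))
      exact ⟨v, hv.trans_le h⟩
    · rintro ⟨v, hv⟩
      exact (ciInf_le ⟨0, by rintro _ ⟨_, rfl⟩; exact Nat.zero_le _⟩ v).trans hv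

theorem connected_induce_supp {V : Type} {G : SimpleGraph V} (c : G.ConnectedComponent) :
    (G.induce c.supp).Connected := c.connected_toSimpleGraph

theorem elimDist_eq_zero_of_mem {V : Type} [Finite V] {G : SimpleGraph V} (h : C V G) :
    elimDist C V G = 0 := by
  rw [elimDist, if_pos h]

theorem elimDist_le_zero_of_connected {V : Type} [Finite V] {G : SimpleGraph V}
    (hG : G.Connected) : elimDist C V G ≤ 0 ↔ C V G := by
  rw [elimDist]
  by_cases h1 : C V G <;> simp [h1, hG]

/-- A connected graph is its only component, a disconnected graph outside C is covered by the
definition, and for a graph in C robustness makes all the distances zero. -/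
theorem robust_elim (hiso : C.IsoInvariant) (hrob : C.Robust) (i : ℕ) : (C.elim i).Robust := by
  intro V _ G
  change elimDist C V G ≤ i ↔ ∀ c : G.ConnectedComponent, elimDist C _ (G.induce c.supp) ≤ i
  by_cases h2 : G.Connected
  · have key : ∀ c : G.ConnectedComponent, elimDist C _ (G.induce c.supp) = elimDist C V G := by
      intro c
      refine elimDist_congr hiso ((inducedIso (SimpleGraph.Iso.refl (G := G)) (t := Set.univ)
        fun x => ?_).trans (SimpleGraph.induceUnivIso _))
      induction c using SimpleGraph.ConnectedComponent.ind with
      | _ v => simpa using h2.preconnected x v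
    have := h2.nonempty
    simp [key]
  · by_cases h1 : C V G
    · have h3 := (hrob V G).1 h1
      simp [elimDist_eq_zero_of_mem h1, fun c => elimDist_eq_zero_of_mem (h3 c)]
    · rw [elimDist, if_neg h1, dif_neg h2]
      -- The supremum over no components is treated apart: a graph without components lies in C by
      -- robustness.
      by_cases hE : IsEmpty G.ConnectedComponent
      · exact absurd ((hrob V G).2 fun c => (hE.false c).elim) h1
      · rw [not_isEmpty_iff] at hE
        exact ciSup_le_iff (Set.finite_range _).bddAbove

theorem elim_zero_iff (hrob : C.Robust) {V : Type} [Finite V] {G : SimpleGraph V} :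
    C.elim 0 V G ↔ C V G := by
  constructor
  · intro h
    by_contra h1
    change elimDist C V G ≤ 0 at h
    by_cases h2 : G.Connected
    · exact h1 ((elimDist_le_zero_of_connected h2).1 h)
    · rw [elimDist, if_neg h1, dif_neg h2] at h
      refine h1 ((hrob V G).2 fun c => ?_)
      have := (le_ciSup (Set.finite_range (fun c : G.ConnectedComponent =>
        elimDist C _ (G.induce c.supp))).bddAbove c).trans h
      exact (elimDist_le_zero_of_connected (connected_induce_supp c)).1 this
  · intro h
    exact (elimDist_eq_zero_of_mem h).le

/-! ### Classes and finite vertex sets -/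

variable {V W : Type} [DecidableEq V] [DecidableEq W] {G : SimpleGraph V} {S T : Finset V}

/-- The subgraph induced by `S` belongs to `D`. -/
def InClass (D : GraphClass) (G : SimpleGraph V) (S : Finset V) : Prop :=
  D (S : Set V) (G.induce (S : Set V))

theorem inClass_of_iso (hD : D.IsoInvariant) [Finite W] {H : SimpleGraph W}
    (e : H ≃g G.induce (S : Set V)) : InClass D G S ↔ D W H :=
  ⟨hD _ _ _ _ ⟨e.symm⟩, hD _ _ _ _ ⟨e⟩⟩

/-- The map of an embedding is an isomorphism of induced subgraphs. -/
noncomputable def mapIso (f : V ↪ W) (H : SimpleGraph W) (S : Finset V) :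
    (H.comap f).induce (S : Set V) ≃g H.induce ((S.map f : Finset W) : Set W) where
  toEquiv := (Equiv.Set.image f (S : Set V) f.injective).trans
    (Equiv.setCongr (by simp))
  map_rel_iff' := by
    intro a b
    rfl

theorem inClass_map (hD : D.IsoInvariant) (f : V ↪ W) (H : SimpleGraph W) :
    InClass D H (S.map f) ↔ InClass D (H.comap f) S :=
  inClass_of_iso hD (mapIso f H S)

theorem inClass_univ [Fintype V] (hD : D.IsoInvariant) :
    InClass D G Finset.univ ↔ D V G :=
  inClass_of_iso hD ((inducedIso (SimpleGraph.Iso.refl (G := G)) (s := Set.univ)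
    fun x => by simp).symm.trans (SimpleGraph.induceUnivIso _)).symm

theorem InClass.subset_of_hereditary (hD : D.IsoInvariant) (hh : D.Hereditary)
    (h : InClass D G S) (hTS : T ⊆ S) : InClass D G T := by
  have h1 := hh _ _ {x : (S : Set V) | x.1 ∈ T} h
  refine hD _ _ _ _ ⟨?_⟩ h1
  refine ⟨⟨fun x => ⟨x.1.1, x.2⟩, fun x => ⟨⟨x.1, hTS x.2⟩, x.2⟩, fun _ => rfl, fun _ => rfl⟩, ?_⟩
  intro a b
  rfl

/-- Steps along an edge inside `S`. -/
def StepIn (G : SimpleGraph V) (S : Finset V) (a b : V) : Prop := a ∈ S ∧ b ∈ S ∧ G.Adj a b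

open Classical in
/-- The vertices of `S` in the component of `v`. -/
noncomputable def compOn (G : SimpleGraph V) (S : Finset V) (v : V) : Finset V :=
  S.filter fun u => Relation.ReflTransGen (StepIn G S) v u

theorem mem_compOn {u v : V} :
    u ∈ compOn G S v ↔ u ∈ S ∧ Relation.ReflTransGen (StepIn G S) v u := by
  simp [compOn]

theorem compOn_subset {v : V} : compOn G S v ⊆ S := fun _ hu => (mem_compOn.1 hu).1

theorem self_mem_compOn {v : V} (hv : v ∈ S) : v ∈ compOn G S v :=
  mem_compOn.2 ⟨hv, Relation.ReflTransGen.refl⟩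

theorem stepIn_symm {a b : V} (h : Relation.ReflTransGen (StepIn G S) a b) :
    Relation.ReflTransGen (StepIn G S) b a := by
  induction h with
  | refl => exact .refl
  | tail _ h ih => exact .head ⟨h.2.1, h.1, h.2.2.symm⟩ ih

theorem compOn_eq {u v : V} (hu : u ∈ compOn G S v) : compOn G S u = compOn G S v := by
  have h := (mem_compOn.1 hu).2
  ext w
  simp only [mem_compOn]
  exact and_congr_right fun _ => ⟨fun h' => h.trans h', fun h' => (stepIn_symm h).trans h'⟩

theorem compOn_disjoint {u v : V} (h : compOn G S u ≠ compOn G S v) :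
    Disjoint (compOn G S u) (compOn G S v) := by
  rw [Finset.disjoint_left]
  intro w hu hv
  exact h ((compOn_eq hu).symm.trans (compOn_eq hv))

theorem noEdges_compOn {v : V} : NoEdges G (compOn G S v) (S \ compOn G S v) := by
  intro a ha b hb hab
  rw [Finset.mem_sdiff] at hb
  have h := mem_compOn.1 ha
  exact hb.2 (mem_compOn.2 ⟨hb.1, h.2.tail ⟨h.1, hb.1, hab⟩⟩)

theorem noEdges_compOn_compOn {u v : V} (h : compOn G S u ≠ compOn G S v) :
    NoEdges G (compOn G S u) (compOn G S v) := by
  intro a ha b hb hab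
  refine noEdges_compOn a ha b (Finset.mem_sdiff.2 ⟨compOn_subset hb, fun hb' => ?_⟩) hab
  exact h ((compOn_eq hb').symm.trans (compOn_eq hb))

theorem reachable_iff {u v : V} (hu : u ∈ S) (hv : v ∈ S) :
    (G.induce (S : Set V)).Reachable ⟨u, hu⟩ ⟨v, hv⟩ ↔
      Relation.ReflTransGen (StepIn G S) u v := by
  rw [SimpleGraph.reachable_iff_reflTransGen]
  constructor
  · intro h
    exact h.lift (fun x : (S : Set V) => x.1) fun a b hab => ⟨a.2, b.2, hab⟩
  · intro h
    have : ∀ w, Relation.ReflTransGen (StepIn G S) u w → ∀ hw : w ∈ S,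
        Relation.ReflTransGen (G.induce (S : Set V)).Adj ⟨u, hu⟩ ⟨w, hw⟩ := by
      intro w hw
      induction hw with
      | refl => exact fun _ => .refl
      | tail _ hbc ih => exact fun hc => (ih hbc.1).tail hbc.2.2
    exact this v h hv

theorem inClass_iff_forall_compOn (hD : D.IsoInvariant) (hr : D.Robust) :
    InClass D G S ↔ ∀ v ∈ S, InClass D G (compOn G S v) := by
  have key : ∀ v (hv : v ∈ S), InClass D G (compOn G S v) ↔
      D _ ((G.induce (S : Set V)).induce
        ((G.induce (S : Set V)).connectedComponentMk ⟨v, hv⟩).supp) := by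
    intro v hv
    refine inClass_of_iso hD ⟨⟨fun x => ⟨x.1.1, ?_⟩, fun x => ⟨⟨x.1, compOn_subset x.2⟩, ?_⟩,
      fun _ => rfl, fun _ => rfl⟩, fun {a b} => Iff.rfl⟩
    · have h := x.2
      rw [SimpleGraph.ConnectedComponent.mem_supp_iff, SimpleGraph.ConnectedComponent.eq] at h
      exact mem_compOn.2 ⟨x.1.2, (reachable_iff hv x.1.2).1 h.symm⟩
    · rw [SimpleGraph.ConnectedComponent.mem_supp_iff, SimpleGraph.ConnectedComponent.eq]
      exact ((reachable_iff hv _).2 (mem_compOn.1 x.2).2).symm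
  rw [InClass, hr]
  constructor
  · exact fun h v hv => (key v hv).2 (h _)
  · intro h c
    induction c using SimpleGraph.ConnectedComponent.ind with
    | _ v => exact (key v.1 v.2).1 (h v.1 v.2)

theorem connected_compOn {v : V} (hv : v ∈ S) :
    (G.induce (compOn G S v : Set V)).Connected := by
  have hvv := self_mem_compOn (G := G) hv
  have key : ∀ w, Relation.ReflTransGen (StepIn G S) v w →
      Relation.ReflTransGen (StepIn G (compOn G S v)) v w := by
    intro w hw
    induction hw with
    | refl => exact .refl
    | tail hab hbc ih =>
      exact ih.tail ⟨mem_compOn.2 ⟨hbc.1, hab⟩, mem_compOn.2 ⟨hbc.2.1, hab.tail hbc⟩, hbc.2.2⟩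
  have : Nonempty (compOn G S v : Set V) := ⟨⟨v, hvv⟩⟩
  refine ⟨fun a b => ?_⟩
  exact ((reachable_iff hvv a.2).2 (key _ (mem_compOn.1 a.2).2)).symm.trans
    ((reachable_iff hvv b.2).2 (key _ (mem_compOn.1 b.2).2))

/-- Deleting a vertex is expressed as erasing it from a finset, so that the nested subtypes in the
definition of `elimDist` do not accumulate. -/
theorem inClass_elim_succ_iff (hiso : C.IsoInvariant) {i : ℕ}
    (hS : (G.induce (S : Set V)).Connected) :
    InClass (C.elim (i + 1)) G S ↔ InClass C G S ∨ ∃ v ∈ S, InClass (C.elim i) G (S.erase v) := by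
  have key : ∀ v (hv : v ∈ S), InClass (C.elim i) G (S.erase v) ↔
      elimDist C _ ((G.induce (S : Set V)).induce ({⟨v, hv⟩} : Set (S : Set V))ᶜ) ≤ i := by
    intro v hv
    refine inClass_of_iso (isoInvariant_elim hiso i) ⟨⟨fun x => ⟨x.1.1, ?_⟩,
      fun x => ⟨⟨x.1, Finset.erase_subset _ _ x.2⟩, ?_⟩,
      fun _ => rfl, fun _ => rfl⟩, fun {a b} => Iff.rfl⟩
    · have := x.2
      simp only [Set.mem_compl_iff, Set.mem_singleton_iff, Subtype.ext_iff] at this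
      exact Finset.mem_coe.2 (Finset.mem_erase.2 ⟨this, x.1.2⟩)
    · simp only [Set.mem_compl_iff, Set.mem_singleton_iff, Subtype.ext_iff]
      exact (Finset.mem_erase.1 x.2).1
  change elimDist C _ _ ≤ i + 1 ↔ _
  rw [elimDist_le_succ_iff hS]
  constructor
  · rintro (h | ⟨v, hv⟩)
    · exact Or.inl h
    · exact Or.inr ⟨v.1, v.2, (key v.1 v.2).2 hv⟩
  · rintro (h | ⟨v, hv, h⟩)
    · exact Or.inl h
    · exact Or.inr ⟨⟨v, hv⟩, (key v hv).1 h⟩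

theorem compOn_subset_compOn (hTS : T ⊆ S) {v : V} : compOn G T v ⊆ compOn G S v := by
  intro u hu
  rw [mem_compOn] at *
  exact ⟨hTS hu.1, hu.2.lift id fun a b h => ⟨hTS h.1, hTS h.2.1, h.2.2⟩⟩

theorem inClass_elim_zero_iff (hrob : C.Robust) : InClass (C.elim 0) G S ↔ InClass C G S :=
  elim_zero_iff hrob

/-- A component of the smaller graph lies in one of the larger graph, whose elimination vertex
serves for both as long as it is still present. -/
theorem InClass.elim_mono (hiso : C.IsoInvariant) (hher : C.Hereditary) (hrob : C.Robust)
    {i : ℕ} (h : InClass (C.elim i) G S) (hTS : T ⊆ S) : InClass (C.elim i) G T := by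
  induction i generalizing S T with
  | zero =>
    rw [inClass_elim_zero_iff hrob] at *
    exact h.subset_of_hereditary hiso hher hTS
  | succ i ih =>
    have hi := isoInvariant_elim hiso (i + 1)
    have hr := robust_elim hiso hrob (i + 1)
    rw [inClass_iff_forall_compOn hi hr] at h ⊢
    intro v hv
    have h1 := (inClass_elim_succ_iff hiso (connected_compOn (hTS hv))).1 (h v (hTS hv))
    rw [inClass_elim_succ_iff hiso (connected_compOn hv)]
    have hsub := compOn_subset_compOn (G := G) hTS (v := v)
    rcases h1 with h1 | ⟨w, _, h1⟩
    · exact Or.inl (h1.subset_of_hereditary hiso hher hsub)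
    · right
      by_cases hw : w ∈ compOn G T v
      · exact ⟨w, hw, ih h1 (Finset.erase_subset_erase w hsub)⟩
      -- The elimination vertex w is gone, so the smaller component avoids w already, and any of its
      -- vertices may be deleted.
      · refine ⟨v, self_mem_compOn hv, ih h1 fun x hx => ?_⟩
        have := (Finset.mem_erase.1 hx).2
        exact Finset.mem_erase.2 ⟨fun h => hw (h ▸ this), hsub this⟩

theorem InClass.elim {i : ℕ} (h : InClass C G S) :
    InClass (C.elim i) G S :=
  (elimDist_eq_zero_of_mem h).le.trans (Nat.zero_le i)

theorem inClass_empty (hD : D.IsoInvariant) (hr : D.Robust) : InClass D G ∅ := by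
  rw [inClass_iff_forall_compOn hD hr]; simp

/-- A class that is determined by components contains the disjoint unions of its members. -/
theorem inClass_biUnion (hiso : C.IsoInvariant) (hher : C.Hereditary) (hrob : C.Robust) {i : ℕ}
    {ι : Type} [DecidableEq ι] {J : Finset ι} {P : ι → Finset V}
    (hn : ∀ i ∈ J, ∀ j ∈ J, i ≠ j → NoEdges G (P i) (P j))
    (h : ∀ j ∈ J, InClass (C.elim i) G (P j)) : InClass (C.elim i) G (J.biUnion P) := by
  rw [inClass_iff_forall_compOn (isoInvariant_elim hiso i) (robust_elim hiso hrob i)]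
  intro v hv
  obtain ⟨j, hj, hvj⟩ := Finset.mem_biUnion.1 hv
  refine (h j hj).elim_mono hiso hher hrob fun u hu => ?_
  have := (mem_compOn.1 hu).2
  induction this with
  | refl => exact hvj
  | @tail b c _ hbc ih =>
    have hb := ih (mem_compOn.2 ⟨hbc.1, by assumption⟩)
    obtain ⟨j', hj', hc⟩ := Finset.mem_biUnion.1 hbc.2.1
    by_cases hjj : j = j'
    · exact hjj ▸ hc
    · exact absurd hbc.2.2 (hn j hj j' hj' hjj b hb c hc)

end Classes

/-! ### Bounds on minimal blocking sets -/

/-- In induced subgraphs that belong to `D`, blocking sets contain blocking sets of size at most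
`b`. -/
def BlockBound (D : GraphClass) (b : ℕ) : Prop :=
  ∀ (V : Type) (G : SimpleGraph V) (S Y : Finset V), Y ⊆ S → InClass D G S → BlocksOn G S Y →
    ∃ Y' ⊆ Y, BlocksOn G S Y' ∧ Y'.card ≤ b

theorem isVertexCover_iff_coversOn {V : Type} [Fintype V] {G : SimpleGraph V} {T : Finset V} :
    G.IsVertexCover (T : Set V) ↔ CoversOn G Finset.univ T := by
  simp [SimpleGraph.IsVertexCover, CoversOn]

theorem isBlockingSet_iff_blocksOn {V : Type} [Fintype V] {G : SimpleGraph V} {Y : Finset V} :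
    IsBlockingSet G (Y : Set V) ↔ BlocksOn G Finset.univ Y := by
  classical
  constructor
  · intro h T hT hY
    by_contra hlt
    have hc : T.card = coverNum G Finset.univ := (not_lt.1 hlt).antisymm hT.coverNum_le
    refine h ⟨(T : Set V), ⟨isVertexCover_iff_coversOn.2 hT, fun T' hT' => ?_⟩, by simpa using hY⟩
    rw [← Set.coe_toFinset T'] at hT' ⊢
    rw [Set.ncard_coe_finset, Set.ncard_coe_finset, hc]
    exact (isVertexCover_iff_coversOn.1 hT').coverNum_le
  · rintro h ⟨T, hT, hY⟩
    obtain ⟨T0, hT0, hc0⟩ := exists_coversOn_card_eq G Finset.univ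
    have h1 := hT.2 (T0 : Set V) (isVertexCover_iff_coversOn.2 hT0)
    have h2 := hT.1
    rw [← Set.coe_toFinset T] at h1 h2 hY
    rw [Set.ncard_coe_finset, Set.ncard_coe_finset] at h1
    have h3 := h _ (isVertexCover_iff_coversOn.1 h2) (by exact_mod_cast hY)
    omega

theorem beta_le_of_blockBound {D : GraphClass} (hD : D.IsoInvariant) {b : ℕ}
    (h : BlockBound D b) : D.beta ≤ b := by
  classical
  refine sSup_le ?_
  rintro m ⟨V, _, G, Y, hG, hY, rfl⟩
  have := Fintype.ofFinite V
  have hb := hY.prop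
  rw [← Set.coe_toFinset Y, isBlockingSet_iff_blocksOn] at hb
  obtain ⟨Y', hY', hB, hc⟩ := h V G _ _ (Finset.subset_univ _) ((inClass_univ hD).2 hG) hb
  have h1 : (Y' : Set V) = Y := by
    refine hY.eq_of_subset (isBlockingSet_iff_blocksOn.2 hB) ?_
    intro x hx
    simpa using hY' hx
  rw [← h1, Set.ncard_coe_finset]
  exact_mod_cast hc

/-- There are finitely many subsets, so a blocking set contains a minimal one, whose size is bounded
by `beta`. As `beta` refers to whole graphs, the induced subgraph is regarded as a graph on its own
vertex type. -/
theorem blockBound_of_beta_lt_top {D : GraphClass} (h : D.beta < ⊤) :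
    BlockBound D D.beta.toNat := by
  classical
  intro V G S Y hYS hS hY
  let f : (S : Set V) ↪ V := Function.Embedding.subtype _
  have hSmap : (Finset.univ : Finset (S : Set V)).map f = S := by ext x; simp [f]
  have hYmap : (Y.preimage f f.injective.injOn).map f = Y := by
    ext x; simp only [Finset.mem_map, Finset.mem_preimage, f]
    constructor
    · rintro ⟨a, ha, rfl⟩; exact ha
    · exact fun hx => ⟨⟨x, hYS hx⟩, hx, rfl⟩
  rw [← hSmap, ← hYmap, blocksOn_map, ← isBlockingSet_iff_blocksOn] at hY
  obtain ⟨M, hMY, hM⟩ := Set.Finite.exists_le_minimal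
    (s := {Z | IsBlockingSet (G.comap f) Z}) (Set.toFinite _) hY
  have hMc : (M.ncard : ℕ∞) ≤ D.beta := le_sSup ⟨_, inferInstance, G.comap f, M, hS, hM, rfl⟩
  refine ⟨M.toFinset.map f, ?_, ?_, ?_⟩
  · rw [← hYmap]
    refine Finset.map_subset_map.2 fun x hx => ?_
    exact hMY (Set.mem_toFinset.1 hx)
  · have h1 : BlocksOn G (Finset.univ.map f) (M.toFinset.map f) := by
      rw [blocksOn_map, ← isBlockingSet_iff_blocksOn, Set.coe_toFinset]
      exact hM.prop
    generalize M.toFinset.map f = M' at h1 ⊢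
    rwa [hSmap] at h1
  · rw [Finset.card_map, ← Set.ncard_eq_toFinset_card']
    rw [← ENat.natCast_toNat h.ne] at hMc
    exact_mod_cast hMc

/-- In a disconnected graph one component or the rest is blocked already, and induction on the
number of vertices applies. A connected graph is in C, with bound b₀, or has a vertex w such that S
− w and, by heredity, S − N[w] have distance at most i; then `exists_small_of_branch` gives 2b + 1.
-/
theorem blockBound_elim_succ {C : GraphClass} (hiso : C.IsoInvariant) (hher : C.Hereditary)
    (hrob : C.Robust) {b₀ b i : ℕ} (h0 : BlockBound C b₀) (hi : BlockBound (C.elim i) b) :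
    BlockBound (C.elim (i + 1)) (max b₀ (2 * b + 1)) := by
  classical
  intro V G S
  induction hn : S.card using Nat.strong_induction_on generalizing S with
  | _ n ih =>
  subst hn
  intro Y hYS hS hY
  rcases S.eq_empty_or_nonempty with rfl | ⟨v, hv⟩
  · rw [Finset.subset_empty] at hYS
    exact absurd (hYS ▸ hY) not_blocksOn_empty
  by_cases hcv : compOn G S v = S
  · have hconn := connected_compOn (G := G) hv
    rw [hcv] at hconn
    rcases (inClass_elim_succ_iff hiso hconn).1 hS with h | ⟨w, hw, h⟩
    · obtain ⟨Y', hY', hB, hc⟩ := h0 V G S Y hYS h hY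
      exact ⟨Y', hY', hB, hc.trans (le_max_left _ _)⟩
    · obtain ⟨Y', hY', hB, hc⟩ := hY.exists_small_of_branch hw (fun Y hY => hi V G _ Y hY h)
        (fun Y hY => hi V G _ Y hY (h.elim_mono hiso hher hrob Finset.sdiff_subset)) hYS
      exact ⟨Y', hY', hB, hc.trans (le_max_right _ _)⟩
  · set A := compOn G S v with hA
    have hAS : A ⊆ S := compOn_subset
    have hunion : A ∪ S \ A = S := Finset.union_sdiff_of_subset hAS
    have hd : Disjoint A (S \ A) := Finset.disjoint_sdiff
    have hne : NoEdges G A (S \ A) := noEdges_compOn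
    have hne' : NoEdges G (S \ A) A := fun a ha b hb hab => hne b hb a ha hab.symm
    have hcA : A.card < S.card := Finset.card_lt_card (hAS.ssubset_of_ne hcv)
    have hcB : (S \ A).card < S.card := by
      refine Finset.card_lt_card (Finset.sdiff_ssubset hAS ⟨v, self_mem_compOn hv⟩)
    rw [← hunion] at hY hYS
    rcases hY.of_union hd hne hYS with h | h
    · obtain ⟨Y', hY', hB, hc⟩ := ih _ hcA A rfl _ Finset.inter_subset_right
        (hS.elim_mono hiso hher hrob hAS) h
      refine ⟨Y', hY'.trans Finset.inter_subset_left, ?_, hc⟩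
      rw [← hunion]
      exact hB.union hd hne (hY'.trans Finset.inter_subset_right)
    · obtain ⟨Y', hY', hB, hc⟩ := ih _ hcB (S \ A) rfl _ Finset.inter_subset_right
        (hS.elim_mono hiso hher hrob Finset.sdiff_subset) h
      refine ⟨Y', hY'.trans Finset.inter_subset_left, ?_, hc⟩
      rw [← hunion, Finset.union_comm]
      exact hB.union hd.symm hne' (hY'.trans Finset.inter_subset_right)

theorem beta_elim_lt_top {C : GraphClass} (hiso : C.IsoInvariant) (hher : C.Hereditary)
    (hrob : C.Robust) (hbeta : C.beta < ⊤) (i : ℕ) : (C.elim i).beta < ⊤ := by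
  have h0 := blockBound_of_beta_lt_top hbeta
  have : ∃ b, BlockBound (C.elim i) b := by
    induction i with
    | zero =>
      classical
      refine ⟨_, fun V G S Y hYS hS => h0 V G S Y hYS ((inClass_elim_zero_iff hrob).1 hS)⟩
    | succ i ih =>
      obtain ⟨b, hb⟩ := ih
      exact ⟨_, blockBound_elim_succ hiso hher hrob h0 hb⟩
  obtain ⟨b, hb⟩ := this
  exact (beta_le_of_blockBound (isoInvariant_elim hiso i) hb).trans_lt (ENat.natCast_lt_top b)

/-- In the one-vertex graph the vertex blocks, while the empty set never does. Hence no factor of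
the exponent vanishes, and |X| ≤ |X|^β holds. -/
theorem one_le_beta_elim_succ {C : GraphClass} (hiso : C.IsoInvariant)
    (hrob : C.Robust) {i : ℕ} (h : (C.elim (i + 1)).beta < ⊤) :
    1 ≤ (C.elim (i + 1)).beta.toNat := by
  classical
  by_contra hlt
  have hb := blockBound_of_beta_lt_top h
  have h1 : InClass (C.elim (i + 1)) (⊥ : SimpleGraph Unit) {()} := by
    have hc : compOn (⊥ : SimpleGraph Unit) {()} () = {()} :=
      compOn_subset.antisymm (by simpa using self_mem_compOn (by simp))
    have hconn := connected_compOn (G := (⊥ : SimpleGraph Unit)) (S := {()}) (v := ()) (by simp)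
    rw [hc] at hconn
    rw [inClass_elim_succ_iff hiso hconn]
    refine Or.inr ⟨(), by simp, ?_⟩
    rw [Finset.erase_singleton]
    exact inClass_empty (isoInvariant_elim hiso i) (robust_elim hiso hrob i)
  have h2 : BlocksOn (⊥ : SimpleGraph Unit) {()} {()} := by
    intro T hT hY
    have h3 : coverNum (⊥ : SimpleGraph Unit) {()} ≤ (∅ : Finset Unit).card :=
      CoversOn.coverNum_le ⟨by simp, by simp⟩
    have h4 := Finset.card_le_card hY
    rw [Finset.card_singleton] at h4
    rw [Finset.card_empty] at h3
    omega
  obtain ⟨Y', _, hB, hc⟩ := hb _ _ _ _ subset_rfl h1 h2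
  have : Y' = ∅ := by rw [← Finset.card_eq_zero]; omega
  exact not_blocksOn_empty (this ▸ hB)

/-! ### Graphs given by matrices -/

/-- The entry `b` of a list of bits, `false` beyond its end. -/
def bitAt (l : List Bool) (b : ℕ) : Bool := (l.drop b).headD false

/-- Adjacency in the graph on `ℕ` given by a matrix with rows of length `M.1`. -/
def adjB (M : ℕ × List Bool) (i j : ℕ) : Bool :=
  !(i.beq j) && (bitAt M.2 (M.1 * i + j) || bitAt M.2 (M.1 * j + i))

theorem adjB_iff {M : ℕ × List Bool} {i j : ℕ} : adjB M i j = true ↔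
    i ≠ j ∧ (bitAt M.2 (M.1 * i + j) = true ∨ bitAt M.2 (M.1 * j + i) = true) := by
  rw [adjB, Bool.and_eq_true, Bool.or_eq_true, Bool.not_eq_true', ← Bool.not_eq_true, Nat.beq_eq]

/-- The graph given by a matrix. -/
def matrixGraph (M : ℕ × List Bool) : SimpleGraph ℕ where
  Adj i j := adjB M i j = true
  symm := ⟨fun i j h => by
    rw [adjB_iff] at *
    exact ⟨h.1.symm, h.2.symm⟩⟩
  loopless := ⟨fun i h => (adjB_iff.1 h).1 rfl⟩

/-- Membership in a list of numbers. -/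
def memB (X : List ℕ) (v : ℕ) : Bool := X.any fun x => x.beq v

theorem memB_iff {X : List ℕ} {v : ℕ} : memB X v = true ↔ v ∈ X := by simp [memB]

/-- The encoding of the subgraph induced by the list `S`, with budget `k` and modulator `X`. -/
def encodeSub (M : ℕ × List Bool) (S X : List ℕ) (k : ℕ) : List Bool :=
  List.replicate S.length true ++ [false] ++ List.replicate k true ++ [false] ++
    S.map (memB X) ++ S.flatMap fun i => S.map fun j => adjB M i j

/-- The instance encoded by `encodeSub`. -/
def instOf (M : ℕ × List Bool) (S X : List ℕ) (k : ℕ) : VCInstance :=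
  ⟨S.length, (matrixGraph M).comap S.get, k, Finset.univ.filter fun i => memB X (S.get i) = true⟩

theorem ofFn_get_eq_map {α : Type} (S : List ℕ) (f : ℕ → α) :
    List.ofFn (fun i : Fin S.length => f (S.get i)) = S.map f := by
  refine List.ext_getElem (by simp) fun i h1 h2 => by simp

theorem encode_instOf (M : ℕ × List Bool) (S X : List ℕ) (k : ℕ) :
    (instOf M S X k).encode = encodeSub M S X k := by
  classical
  have h1 : ∀ i j : Fin S.length, decide ((instOf M S X k).G.Adj i j) =
      adjB M (S.get i) (S.get j) := by
    intro i j
    rw [Bool.eq_iff_iff, decide_eq_true_iff]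
    exact Iff.rfl
  simp only [VCInstance.encode, encodeSub]
  refine congrArg₂ (· ++ ·) (congrArg₂ (· ++ ·) rfl ?_) ?_
  · refine Eq.trans (congrArg List.ofFn (funext fun i => ?_)) (ofFn_get_eq_map S (memB X))
    rw [Bool.eq_iff_iff, decide_eq_true_iff]
    exact Finset.mem_filter_univ (p := fun i : Fin S.length => memB X (S.get i) = true) i
  · rw [List.flatMap_def]
    refine congrArg List.flatten ?_
    have : ∀ i : Fin S.length, (List.ofFn fun j => decide ((instOf M S X k).G.Adj i j)) =
        S.map fun j => adjB M (S.get i) j := by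
      intro i
      exact (congrArg List.ofFn (funext (h1 i))).trans (ofFn_get_eq_map S _)
    exact (congrArg List.ofFn (funext this)).trans
      (ofFn_get_eq_map S fun i => S.map fun j => adjB M i j)

/-! ### Decoding -/

/-- Splits off a leading block of `true`. -/
def splitTrue (x : List Bool) : ℕ × List Bool :=
  (fun p : ℕ × List Bool => cond (p.2.headD false) (p.1 + 1, p.2.tail) p)^[x.length] (0, x)

/-- The iteration is stationary once `false` is in front, so the length of the string is a
sufficient number of rounds. -/
theorem splitTrue_replicate (n : ℕ) (r : List Bool) :
    splitTrue (List.replicate n true ++ false :: r) = (n, false :: r) := by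
  have fixed : ∀ j m, (fun p : ℕ × List Bool => cond (p.2.headD false) (p.1 + 1, p.2.tail) p)^[j]
      (m, false :: r) = (m, false :: r) := by
    intro j m
    induction j with
    | zero => rfl
    | succ j ih => rw [Function.iterate_succ_apply]; exact ih
  have key : ∀ n m j, n ≤ j →
      (fun p : ℕ × List Bool => cond (p.2.headD false) (p.1 + 1, p.2.tail) p)^[j]
      (m, List.replicate n true ++ false :: r) = (m + n, false :: r) := by
    intro n
    induction n with
    | zero => intro m j _; exact fixed j m
    | succ n ih =>
      intro m j hj
      obtain ⟨j, rfl⟩ : ∃ i, j = i + 1 := ⟨j - 1, by omega⟩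
      rw [Function.iterate_succ_apply]
      have := ih (m + 1) j (by omega)
      rw [show m + (n + 1) = m + 1 + n by ring, ← this]
      rfl
  rw [splitTrue, key n 0 _ (by simp)]
  simp

theorem splitTrue_fst_le (x : List Bool) : (splitTrue x).1 ≤ x.length := by
  have key : ∀ (j : ℕ) (p : ℕ × List Bool),
      ((fun p : ℕ × List Bool => cond (p.2.headD false) (p.1 + 1, p.2.tail) p)^[j] p).1 ≤
        p.1 + j := by
    intro j
    induction j with
    | zero => intro p; simp
    | succ j ih =>
      intro p
      rw [Function.iterate_succ_apply]
      refine (ih _).trans ?_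
      cases p.2.headD false <;> (simp; try omega)
  simpa [splitTrue] using key x.length (0, x)

/-- Reads a matrix, a modulator, and a budget from a string. -/
def parse (x : List Bool) : (ℕ × List Bool) × List ℕ × ℕ :=
  ((((splitTrue x).1, (splitTrue (splitTrue x).2.tail).2.tail.drop (splitTrue x).1)),
    (List.range (splitTrue x).1).filter
      (fun i => bitAt (splitTrue (splitTrue x).2.tail).2.tail i),
    (splitTrue (splitTrue x).2.tail).1)

theorem bitAt_append_left {l m : List Bool} {b : ℕ} (h : b < l.length) :
    bitAt (l ++ m) b = bitAt l b := by
  simp [bitAt, List.head?_drop, List.getElem?_append_left h]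

theorem bitAt_of_lt {l : List Bool} {b : ℕ} (h : b < l.length) : bitAt l b = l[b] := by
  simp [bitAt, List.head?_drop, h]

theorem bitAt_flatten {n : ℕ} {j : ℕ} (hj : j < n) (L : List (List Bool))
    (hL : ∀ r ∈ L, r.length = n) (i : ℕ) (hi : i < L.length) :
    bitAt L.flatten (n * i + j) = bitAt L[i] j := by
  induction L generalizing i with
  | nil => simp at hi
  | cons r L ih =>
    have hr := hL r (by simp)
    cases i with
    | zero => simpa using bitAt_append_left (by omega)
    | succ i =>
      have h1 := ih (fun r hr => hL r (by simp [hr])) i (by simpa using hi)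
      simp only [List.flatten_cons, List.getElem_cons_succ]
      rw [← h1, bitAt, bitAt, List.drop_append, List.drop_of_length_le (by rw [hr]; nlinarith),
        List.nil_append]
      congr 3
      rw [hr, Nat.mul_add]; omega

/-- `adjB` symmetrizes the matrix and ignores its diagonal so that every string describes a simple
graph; on the matrix of an actual graph this changes nothing. -/
theorem parse_encode (I : VCInstance) :
    (parse I.encode).1.1 = I.n ∧ (parse I.encode).2.2 = I.k ∧
    (∀ i : Fin I.n, i.1 ∈ (parse I.encode).2.1 ↔ i ∈ I.X) ∧
    (∀ v ∈ (parse I.encode).2.1, v < I.n) ∧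
    ∀ i j : Fin I.n, (matrixGraph (parse I.encode).1).Adj i j ↔ I.G.Adj i j := by
  classical
  set bits := List.ofFn (fun i : Fin I.n => decide (i ∈ I.X)) with hbits
  set rows := List.ofFn (fun i : Fin I.n => List.ofFn fun j : Fin I.n => decide (I.G.Adj i j))
    with hrows
  have hx : I.encode = List.replicate I.n true ++ false :: (List.replicate I.k true ++ false ::
      (bits ++ rows.flatten)) := by
    simp only [VCInstance.encode, hbits, hrows, List.append_assoc, List.cons_append,
      List.nil_append]
  have hs : splitTrue I.encode = (I.n, false :: (List.replicate I.k true ++ false ::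
      (bits ++ rows.flatten))) := by
    rw [hx, splitTrue_replicate]
  have hs2 : splitTrue (splitTrue I.encode).2.tail = (I.k, false :: (bits ++ rows.flatten)) := by
    rw [hs]; exact splitTrue_replicate _ _
  have hbl : bits.length = I.n := by simp [hbits]
  have hp : parse I.encode = ((I.n, rows.flatten), (List.range I.n).filter
      (fun i => bitAt (bits ++ rows.flatten) i), I.k) := by
    rw [parse, hs2, hs]
    simp only [List.tail_cons]
    rw [← hbl, List.drop_left]
  rw [hp]
  refine ⟨rfl, rfl, fun i => ?_, fun v hv => ?_, fun i j => ?_⟩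
  · simp only [List.mem_filter, List.mem_range, i.2, true_and]
    rw [bitAt_append_left (by rw [hbl]; exact i.2), bitAt_of_lt (by rw [hbl]; exact i.2)]
    simp [hbits]
  · simp only [List.mem_filter, List.mem_range] at hv
    exact hv.1
  · have hb : ∀ i j : Fin I.n, bitAt rows.flatten (I.n * i + j) = decide (I.G.Adj i j) := by
      intro i j
      rw [bitAt_flatten j.2 rows (by simp [hrows, List.mem_ofFn]) i (by simp [hrows]),
        bitAt_of_lt (by simp [hrows])]
      simp [hrows]
    change adjB _ _ _ = true ↔ _
    rw [adjB_iff]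
    simp only [hb, decide_eq_true_eq]
    constructor
    · rintro ⟨_, h | h⟩
      · exact h
      · exact h.symm
    · intro h
      exact ⟨fun hij => h.ne (Fin.ext hij), Or.inl h⟩

/-- All parts of an instance are recovered by `parse`. The problem asks for some instance with the
given encoding, and by uniqueness membership concerns a single graph. -/
theorem encode_injective : Function.Injective VCInstance.encode := by
  intro I J h
  obtain ⟨h1, h2, h3, _, h4⟩ := parse_encode I
  obtain ⟨h1', h2', h3', _, h4'⟩ := parse_encode J
  rw [h] at h1 h2 h3 h4
  obtain ⟨n, G, k, X⟩ := I
  obtain ⟨m, H, k', X'⟩ := J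
  obtain rfl : n = m := h1.symm.trans h1'
  obtain rfl : k = k' := h2.symm.trans h2'
  obtain rfl : G = H := by ext i j; exact (h4 i j).symm.trans (h4' i j)
  obtain rfl : X = X' := by ext i; exact (h3 i).symm.trans (h3' i)
  rfl

/-- Strings that encode instances can be recovered from their parts. -/
theorem encodeSub_parse_encode (I : VCInstance) :
    encodeSub (parse I.encode).1 (List.range (parse I.encode).1.1) (parse I.encode).2.1
      (parse I.encode).2.2 = I.encode := by
  classical
  obtain ⟨h1, h2, h3, -, h4⟩ := parse_encode I
  generalize parse I.encode = p at *
  have hb : (List.range I.n).map (memB p.2.1) = List.ofFn (fun i : Fin I.n => decide (i ∈ I.X)) := by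
    refine List.ext_getElem (by simp) fun i hi hi' => ?_
    have hi'' : i < I.n := by simpa using hi
    rw [Bool.eq_iff_iff]
    simp [memB_iff, ← h3 ⟨i, hi''⟩]
  have hr : (List.range I.n).map (fun i => (List.range I.n).map fun j => adjB p.1 i j) =
      List.ofFn (fun i : Fin I.n => List.ofFn fun j : Fin I.n => decide (I.G.Adj i j)) := by
    refine List.ext_getElem (by simp) fun i hi hi' => ?_
    simp only [List.getElem_map, List.getElem_range, List.getElem_ofFn]
    refine List.ext_getElem (by simp) fun j hj hj' => ?_
    have hi'' : i < I.n := by simpa using hi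
    have hj'' : j < I.n := by simpa using hj
    rw [Bool.eq_iff_iff]
    simp only [List.getElem_map, List.getElem_range, List.getElem_ofFn, decide_eq_true_eq]
    exact h4 ⟨i, hi''⟩ ⟨j, hj''⟩
  simp only [encodeSub, VCInstance.encode, h1, h2, List.flatMap_def, hb, hr, List.length_range]

theorem parse_modulator_lt (x : List Bool) : ∀ v ∈ (parse x).2.1, v < (parse x).1.1 := by
  intro v hv
  simp only [parse, List.mem_filter, List.mem_range] at *
  exact hv.1

theorem parse_modulator_nodup (x : List Bool) : (parse x).2.1.Nodup :=
  List.nodup_range.filter _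

/-- What it means that an encoded induced subgraph belongs to the problem. -/
theorem encodeSub_mem_iff {D : GraphClass} (hD : D.IsoInvariant) {M : ℕ × List Bool}
    {S X : List ℕ} (hS : S.Nodup) {k l : ℕ} :
    (encodeSub M S X k, l) ∈ vertexCoverByModulator D ↔
      (S.filter (memB X)).length = l ∧ InClass D (matrixGraph M) (S.toFinset \ X.toFinset) ∧
        coverNum (matrixGraph M) S.toFinset ≤ k := by
  classical
  let f : Fin S.length ↪ ℕ := ⟨S.get, hS.injective_get⟩
  have hfS : (Finset.univ : Finset (Fin S.length)).map f = S.toFinset := by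
    ext v; simp [f, List.mem_iff_get]
  let X₀ : Finset (Fin S.length) := Finset.univ.filter fun i => memB X (S.get i) = true
  have h1 : (encodeSub M S X k, l) ∈ vertexCoverByModulator D ↔ X₀.card = l ∧
      D ((X₀ : Set (Fin S.length))ᶜ : Set (Fin S.length))
        (((matrixGraph M).comap f).induce (X₀ : Set (Fin S.length))ᶜ) ∧
      ∃ T : Finset (Fin S.length),
        ((matrixGraph M).comap f).IsVertexCover (T : Set (Fin S.length)) ∧ T.card ≤ k := by
    constructor
    · rintro ⟨J, hJ, h⟩
      have : J = instOf M S X k := encode_injective (hJ.trans (encode_instOf M S X k).symm)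
      subst this
      exact h
    · exact fun h => ⟨instOf M S X k, encode_instOf M S X k, h⟩
  have hmem : ∀ v, (∃ i, S.get i = v) ↔ v ∈ S := fun v => List.mem_iff_get.symm
  have hXmap : X₀.map f = (S.filter (memB X)).toFinset := by
    ext v
    simp only [X₀, f, Finset.mem_map, Finset.mem_filter, Finset.mem_univ, true_and,
      List.mem_toFinset, List.mem_filter, Function.Embedding.coeFn_mk]
    constructor
    · rintro ⟨i, hi, rfl⟩; exact ⟨List.get_mem S i, hi⟩
    · rintro ⟨hv, hm⟩
      obtain ⟨i, rfl⟩ := List.mem_iff_get.1 hv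
      exact ⟨i, hm, rfl⟩
  have h2 : X₀.card = (S.filter (memB X)).length := by
    rw [← Finset.card_map f, hXmap, List.toFinset_card_of_nodup (hS.filter _)]
  have h3 : D ((X₀ : Set (Fin S.length))ᶜ : Set (Fin S.length))
        (((matrixGraph M).comap f).induce (X₀ : Set (Fin S.length))ᶜ) ↔
      InClass D (matrixGraph M) (S.toFinset \ X.toFinset) := by
    have e1 : (X₀ᶜ).map f = S.toFinset \ X.toFinset := by
      rw [Finset.compl_eq_univ_sdiff, Finset.map_sdiff, hfS, hXmap]
      ext v
      simp only [Finset.mem_sdiff, List.mem_toFinset, List.mem_filter, memB_iff]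
      tauto
    rw [← e1, inClass_map hD]
    exact (inClass_of_iso hD (inducedIso (SimpleGraph.Iso.refl (G := (matrixGraph M).comap f))
      fun x => by simp)).symm
  have h4 : (∃ T : Finset (Fin S.length),
        ((matrixGraph M).comap f).IsVertexCover (T : Set (Fin S.length)) ∧ T.card ≤ k) ↔
      coverNum (matrixGraph M) S.toFinset ≤ k := by
    rw [← hfS, coverNum_map]
    constructor
    · rintro ⟨T, hT, hc⟩
      exact (isVertexCover_iff_coversOn.1 hT).coverNum_le.trans hc
    · intro h
      obtain ⟨T, hT, hc⟩ := exists_coversOn_card_eq ((matrixGraph M).comap f) Finset.univ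
      exact ⟨T, isVertexCover_iff_coversOn.2 hT, hc.trans_le h⟩
  rw [h1, h2, h3, h4]

/-! ### Running times of the elementary graph operations -/

namespace PolyTime

@[fun_prop]
theorem bitAt' {l : α → List Bool} {b : α → ℕ} (hl : PolyTime l) (hb : PolyTime b) :
    PolyTime (fun a => bitAt (l a) (b a)) := by
  unfold bitAt; fun_prop

@[fun_prop]
theorem adjB' {M : α → ℕ × List Bool} {i j : α → ℕ} (hM : PolyTime M) (hi : PolyTime i)
    (hj : PolyTime j) : PolyTime (fun a => adjB (M a) (i a) (j a)) := by
  unfold adjB; fun_prop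

@[fun_prop]
theorem memB' {X : α → List ℕ} {v : α → ℕ} (hX : PolyTime X) (hv : PolyTime v) :
    PolyTime (fun a => memB (X a) (v a)) := by
  unfold memB; fun_prop

@[fun_prop]
theorem encodeSub' {M : α → ℕ × List Bool} {S X : α → List ℕ} {k : α → ℕ} (hM : PolyTime M)
    (hS : PolyTime S) (hX : PolyTime X) (hk : PolyTime k) :
    PolyTime (fun a => encodeSub (M a) (S a) (X a) (k a)) := by
  unfold encodeSub; fun_prop

@[fun_prop]
theorem splitTrue' {x : α → List Bool} (hx : PolyTime x) :
    PolyTime (fun a => splitTrue (x a)) := by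
  unfold splitTrue
  refine iterate_of_growth
    (f := fun _ (p : ℕ × List Bool) => cond (p.2.headD false) (p.1 + 1, p.2.tail) p)
    (by fun_prop) (by fun_prop) (by fun_prop) 2 fun a p => ?_
  have := sz_sublist_le (List.tail_sublist p.2)
  cases p.2.headD false <;> simp [sz_prod p]; omega

end PolyTime

/-! ### Components -/

/-- The component of `v` in the subgraph induced by `S`. -/
def compList (M : ℕ × List Bool) (S : List ℕ) (v : ℕ) : List ℕ :=
  (fun R => S.filter fun u => memB R u || R.any fun w => adjB M u w)^[S.length] [v]

/-- The first vertices of the components. -/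
def reps (M : ℕ × List Bool) (S : List ℕ) : List ℕ :=
  S.filter fun v => ((compList M S v).headD 0).beq v

@[fun_prop]
theorem PolyTime.compList' {M : α → ℕ × List Bool} {S : α → List ℕ} {v : α → ℕ}
    (hM : PolyTime M) (hS : PolyTime S) (hv : PolyTime v) :
    PolyTime (fun a => compList (M a) (S a) (v a)) := by
  unfold compList
  obtain ⟨p, hp⟩ := hS.exists_size_le
  refine iterate_of_growth
    (f := fun a R => (S a).filter fun u => memB R u || R.any fun w => adjB (M a) u w)
    (by fun_prop) (by fun_prop) (by fun_prop) p fun a R => ?_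
  exact (sz_sublist_le List.filter_sublist).trans ((hp a).trans (Nat.le_add_left _ _))

@[fun_prop]
theorem PolyTime.reps' {M : α → ℕ × List Bool} {S : α → List ℕ}
    (hM : PolyTime M) (hS : PolyTime S) : PolyTime (fun a => reps (M a) (S a)) := by
  unfold reps; fun_prop

section

variable {M : ℕ × List Bool} {S : List ℕ}

theorem mem_compList {u v : ℕ} (hv : v ∈ S) :
    u ∈ compList M S v ↔ u ∈ compOn (matrixGraph M) S.toFinset v := by
  set f : List ℕ → List ℕ := fun R => S.filter fun u => memB R u || R.any fun w => adjB M u w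
    with hf
  have hmem : ∀ R u, u ∈ f R ↔ u ∈ S ∧ (u ∈ R ∨ ∃ w ∈ R, (matrixGraph M).Adj u w) := by
    intro R u
    simp only [hf, List.mem_filter, Bool.or_eq_true, memB_iff, List.any_eq_true]
    rfl
  have hS' : ∀ u, u ∈ S.toFinset ↔ u ∈ S := fun u => List.mem_toFinset
  constructor
  · have : ∀ j u, u ∈ f^[j] [v] → u ∈ compOn (matrixGraph M) S.toFinset v := by
      intro j
      induction j with
      | zero =>
        intro u hu
        rw [Function.iterate_zero, id, List.mem_singleton] at hu
        subst hu
        exact self_mem_compOn ((hS' u).2 hv)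
      | succ j ih =>
        intro u hu
        rw [Function.iterate_succ_apply', hmem] at hu
        rcases hu with ⟨hu, h | ⟨w, hw, h⟩⟩
        · exact ih u h
        · have := mem_compOn.1 (ih w hw)
          exact mem_compOn.2 ⟨(hS' u).2 hu, this.2.tail ⟨this.1, (hS' u).2 hu, h.symm⟩⟩
    exact this _ u
  · intro hu
    have key : ∀ j (a : (S.toFinset : Set ℕ)) (p : ((matrixGraph M).induce
        (S.toFinset : Set ℕ)).Walk a ⟨v, (hS' v).2 hv⟩), p.length ≤ j → a.1 ∈ f^[j] [v] := by
      intro j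
      induction j with
      | zero =>
        intro a p hp
        cases p with
        | nil => simp
        | cons h p => simp at hp
      | succ j ih =>
        intro a p hp
        rw [Function.iterate_succ_apply', hmem]
        refine ⟨(hS' _).1 a.2, ?_⟩
        cases p with
        | nil => exact Or.inl (ih _ SimpleGraph.Walk.nil (by simp))
        | cons h p => exact Or.inr ⟨_, ih _ p (by simpa using hp), h⟩
    obtain ⟨huS, h⟩ := mem_compOn.1 hu
    obtain ⟨p, hp⟩ := ((reachable_iff ((hS' v).2 hv) huS).2 h).symm.exists_isPath
    refine key S.length ⟨u, huS⟩ p ?_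
    -- A path has fewer edges than there are vertices, so |S| rounds reach the whole component.
    have h1 := hp.length_lt
    have h2 : Fintype.card (S.toFinset : Set ℕ) = S.toFinset.card := by
      rw [← Set.toFinset_card]; simp
    have h3 := S.toFinset_card_le
    omega

/-- The list keeps the order of S, so vertices of one component produce literally the same list,
whose head is a canonical representative. As S is nonempty, at least one round of filtering has
taken place. -/
theorem compList_eq_filter {v : ℕ} (hv : v ∈ S) :
    compList M S v = S.filter fun u => memB (compList M S v) u := by
  have h1 : ∃ (n : ℕ), S.length = n + 1 :=
    ⟨S.length - 1, by have := List.length_pos_of_mem hv; omega⟩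
  obtain ⟨n, hn⟩ := h1
  obtain ⟨p, hp⟩ : ∃ p : ℕ → Bool, compList M S v = S.filter p := by
    rw [compList, hn, Function.iterate_succ_apply']
    exact ⟨_, rfl⟩
  conv_lhs => rw [hp]
  refine List.filter_congr fun u hu => ?_
  rw [Bool.eq_iff_iff, memB_iff, hp, List.mem_filter]
  simp [hu]

theorem compList_sublist {v : ℕ} (hv : v ∈ S) : (compList M S v).Sublist S := by
  rw [compList_eq_filter hv]; exact List.filter_sublist

theorem toFinset_compList {v : ℕ} (hv : v ∈ S) :
    (compList M S v).toFinset = compOn (matrixGraph M) S.toFinset v := by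
  ext u; rw [List.mem_toFinset, mem_compList hv]

theorem compList_eq_iff {u v : ℕ} (hu : u ∈ S) (hv : v ∈ S) :
    compList M S u = compList M S v ↔
      compOn (matrixGraph M) S.toFinset u = compOn (matrixGraph M) S.toFinset v := by
  constructor
  · intro h
    rw [← toFinset_compList hu, ← toFinset_compList hv, h]
  · intro h
    rw [compList_eq_filter hu, compList_eq_filter hv]
    refine List.filter_congr fun w _ => ?_
    rw [Bool.eq_iff_iff, memB_iff, memB_iff, mem_compList hu, mem_compList hv, h]

theorem reps_sublist : (reps M S).Sublist S := List.filter_sublist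

theorem reps_injOn {u v : ℕ} (hu : u ∈ reps M S) (hv : v ∈ reps M S)
    (h : compList M S u = compList M S v) : u = v := by
  simp only [reps, List.mem_filter, Nat.beq_eq] at hu hv
  rw [← hu.2, ← hv.2, h]

theorem exists_rep {v : ℕ} (hv : v ∈ S) : ∃ r ∈ reps M S, compList M S r = compList M S v := by
  have h1 : v ∈ compList M S v := (mem_compList hv).2 (self_mem_compOn (List.mem_toFinset.2 hv))
  obtain ⟨r, l, hrl⟩ : ∃ r l, compList M S v = r :: l := by
    cases h : compList M S v with
    | nil => rw [h] at h1; simp at h1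
    | cons r l => exact ⟨r, l, rfl⟩
  have hr : r ∈ compList M S v := by rw [hrl]; simp
  have hrS : r ∈ S := (compList_sublist hv).subset hr
  have heq : compList M S r = compList M S v :=
    (compList_eq_iff hrS hv).2 (compOn_eq ((mem_compList hv).1 hr))
  refine ⟨r, ?_, heq⟩
  simp only [reps, List.mem_filter, Nat.beq_eq]
  exact ⟨hrS, by rw [heq, hrl]; rfl⟩

theorem reps_pairwise {u v : ℕ} (hu : u ∈ reps M S) (hv : v ∈ reps M S) (huv : u ≠ v) :
    compOn (matrixGraph M) S.toFinset u ≠ compOn (matrixGraph M) S.toFinset v := fun h =>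
  huv (reps_injOn hu hv ((compList_eq_iff (reps_sublist.subset hu) (reps_sublist.subset hv)).2 h))

theorem biUnion_reps :
    (reps M S).toFinset.biUnion (compOn (matrixGraph M) S.toFinset) = S.toFinset := by
  ext u
  simp only [Finset.mem_biUnion, List.mem_toFinset]
  constructor
  · rintro ⟨r, _, hu⟩
    exact List.mem_toFinset.1 (compOn_subset hu)
  · intro hu
    obtain ⟨r, hr, h⟩ := exists_rep (M := M) hu
    refine ⟨r, hr, ?_⟩
    rw [← mem_compList (reps_sublist.subset hr), h, mem_compList hu]
    exact self_mem_compOn (List.mem_toFinset.2 hu)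

theorem coverNum_eq_sum_reps :
    coverNum (matrixGraph M) S.toFinset =
      ∑ r ∈ (reps M S).toFinset, coverNum (matrixGraph M)
        (compOn (matrixGraph M) S.toFinset r) := by
  conv_lhs => rw [← biUnion_reps (M := M)]
  refine coverNum_biUnion (fun i hi j hj hij => ?_) (fun i hi j hj hij => ?_) <;>
    rw [List.mem_toFinset] at hi hj
  · exact compOn_disjoint (reps_pairwise hi hj hij)
  · exact noEdges_compOn_compOn (reps_pairwise hi hj hij)

end

/-! ### Vertex cover numbers of graphs of bounded elimination distance -/

/-- The vertex cover number of a subgraph in the base class, found with an oracle for instances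
without modulator. -/
def baseNum (O : List Bool → Bool) (M : ℕ × List Bool) (S : List ℕ) : Option ℕ :=
  cond (O (encodeSub M S [] ((fun k => cond (O (encodeSub M S [] k)) k (k + 1))^[S.length] 0)))
    (some ((fun k => cond (O (encodeSub M S [] k)) k (k + 1))^[S.length] 0)) none

/-- The values obtained by branching on a vertex whose deletion leads to a good subgraph. -/
def branchNums (F : List ℕ → Option ℕ) (M : ℕ × List Bool) (H : List ℕ) : List ℕ :=
  H.flatMap fun v => (F (H.filter fun u => !u.beq v)).elim [] fun a =>
    (F (H.filter fun u => !u.beq v && !adjB M v u)).elim [] fun c =>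
      [min (a + 1) ((H.filter fun u => adjB M v u).length + c)]

/-- The sum of a list of numbers, provided that all are defined. -/
def sumOption (L : List (Option ℕ)) : Option ℕ :=
  cond (L.all fun o => o.isSome) (some (L.map fun o => o.getD 0).sum) none

/-- The vertex cover number of a subgraph of elimination distance at most `i`. -/
def optNum (O : List Bool → Bool) (M : ℕ × List Bool) : ℕ → List ℕ → Option ℕ
  | 0, S => baseNum O M S
  | i + 1, S => sumOption <| (reps M S).map fun r =>
      (baseNum O M (compList M S r)).elim (branchNums (optNum O M i) M (compList M S r)).head? some

namespace PolyTime

@[fun_prop]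
theorem baseNum' {O : α → List Bool → Bool} {M : α → ℕ × List Bool} {S : α → List ℕ}
    (hO : PolyTime fun p : α × List Bool => O p.1 p.2) (hM : PolyTime M) (hS : PolyTime S) :
    PolyTime (fun a => baseNum (O a) (M a) (S a)) := by
  have hO' : ∀ {δ : Type} [Enc δ] {u : δ → α} {y : δ → List Bool}, PolyTime u → PolyTime y →
      PolyTime (fun d => O (u d) (y d)) := fun hu hy => hO.comp' (hu.prodMk hy)
  have hk : PolyTime fun a => (fun k => cond (O a (encodeSub (M a) (S a) [] k)) k
      (k + 1))^[(S a).length] 0 := by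
    refine iterate_of_growth (f := fun a k => cond (O a (encodeSub (M a) (S a) [] k)) k
      (k + 1)) (by fun_prop) (by fun_prop) ?_ 2 fun a k => ?_
    · exact cond' (hO' (by fun_prop) (by fun_prop)) (by fun_prop) (by fun_prop)
    · cases O a (encodeSub (M a) (S a) [] k) <;> simp; omega
  unfold baseNum
  exact cond' (hO' (by fun_prop) (by fun_prop)) (by fun_prop) (by fun_prop)

@[fun_prop]
theorem branchNums' {F : α → List ℕ → Option ℕ} {M : α → ℕ × List Bool} {S : α → List ℕ}
    (hF : PolyTime fun p : α × List ℕ => F p.1 p.2) (hM : PolyTime M) (hS : PolyTime S) :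
    PolyTime (fun a => branchNums (F a) (M a) (S a)) := by
  have hF' : ∀ {δ : Type} [Enc δ] {u : δ → α} {y : δ → List ℕ}, PolyTime u → PolyTime y →
      PolyTime (fun d => F (u d) (y d)) := fun hu hy => hF.comp' (hu.prodMk hy)
  unfold branchNums
  refine list_flatMap hS (option_elim (hF' (by fun_prop) (by fun_prop)) (by fun_prop)
    (option_elim (hF' (by fun_prop) (by fun_prop)) (by fun_prop) (by fun_prop)))

@[fun_prop]
theorem sumOption' {L : α → List (Option ℕ)} (hL : PolyTime L) :
    PolyTime (fun a => sumOption (L a)) := by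
  unfold sumOption; fun_prop

-- The recursion has constant depth, and each level makes polynomially many calls, so induction on
-- the level suffices.
@[fun_prop]
theorem optNum' {O : α → List Bool → Bool} {M : α → ℕ × List Bool} {i : ℕ} {S : α → List ℕ}
    (hO : PolyTime fun p : α × List Bool => O p.1 p.2) (hM : PolyTime M) (hS : PolyTime S) :
    PolyTime (fun a => optNum (O a) (M a) i (S a)) := by
  suffices h : PolyTime (fun p : α × List ℕ => optNum (O p.1) (M p.1) i p.2) from
    h.comp' (f := fun a => (a, S a)) (by fun_prop)
  have hO' : ∀ {δ : Type} [Enc δ] {u : δ → α} {y : δ → List Bool}, PolyTime u → PolyTime y →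
      PolyTime (fun d => O (u d) (y d)) := fun hu hy => hO.comp' (hu.prodMk hy)
  induction i with
  | zero => exact baseNum' (hO' (by fun_prop) (by fun_prop)) (by fun_prop) (by fun_prop)
  | succ i ih =>
    simp only [optNum]
    refine sumOption' (list_map (by fun_prop) (option_elim
      (baseNum' (hO' (by fun_prop) (by fun_prop)) (by fun_prop) (by fun_prop))
      (list_head? (branchNums' ?_ (by fun_prop) (by fun_prop))) (by fun_prop)))
    exact ih.comp' (f := fun p : ((α × List ℕ) × ℕ) × List ℕ => (p.1.1.1, p.2)) (by fun_prop)

end PolyTime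

/-! ### Correctness of the computed cover numbers -/

/-- The oracle `O` decides Vertex Cover on induced subgraphs on at most `n` vertices, together with
membership in `C`. -/
def DecidesVC (C : GraphClass) (O : List Bool → Bool) (M : ℕ × List Bool) (n : ℕ) : Prop :=
  ∀ S : List ℕ, S.Nodup → S.length ≤ n → ∀ k ≤ n, (O (encodeSub M S [] k) = true ↔
    InClass C (matrixGraph M) S.toFinset ∧ coverNum (matrixGraph M) S.toFinset ≤ k)

theorem sumOption_map_eq_some {L : List ℕ} {f : ℕ → Option ℕ} {g : ℕ → ℕ}
    (h : ∀ r ∈ L, f r = some (g r)) : sumOption (L.map f) = some (L.map g).sum := by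
  have h1 : (L.map f).all (fun o => o.isSome) = true := by
    simp only [List.all_eq_true, List.mem_map]
    rintro _ ⟨r, hr, rfl⟩
    rw [h r hr]; rfl
  have h2 : (L.map f).map (fun o => o.getD 0) = L.map g := by
    rw [List.map_map]
    refine List.map_congr_left fun r hr => ?_
    simp [h r hr]
  rw [sumOption, h1, h2, cond_true]

theorem sumOption_map_eq_none {L : List ℕ} {f : ℕ → Option ℕ} {r : ℕ} (hr : r ∈ L)
    (h : f r = none) : sumOption (L.map f) = none := by
  have h1 : (L.map f).all (fun o => o.isSome) = false := by
    rw [← Bool.not_eq_true, List.all_eq_true]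
    intro hall
    have := hall _ (List.mem_map_of_mem hr)
    rw [h] at this
    simp at this
  rw [sumOption, h1, cond_false]

theorem List.toFinset_filter_ne {S : List ℕ} {v : ℕ} :
    (S.filter fun u => !u.beq v).toFinset = S.toFinset.erase v := by
  ext u
  simp only [List.mem_toFinset, List.mem_filter, Finset.mem_erase, Bool.not_eq_true',
    ← Bool.not_eq_true, Nat.beq_eq]
  tauto

section

variable {C : GraphClass} {O : List Bool → Bool} {M : ℕ × List Bool} {n : ℕ}

theorem linear_search {p : ℕ → Bool} {m t : ℕ} (h : ∀ k ≤ m, (p k = true ↔ t ≤ k))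
    (ht : t ≤ m) : (fun k => cond (p k) k (k + 1))^[m] 0 = t := by
  have key : ∀ j ≤ m, (fun k => cond (p k) k (k + 1))^[j] 0 = min j t := by
    intro j
    induction j with
    | zero => simp
    | succ j ih =>
      intro hj
      rw [Function.iterate_succ_apply', ih (by omega)]
      by_cases hjt : t ≤ min j t
      · rw [(h _ (by omega)).2 hjt, cond_true]; omega
      · have : p (min j t) = false := by
          rw [← Bool.not_eq_true, h _ (by omega)]; exact hjt
        rw [this, cond_false]; omega
  rw [key m le_rfl]; omega

open Classical in
-- Inside the class the oracle accepts exactly the budgets from the cover number on, and the search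
-- stops there. Outside it every query is rejected, which the last query reveals.
theorem baseNum_eq (hO : DecidesVC C O M n) {S : List ℕ} (hS : S.Nodup) (hn : S.length ≤ n) :
    baseNum O M S = if InClass C (matrixGraph M) S.toFinset then
      some (coverNum (matrixGraph M) S.toFinset) else none := by
  have hc : coverNum (matrixGraph M) S.toFinset ≤ S.length :=
    coverNum_le_card.trans S.toFinset_card_le
  have hO' := hO S hS hn
  split_ifs with h
  · have h1 : (fun k => cond (O (encodeSub M S [] k)) k (k + 1))^[S.length] 0 =
        coverNum (matrixGraph M) S.toFinset := by
      refine linear_search (p := fun k => O (encodeSub M S [] k)) (fun k hk => ?_) hc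
      rw [hO' k (hk.trans hn)]
      simp [h]
    rw [baseNum, h1, (hO' _ (hc.trans hn)).2 ⟨h, le_rfl⟩, cond_true]
  · have h1 : ∀ j ≤ S.length,
        (fun k => cond (O (encodeSub M S [] k)) k (k + 1))^[j] 0 ≤ j := by
      intro j
      induction j with
      | zero => simp
      | succ j ih =>
        intro hj
        have := ih (by omega)
        rw [Function.iterate_succ_apply']
        cases O (encodeSub M S [] ((fun k => cond (O (encodeSub M S [] k)) k (k + 1))^[j] 0)) <;>
          simp only [cond_true, cond_false] <;> omega
    have h2 := hO' _ ((h1 _ le_rfl).trans hn)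
    rw [baseNum, Bool.eq_false_iff.2 fun h3 => h (h2.1 h3).1, cond_false]

open Classical in
-- Used for branching: all successful branches return the same value, the cover number, so the first
-- may be taken.
theorem head?_flatMap_ite {H : List ℕ} {f : ℕ → List ℕ} {p : ℕ → Prop} {c : ℕ}
    (h : ∀ v ∈ H, f v = if p v then [c] else []) :
    (H.flatMap f).head? = if ∃ v ∈ H, p v then some c else none := by
  induction H with
  | nil => simp
  | cons v H ih =>
    have ih := ih fun w hw => h w (by simp [hw])
    rw [List.flatMap_cons, h v (by simp)]
    by_cases hv : p v
    · simp [hv]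
    · rw [if_neg hv, List.nil_append, ih]
      simp [hv]

open Classical in
-- A component in C is left to the oracle. Any other one in the class has a vertex v whose deletion
-- leads to distance i; so does deleting N[v], by heredity, and `coverNum_branch` combines the two
-- values. The value `none` signals non-membership, so `optNum` also recognizes `C.elim i`.
theorem optNum_eq (hiso : C.IsoInvariant) (hher : C.Hereditary) (hrob : C.Robust)
    (hO : DecidesVC C O M n) (i : ℕ) {S : List ℕ} (hS : S.Nodup) (hn : S.length ≤ n) :
    optNum O M i S = if InClass (C.elim i) (matrixGraph M) S.toFinset then
      some (coverNum (matrixGraph M) S.toFinset) else none := by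
  induction i generalizing S with
  | zero =>
    rw [optNum, baseNum_eq hO hS hn]
    simp only [inClass_elim_zero_iff hrob]
  | succ i ih =>
    set G := matrixGraph M with hG
    have hpiece : ∀ r ∈ reps M S, (baseNum O M (compList M S r)).elim
        (branchNums (optNum O M i) M (compList M S r)).head? some =
        if InClass (C.elim (i + 1)) G (compOn G S.toFinset r) then
          some (coverNum G (compOn G S.toFinset r)) else none := by
      intro r hr
      have hrS := reps_sublist.subset hr
      have hsub := compList_sublist (M := M) hrS
      have hH := hsub.nodup hS
      have hHn := hsub.length_le.trans hn
      rw [← toFinset_compList hrS]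
      have hconn : (G.induce ((compList M S r).toFinset : Set ℕ)).Connected := by
        rw [toFinset_compList hrS]; exact connected_compOn (List.mem_toFinset.2 hrS)
      rw [inClass_elim_succ_iff hiso hconn, baseNum_eq hO hH hHn]
      generalize compList M S r = H at *
      by_cases h0 : InClass C G H.toFinset
      · rw [if_pos (hG ▸ h0), if_pos (Or.inl h0)]; rfl
      rw [if_neg (hG ▸ h0)]
      simp only [Option.elim_none, h0, false_or]
      have hF : ∀ p : ℕ → Bool, optNum O M i (H.filter p) =
          if InClass (C.elim i) G (H.filter p).toFinset then
            some (coverNum G (H.filter p).toFinset) else none := fun p =>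
        ih (hH.filter p) ((List.length_filter_le _ _).trans hHn)
      have hnb : ∀ v, (H.filter fun u => adjB M v u).toFinset = nbrsIn G H.toFinset {v} := by
        intro v
        ext u
        simp only [List.mem_toFinset, List.mem_filter, nbrsIn, Finset.mem_filter,
          Finset.mem_singleton, exists_eq_left]
        rfl
      have hdel : ∀ v, (H.filter fun u => !u.beq v && !adjB M v u).toFinset =
          H.toFinset.erase v \ nbrsIn G H.toFinset {v} := by
        intro v
        ext u
        simp only [← hnb, Finset.mem_sdiff, Finset.mem_erase, List.mem_toFinset, List.mem_filter,
          Bool.and_eq_true, Bool.not_eq_true', ← Bool.not_eq_true, Nat.beq_eq]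
        tauto
      rw [branchNums, head?_flatMap_ite (p := fun v => InClass (C.elim i) G (H.toFinset.erase v))
        (c := coverNum G H.toFinset)]
      · simp only [List.mem_toFinset]
      · intro v hv
        rw [hF, hF, List.toFinset_filter_ne, hdel]
        by_cases hv' : InClass (C.elim i) G (H.toFinset.erase v)
        · rw [if_pos hv', if_pos hv', if_pos (hv'.elim_mono hiso hher hrob Finset.sdiff_subset),
            coverNum_branch (List.mem_toFinset.2 hv), ← hnb,
            List.toFinset_card_of_nodup (hH.filter _)]
          rfl
        · rw [if_neg hv', if_neg hv']; rfl
    rw [optNum]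
    by_cases hall : ∀ r ∈ reps M S, InClass (C.elim (i + 1)) G (compOn G S.toFinset r)
    · have hin : InClass (C.elim (i + 1)) G S.toFinset := by
        rw [inClass_iff_forall_compOn (isoInvariant_elim hiso _) (robust_elim hiso hrob _)]
        intro v hv
        obtain ⟨r, hr, h⟩ := exists_rep (M := M) (List.mem_toFinset.1 hv)
        rw [← (compList_eq_iff (reps_sublist.subset hr) (List.mem_toFinset.1 hv)).1 h]
        exact hall r hr
      rw [if_pos hin, sumOption_map_eq_some (g := fun r => coverNum G (compOn G S.toFinset r))
        fun r hr => by rw [hpiece r hr, if_pos (hall r hr)]]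
      rw [hG, coverNum_eq_sum_reps, List.sum_toFinset _ (reps_sublist.nodup hS)]
    · have hin : ¬ InClass (C.elim (i + 1)) G S.toFinset := fun h => hall fun r hr =>
        h.elim_mono hiso hher hrob compOn_subset
      push Not at hall
      obtain ⟨r, hr, h⟩ := hall
      rw [if_neg hin, sumOption_map_eq_none hr (by rw [hpiece r hr, if_neg h])]

end

/-! ### Matching by auction

Keys `0, …, N - 1` are matched to identifiers in a list `H`. The state lists for every key its price
and its owner. In every step an identifier that owns no key acquires the cheapest key that it is
related to, as long as the price is below `N + 1`, and the price rises by one. -/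

/-- Whether `h` owns a key. -/
def ownsKey (st : List (ℕ × ℕ × Option ℕ)) (h : ℕ) : Bool :=
  st.any fun e => e.2.2.elim false fun h' => h'.beq h

/-- The possible acquisitions. -/
def bids (N : ℕ) (H : List ℕ) (rel : ℕ → ℕ → Bool) (st : List (ℕ × ℕ × Option ℕ)) :
    List (ℕ × ℕ) :=
  H.flatMap fun h => cond (ownsKey st h) [] <|
    (st.filter fun e => (rel h e.1 && e.2.1.ble N) &&
      st.all fun e' => !rel h e'.1 || e.2.1.ble e'.2.1).map fun e => (h, e.1)

/-- One step of the auction. -/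
def auctionStep (N : ℕ) (H : List ℕ) (rel : ℕ → ℕ → Bool) (st : List (ℕ × ℕ × Option ℕ)) :
    List (ℕ × ℕ × Option ℕ) :=
  (bids N H rel st).head?.elim st fun c =>
    st.map fun e => cond (e.1.beq c.2) (e.1, e.2.1 + 1, some c.1) e

/-- The final state of the auction. -/
def auction (N : ℕ) (H : List ℕ) (rel : ℕ → ℕ → Bool) : List (ℕ × ℕ × Option ℕ) :=
  (auctionStep N H rel)^[N * (N + 1) + 1] ((List.range N).map fun j => (j, 0, none))

/-- The invariant of the auction. -/
structure AuctionInv (N : ℕ) (H : List ℕ) (rel : ℕ → ℕ → Bool)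
    (st : List (ℕ × ℕ × Option ℕ)) : Prop where
  keys : st.map (fun e => e.1) = List.range N
  price_le : ∀ e ∈ st, e.2.1 ≤ N + 1
  mem : ∀ e ∈ st, ∀ h, e.2.2 = some h → h ∈ H
  related : ∀ e ∈ st, ∀ h, e.2.2 = some h → rel h e.1 = true
  envy : ∀ e ∈ st, ∀ h, e.2.2 = some h → ∀ e' ∈ st, rel h e'.1 = true → e.2.1 ≤ e'.2.1 + 1
  priced : ∀ e ∈ st, 0 < e.2.1 → ∃ h, e.2.2 = some h
  inj : ∀ e ∈ st, ∀ e' ∈ st, ∀ h, e.2.2 = some h → e'.2.2 = some h → e.1 = e'.1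

section

variable {N : ℕ} {H : List ℕ} {rel : ℕ → ℕ → Bool} {st : List (ℕ × ℕ × Option ℕ)}

theorem ownsKey_iff {h : ℕ} : ownsKey st h = true ↔ ∃ e ∈ st, e.2.2 = some h := by
  simp only [ownsKey, List.any_eq_true]
  refine exists_congr fun e => and_congr_right fun _ => ?_
  cases e.2.2 <;> simp

theorem mem_bids {c : ℕ × ℕ} : c ∈ bids N H rel st ↔ c.1 ∈ H ∧ ownsKey st c.1 = false ∧
    ∃ e ∈ st, e.1 = c.2 ∧ rel c.1 e.1 = true ∧ e.2.1 ≤ N ∧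
      ∀ e' ∈ st, rel c.1 e'.1 = true → e.2.1 ≤ e'.2.1 := by
  obtain ⟨h, k⟩ := c
  simp only [bids, List.mem_flatMap]
  constructor
  · rintro ⟨h', hh', hc⟩
    cases ho : ownsKey st h' with
    | true => rw [ho] at hc; simp at hc
    | false =>
      rw [ho, cond_false, List.mem_map] at hc
      obtain ⟨e, he, heq⟩ := hc
      obtain ⟨rfl, rfl⟩ := Prod.mk.inj heq
      simp only [List.mem_filter, Bool.and_eq_true, Nat.ble_eq, List.all_eq_true, Bool.or_eq_true,
        Bool.not_eq_true'] at he
      refine ⟨hh', ho, e, he.1, rfl, he.2.1.1, he.2.1.2, fun e' he' hr => ?_⟩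
      exact (he.2.2 e' he').resolve_left (by simp [hr])
  · rintro ⟨hh, ho, e, he, rfl, hr, hp, hmin⟩
    refine ⟨h, hh, ?_⟩
    rw [show ownsKey st h = false from ho, cond_false, List.mem_map]
    refine ⟨e, ?_, rfl⟩
    simp only [List.mem_filter, Bool.and_eq_true, Nat.ble_eq, List.all_eq_true, Bool.or_eq_true,
      Bool.not_eq_true']
    refine ⟨he, ⟨hr, hp⟩, fun e' he' => ?_⟩
    cases hr' : rel h e'.1
    · exact Or.inl rfl
    · exact Or.inr (hmin e' he' hr')

theorem auctionStep_of_nil (h : bids N H rel st = []) : auctionStep N H rel st = st := by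
  simp [auctionStep, h]

theorem AuctionInv.eq_of_key (hi : AuctionInv N H rel st) {e e' : ℕ × ℕ × Option ℕ}
    (he : e ∈ st) (he' : e' ∈ st) (h : e.1 = e'.1) : e = e' := by
  have hn : (st.map fun e => e.1).Nodup := hi.keys ▸ List.nodup_range
  exact List.inj_on_of_nodup_map hn he he' h

/-- The buyer takes a cheapest related key, so the raised price exceeds those of the other related
keys by at most one; prices never fall, which preserves this for the other owners. The buyer owned
nothing before, so no identifier gets two keys. -/
theorem AuctionInv.step (hi : AuctionInv N H rel st) :
    AuctionInv N H rel (auctionStep N H rel st) ∧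
      (bids N H rel st ≠ [] → ((auctionStep N H rel st).map fun e => e.2.1).sum =
        (st.map fun e => e.2.1).sum + 1) := by
  cases hb : bids N H rel st with
  | nil => rw [auctionStep_of_nil hb]; exact ⟨hi, fun h => absurd rfl h⟩
  | cons c l =>
    have hc : c ∈ bids N H rel st := by rw [hb]; simp
    obtain ⟨hcH, hco, e₀, he₀, hk, hrel, hp, hmin⟩ := mem_bids.1 hc
    obtain ⟨h, k⟩ := c
    dsimp only at hk hrel hp hmin hcH hco
    have hno : ∀ e ∈ st, e.2.2 ≠ some h := fun e he heq => by
      have := ownsKey_iff.2 ⟨e, he, heq⟩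
      rw [hco] at this
      cases this
    set upd : ℕ × ℕ × Option ℕ → ℕ × ℕ × Option ℕ :=
      fun e => cond (e.1.beq k) (e.1, e.2.1 + 1, some h) e with hupd
    have hst : auctionStep N H rel st = st.map upd := by
      simp [auctionStep, hb, hupd]
    have hupd₁ : upd e₀ = (e₀.1, e₀.2.1 + 1, some h) := by
      simp only [hupd]; rw [(Nat.beq_eq ▸ hk : e₀.1.beq k = true), cond_true]
    have hupd₂ : ∀ e ∈ st, e ≠ e₀ → upd e = e := by
      intro e he hne
      have : e.1.beq k = false := by
        rw [← Bool.not_eq_true, Nat.beq_eq]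
        exact fun h => hne (hi.eq_of_key he he₀ (h.trans hk.symm))
      simp only [hupd]; rw [this, cond_false]
    have hfst : ∀ e, (upd e).1 = e.1 := by
      intro e; simp only [hupd]; cases e.1.beq k <;> rfl
    have hcases : ∀ e ∈ st, upd e = e ∧ e ≠ e₀ ∨ e = e₀ := by
      intro e he
      by_cases h : e = e₀
      · exact Or.inr h
      · exact Or.inl ⟨hupd₂ e he h, h⟩
    have hple : ∀ e ∈ st, e.2.1 ≤ (upd e).2.1 := by
      intro e he
      rcases hcases e he with h | rfl
      · rw [h.1]
      · rw [hupd₁]; exact Nat.le_succ _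
    rw [hst]
    refine ⟨⟨?_, ?_, ?_, ?_, ?_, ?_, ?_⟩, fun _ => ?_⟩
    · rw [List.map_map, ← hi.keys]
      exact List.map_congr_left fun e _ => hfst e
    · simp only [List.forall_mem_map]
      intro e he
      rcases hcases e he with h | rfl
      · rw [h.1]; exact hi.price_le e he
      · rw [hupd₁]; exact Nat.succ_le_succ hp
    · simp only [List.forall_mem_map]
      intro e he h' heq
      rcases hcases e he with h | rfl
      · rw [h.1] at heq; exact hi.mem e he h' heq
      · rw [hupd₁] at heq; cases heq; exact hcH
    · simp only [List.forall_mem_map]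
      intro e he h' heq
      rw [hfst]
      rcases hcases e he with h | rfl
      · rw [h.1] at heq; exact hi.related e he h' heq
      · rw [hupd₁] at heq; cases heq; exact hrel
    · simp only [List.forall_mem_map]
      intro e he h' heq e' he' hr
      rw [hfst] at hr
      have h1 := hple e' he'
      rcases hcases e he with h | rfl
      · rw [h.1] at heq ⊢
        exact (hi.envy e he h' heq e' he' hr).trans (Nat.succ_le_succ h1)
      · rw [hupd₁] at heq ⊢
        cases heq
        exact Nat.succ_le_succ ((hmin e' he' hr).trans h1)
    · simp only [List.forall_mem_map]
      intro e he hpos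
      rcases hcases e he with h | rfl
      · rw [h.1] at hpos ⊢; exact hi.priced e he hpos
      · rw [hupd₁]; exact ⟨h, rfl⟩
    · simp only [List.forall_mem_map]
      intro e he e' he' h' heq heq'
      rw [hfst, hfst]
      rcases hcases e he with h1 | rfl <;> rcases hcases e' he' with h2 | rfl
      · rw [h1.1] at heq; rw [h2.1] at heq'; exact hi.inj e he e' he' h' heq heq'
      · rw [h1.1] at heq; rw [hupd₁] at heq'; cases heq'; exact absurd heq (hno e he)
      · rw [h2.1] at heq'; rw [hupd₁] at heq; cases heq; exact absurd heq' (hno e' he')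
      · rfl
    · have hn : st.Nodup := List.Nodup.of_map _ (hi.keys ▸ List.nodup_range)
      obtain ⟨l₁, l₂, hl⟩ := List.append_of_mem he₀
      have h1 : ∀ e ∈ l₁, upd e = e := fun e he => hupd₂ e (by simp [hl, he]) (by
        rintro rfl
        rw [hl, List.nodup_append] at hn
        exact hn.2.2 _ he _ (by simp) rfl)
      have h2 : ∀ e ∈ l₂, upd e = e := fun e he => hupd₂ e (by simp [hl, he]) (by
        rintro rfl
        rw [hl, List.nodup_append, List.nodup_cons] at hn
        exact hn.2.1.1 he)
      rw [hl, List.map_append, List.map_cons, List.map_congr_left h1, List.map_congr_left h2,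
        hupd₁]
      simp; omega

theorem AuctionInv.init : AuctionInv N H rel ((List.range N).map fun j => (j, 0, none)) := by
  constructor <;> simp [Function.comp_def]

theorem AuctionInv.iterate (j : ℕ) : AuctionInv N H rel
    ((auctionStep N H rel)^[j] ((List.range N).map fun j => (j, 0, none))) := by
  induction j with
  | zero => exact .init
  | succ j ih => rw [Function.iterate_succ_apply']; exact ih.step.1

theorem auction_inv : AuctionInv N H rel (auction N H rel) := AuctionInv.iterate _

theorem AuctionInv.length (hi : AuctionInv N H rel st) : st.length = N := by
  simpa using congrArg List.length hi.keys

/-- Every effective step raises the sum of the prices by one, and N prices of at most N + 1 allow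
N(N + 1) such steps. One of N(N + 1) + 1 steps is therefore idle, and from then on the state is
constant. -/
theorem bids_auction : bids N H rel (auction N H rel) = [] := by
  set s : ℕ → List (ℕ × ℕ × Option ℕ) := fun j =>
    (auctionStep N H rel)^[j] ((List.range N).map fun j => (j, 0, none)) with hs
  have hsucc : ∀ j, s (j + 1) = auctionStep N H rel (s j) := fun j =>
    Function.iterate_succ_apply' _ _ _
  have hinv : ∀ j, AuctionInv N H rel (s j) := AuctionInv.iterate
  by_contra hne
  have hconst : ∀ j i, bids N H rel (s j) = [] → s (j + i) = s j := by
    intro j i hj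
    induction i with
    | zero => rfl
    | succ i ih => rw [← add_assoc, hsucc, ih, auctionStep_of_nil hj]
  have hall : ∀ j ≤ N * (N + 1) + 1, bids N H rel (s j) ≠ [] := by
    intro j hj hb
    have := hconst j (N * (N + 1) + 1 - j) hb
    rw [Nat.add_sub_cancel' hj] at this
    exact hne (by rw [show auction N H rel = s (N * (N + 1) + 1) from rfl, this, hb])
  have hsum : ∀ j ≤ N * (N + 1) + 1, j ≤ ((s j).map fun e => e.2.1).sum := by
    intro j
    induction j with
    | zero => simp
    | succ j ih =>
      intro hj
      rw [hsucc, (hinv j).step.2 (hall j (by omega))]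
      exact Nat.succ_le_succ (ih (by omega))
  have h1 := hsum _ le_rfl
  have h2 := List.sum_le_card_nsmul ((s (N * (N + 1) + 1)).map fun e => e.2.1) (N + 1) (by
    simp only [List.forall_mem_map]
    exact (hinv _).price_le)
  rw [List.length_map, (hinv _).length, smul_eq_mul] at h2
  omega

/-- The keys of high price form a set that is matched to identifiers, and that contains every key
related to an identifier matched to it, or unmatched. -/
theorem exists_closed_keys : ∃ (R : Finset ℕ) (own : ℕ → ℕ), Set.InjOn own R ∧
    (∀ j ∈ R, j < N ∧ own j ∈ H ∧ rel (own j) j = true ∧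
      ownsKey (auction N H rel) (own j) = true) ∧
    ∀ h ∈ H, (ownsKey (auction N H rel) h = false ∨ h ∈ R.image own) →
      ∀ j < N, rel h j = true → j ∈ R := by
  have hi := auction_inv (N := N) (H := H) (rel := rel)
  have hb := bids_auction (N := N) (H := H) (rel := rel)
  generalize auction N H rel = st at hi hb
  -- N keys cannot take all the N + 1 prices 1, …, N + 1. A missing price t separates the keys above
  -- it from the others.
  obtain ⟨t, ht1, ht2⟩ : ∃ t ∈ Finset.Icc 1 (N + 1), t ∉ (st.map fun e => e.2.1).toFinset := by
    apply Finset.exists_mem_notMem_of_card_lt_card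
    refine (List.toFinset_card_le _).trans_lt ?_
    rw [List.length_map, hi.length, Nat.card_Icc]; omega
  rw [Finset.mem_Icc] at ht1
  have ht : ∀ e ∈ st, e.2.1 ≠ t := fun e he h => ht2 (by
    rw [List.mem_toFinset, List.mem_map]; exact ⟨e, he, h⟩)
  have hkey : ∀ j < N, ∃ e ∈ st, e.1 = j := fun j hj => by
    have : j ∈ st.map fun e => e.1 := by rw [hi.keys]; simpa using hj
    simpa using this
  set R := ((st.filter fun e => decide (t < e.2.1)).map fun e => e.1).toFinset with hR
  have hmemR : ∀ j, j ∈ R ↔ ∃ e ∈ st, t < e.2.1 ∧ e.1 = j := by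
    intro j; simp only [hR, List.mem_toFinset, List.mem_map, List.mem_filter, decide_eq_true_eq,
      and_assoc]
  have hown : ∀ j, ∃ h, j ∈ R → ∃ e ∈ st, t < e.2.1 ∧ e.1 = j ∧ e.2.2 = some h := by
    intro j
    by_cases hj : j ∈ R
    · obtain ⟨e, he, hte, hej⟩ := (hmemR j).1 hj
      obtain ⟨h, hh⟩ := hi.priced e he (by omega)
      exact ⟨h, fun _ => ⟨e, he, hte, hej, hh⟩⟩
    · exact ⟨0, fun h => absurd h hj⟩
  choose own hown using hown
  refine ⟨R, own, ?_, ?_, ?_⟩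
  · intro j hj j' hj' heq
    obtain ⟨e, he, _, hej, hh⟩ := hown j hj
    obtain ⟨e', he', _, hej', hh'⟩ := hown j' hj'
    rw [← hej, ← hej']
    exact hi.inj e he e' he' _ hh (heq ▸ hh')
  · intro j hj
    obtain ⟨e, he, _, hej, hh⟩ := hown j hj
    refine ⟨?_, hi.mem e he _ hh, by
      have := hi.related e he _ hh
      rwa [hej] at this, ownsKey_iff.2 ⟨e, he, hh⟩⟩
    have : e.1 ∈ st.map fun e => e.1 := List.mem_map_of_mem he
    rw [hi.keys, List.mem_range] at this
    omega
  · intro h hh hcase j hj hrel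
    obtain ⟨e, he, rfl⟩ := hkey j hj
    rw [hmemR]
    refine ⟨e, he, lt_of_le_of_ne ?_ (ht e he).symm, rfl⟩
    rcases hcase with hno | hcase
    · -- otherwise a cheapest related key could be acquired
      by_contra hlt
      obtain ⟨e₁, he₁, hmin⟩ := Finset.exists_min_image
        (st.filter fun e => rel h e.1).toFinset (fun e => e.2.1)
        ⟨e, by simp [he, hrel]⟩
      simp only [List.mem_toFinset, List.mem_filter] at he₁ hmin
      have := hmin e ⟨he, hrel⟩
      have hbid : (h, e₁.1) ∈ bids N H rel st := mem_bids.2 ⟨hh, hno, e₁, he₁.1, rfl, he₁.2,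
        by omega, fun e' he' hr => hmin e' ⟨he', hr⟩⟩
      rw [hb] at hbid
      simp at hbid
    -- The owned key costs more than t, so by `envy` every related key costs at least t, and t is
    -- not a price.
    · obtain ⟨j', hj', rfl⟩ := Finset.mem_image.1 hcase
      obtain ⟨e', he', hte, hej, hh'⟩ := hown j' hj'
      have := hi.envy e' he' _ hh' e he hrel
      omega

/-- There are at most as many owners as keys. -/
theorem length_owners_le (hH : H.Nodup) :
    (H.filter (ownsKey (auction N H rel))).length ≤ N := by
  have hi := auction_inv (N := N) (H := H) (rel := rel)
  generalize auction N H rel = st at hi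
  have h1 : (H.filter (ownsKey st)) ⊆ st.map fun e => e.2.2.getD 0 := by
    intro h hh
    obtain ⟨e, he, heq⟩ := ownsKey_iff.1 (List.mem_filter.1 hh).2
    exact List.mem_map.2 ⟨e, he, by rw [heq]; rfl⟩
  have h2 := ((hH.filter (ownsKey st)).subperm h1).length_le
  rwa [List.length_map, hi.length] at h2

end

namespace PolyTime

/-- The invariant bounds all states: N entries, with keys below N, prices at most N + 1 and owners
from H. -/
theorem auction' {N : α → ℕ} {H : α → List ℕ} {rel : α → ℕ → ℕ → Bool} (hN : PolyTime N)
    (hH : PolyTime H) (hrel : PolyTime fun p : α × ℕ × ℕ => rel p.1 p.2.1 p.2.2) :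
    PolyTime (fun a => auction (N a) (H a) (rel a)) := by
  have hrel' : ∀ {δ : Type} [Enc δ] {u : δ → α} {x y : δ → ℕ}, PolyTime u → PolyTime x →
      PolyTime y → PolyTime (fun d => rel (u d) (x d) (y d)) :=
    fun hu hx hy => hrel.comp' (hu.prodMk (hx.prodMk hy))
  have howns : ∀ {δ : Type} [Enc δ] {st : δ → List (ℕ × ℕ × Option ℕ)} {h : δ → ℕ},
      PolyTime st → PolyTime h → PolyTime (fun d => ownsKey (st d) (h d)) := by
    intro δ _ st h hst hh
    unfold ownsKey
    fun_prop
  have hbids : PolyTime fun p : α × List (ℕ × ℕ × Option ℕ) =>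
      bids (N p.1) (H p.1) (rel p.1) p.2 := by
    unfold bids
    refine list_flatMap (by fun_prop) (cond' (howns (by fun_prop) (by fun_prop)) (by fun_prop)
      (list_map (list_filter (by fun_prop) (and' (and' (hrel' (by fun_prop) (by fun_prop)
        (by fun_prop)) (by fun_prop)) (list_all (by fun_prop) (or' (not' (hrel' (by fun_prop)
        (by fun_prop) (by fun_prop))) (by fun_prop))))) (by fun_prop)))
  have hstep : PolyTime fun p : α × List (ℕ × ℕ × Option ℕ) =>
      auctionStep (N p.1) (H p.1) (rel p.1) p.2 := by
    unfold auctionStep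
    fun_prop
  unfold auction
  obtain ⟨pN, hpN⟩ := hN.exists_size_le
  obtain ⟨pH, hpH⟩ := hH.exists_size_le
  refine iterate_of_bound (f := fun a => auctionStep (N a) (H a) (rel a)) (by fun_prop)
    (by fun_prop) hstep (1 + pN * (10 * pN + pH + 20)) fun a j _ => ?_
  have hi := AuctionInv.iterate (N := N a) (H := H a) (rel := rel a) j
  generalize (auctionStep (N a) (H a) (rel a))^[j] _ = st at hi
  have hNa : N a ≤ pN.eval (sz a) := by have := hpN a; rw [sz_nat] at this; omega
  have hent : ∀ e ∈ st, sz e + 1 ≤ 10 * pN.eval (sz a) + pH.eval (sz a) + 20 := by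
    intro e he
    have h1 : e.1 < N a := by
      have : e.1 ∈ st.map fun e => e.1 := List.mem_map_of_mem he
      rw [hi.keys, List.mem_range] at this
      exact this
    have h2 := hi.price_le e he
    have h3 : sz e.2.2 ≤ pH.eval (sz a) + 2 := by
      cases ho : e.2.2 with
      | none => simp
      | some h =>
        have := sz_mem_le (hi.mem e he h ho)
        have := hpH a
        rw [sz_some]
        omega
    rw [sz_prod, sz_prod, sz_nat, sz_nat]
    omega
  have key : ∀ l : List (ℕ × ℕ × Option ℕ), (∀ e ∈ l, e ∈ st) →
      sz l ≤ 1 + l.length * (10 * pN.eval (sz a) + pH.eval (sz a) + 20) := by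
    intro l
    induction l with
    | nil => simp
    | cons e l ih =>
      intro hl
      have h1 := ih fun e he => hl e (by simp [he])
      have h2 := hent e (hl e (by simp))
      rw [sz_cons, List.length_cons, Nat.add_mul]
      omega
  have h1 := key st fun _ h => h
  rw [hi.length] at h1
  have h2 := Nat.mul_le_mul_right (10 * pN.eval (sz a) + pH.eval (sz a) + 20) hNa
  simp only [Polynomial.eval_add, Polynomial.eval_mul, Polynomial.eval_one,
    Polynomial.eval_ofNat]
  omega

@[fun_prop]
theorem ownsKey' {st : α → List (ℕ × ℕ × Option ℕ)} {h : α → ℕ} (hst : PolyTime st)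
    (hh : PolyTime h) : PolyTime (fun a => ownsKey (st a) (h a)) := by
  unfold ownsKey; fun_prop

end PolyTime

/-! ### Lowering the elimination distance by one -/

/-- The lists of length `b` with entries in `X`. -/
def tuples (X : List ℕ) : ℕ → List (List ℕ)
  | 0 => [[]]
  | b + 1 => X.flatMap fun x => (tuples X b).map fun t => x :: t

/-- Whether the neighbours of `Z` in `H` block `H`. -/
def blocksB (F : List ℕ → Option ℕ) (M : ℕ × List Bool) (H Z : List ℕ) : Bool :=
  (F H).elim false fun a =>
    (F (H.filter fun u => !Z.any fun z => adjB M z u)).elim false fun c =>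
      (a + 1).ble ((H.filter fun u => Z.any fun z => adjB M z u).length + c)

/-- The auction that matches components to tuples of modulator vertices blocking them. -/
def levelAuction (O : List Bool → Bool) (M : ℕ × List Bool) (i b : ℕ) (S X : List ℕ) :
    List (ℕ × ℕ × Option ℕ) :=
  auction (tuples X b).length (reps M S) fun h j =>
    blocksB (optNum O M (i + 1)) M (compList M S h) (((tuples X b).drop j).headD [])

/-- The representatives of the components that are kept. -/
def keptReps (O : List Bool → Bool) (M : ℕ × List Bool) (i b : ℕ) (S X : List ℕ) : List ℕ :=
  (reps M S).filter fun h => ownsKey (levelAuction O M i b S X) h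

/-- The representatives of the components that are deleted. -/
def droppedReps (O : List Bool → Bool) (M : ℕ × List Bool) (i b : ℕ) (S X : List ℕ) : List ℕ :=
  (reps M S).filter fun h => !ownsKey (levelAuction O M i b S X) h

/-- A vertex whose deletion lowers the elimination distance, if the base class does not contain the
component. -/
def pivot (O : List Bool → Bool) (M : ℕ × List Bool) (i : ℕ) (H : List ℕ) : List ℕ :=
  cond (baseNum O M H).isSome []
    ((H.filter fun v => (optNum O M i (H.filter fun u => !u.beq v)).isSome).take 1)

/-- The vertices that are added to the modulator. -/
def pivots (O : List Bool → Bool) (M : ℕ × List Bool) (i b : ℕ) (S X : List ℕ) : List ℕ :=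
  (keptReps O M i b S X).flatMap fun h => pivot O M i (compList M S h)

/-- Deletes components and moves vertices of the remaining ones to the modulator. The state consists
of the vertices outside the modulator, the modulator, and the cost of the deleted components. -/
def levelStep (O : List Bool → Bool) (M : ℕ × List Bool) (i b : ℕ)
    (s : List ℕ × List ℕ × ℕ) : List ℕ × List ℕ × ℕ :=
  (((keptReps O M i b s.1 s.2.1).flatMap fun h => compList M s.1 h).filter
      fun v => !memB (pivots O M i b s.1 s.2.1) v,
    s.2.1 ++ pivots O M i b s.1 s.2.1,
    s.2.2 + ((droppedReps O M i b s.1 s.2.1).map fun h =>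
      (optNum O M (i + 1) (compList M s.1 h)).getD 0).sum)

namespace PolyTime

@[fun_prop]
theorem tuples' {X : α → List ℕ} {b : ℕ} (hX : PolyTime X) :
    PolyTime (fun a => tuples (X a) b) := by
  induction b with
  | zero => simp only [tuples]; fun_prop
  | succ b ih =>
    simp only [tuples]
    exact list_flatMap hX (list_map (ih.comp' (f := fun p : α × ℕ => p.1) (by fun_prop))
      (by fun_prop))

theorem levelStep' {O : α → List Bool → Bool} {M : α → ℕ × List Bool} {i b : ℕ}
    {s : α → List ℕ × List ℕ × ℕ} (hO : PolyTime fun p : α × List Bool => O p.1 p.2)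
    (hM : PolyTime M) (hs : PolyTime s) :
    PolyTime (fun a => levelStep (O a) (M a) i b (s a)) := by
  have hO' : ∀ {δ : Type} [Enc δ] {u : δ → α} {y : δ → List Bool}, PolyTime u → PolyTime y →
      PolyTime (fun d => O (u d) (y d)) := fun hu hy => hO.comp' (hu.prodMk hy)
  have hopt : ∀ {δ : Type} [Enc δ] (i : ℕ) {u : δ → α} {S : δ → List ℕ}, PolyTime u → PolyTime S →
      PolyTime (fun d => optNum (O (u d)) (M (u d)) i (S d)) := fun i _ _ hu hS =>
    optNum' (hO' (by fun_prop) (by fun_prop)) (hM.comp' hu) hS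
  have hbl : ∀ {δ : Type} [Enc δ] (i : ℕ) {u : δ → α} {H Z : δ → List ℕ}, PolyTime u →
      PolyTime H → PolyTime Z →
      PolyTime (fun d => blocksB (optNum (O (u d)) (M (u d)) i) (M (u d)) (H d) (Z d)) := by
    intro δ _ i u H Z hu hH hZ
    unfold blocksB
    exact option_elim (hopt i (by fun_prop) (by fun_prop)) (by fun_prop)
      (option_elim (hopt i (by fun_prop) (by fun_prop)) (by fun_prop) (by fun_prop))
  have hau : PolyTime fun a => levelAuction (O a) (M a) i b (s a).1 (s a).2.1 := by
    unfold levelAuction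
    exact auction' (by fun_prop) (by fun_prop) (hbl _ (by fun_prop) (by fun_prop) (by fun_prop))
  have hkept : PolyTime fun a => keptReps (O a) (M a) i b (s a).1 (s a).2.1 := by
    unfold keptReps
    exact list_filter (by fun_prop) (ownsKey' (hau.comp' (f := fun p : α × ℕ => p.1) (by fun_prop))
      (by fun_prop))
  have hdrop : PolyTime fun a => droppedReps (O a) (M a) i b (s a).1 (s a).2.1 := by
    unfold droppedReps
    exact list_filter (by fun_prop) (not' (ownsKey' (hau.comp' (f := fun p : α × ℕ => p.1)
      (by fun_prop)) (by fun_prop)))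
  have hpiv : PolyTime fun a => pivots (O a) (M a) i b (s a).1 (s a).2.1 := by
    unfold pivots pivot
    refine list_flatMap hkept (cond' (option_isSome (baseNum' (hO' (by fun_prop) (by fun_prop))
      (by fun_prop) (by fun_prop))) (by fun_prop) (list_take (by fun_prop) (list_filter
        (by fun_prop) (option_isSome (hopt i (by fun_prop) (by fun_prop))))))
  unfold levelStep
  exact prodMk (list_filter (list_flatMap hkept (by fun_prop)) (not' (memB'
    (hpiv.comp' (f := fun p : α × ℕ => p.1) (by fun_prop)) (by fun_prop))))
    (prodMk (by fun_prop) (nat_add (by fun_prop) (list_sum (list_map hdrop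
    (option_getD (hopt _ (by fun_prop) (by fun_prop)) (by fun_prop))))))

end PolyTime

/-! ### Correctness of a single level -/

/-- The lists of vertices outside and inside a modulator. -/
structure Layout (n : ℕ) (S X : List ℕ) : Prop where
  nodup : S.Nodup
  nodup_mod : X.Nodup
  disjoint : ∀ v ∈ S, v ∉ X
  length_le : S.length ≤ n

theorem length_tuples (X : List ℕ) (b : ℕ) : (tuples X b).length = X.length ^ b := by
  induction b with
  | zero => rfl
  | succ b ih => simp [tuples, List.length_flatMap, ih, pow_succ, mul_comm]

theorem mem_tuples {X t : List ℕ} {b : ℕ} : t ∈ tuples X b ↔ t.length = b ∧ ∀ x ∈ t, x ∈ X := by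
  induction b generalizing t with
  | zero => simp [tuples]; rintro rfl; simp
  | succ b ih =>
    simp only [tuples, List.mem_flatMap, List.mem_map, ih]
    constructor
    · rintro ⟨x, hx, t, ⟨hl, ht⟩, rfl⟩
      simp [hl, hx]; exact ht
    · rintro ⟨hl, ht⟩
      cases t with
      | nil => simp at hl
      | cons x t => exact ⟨x, ht x (by simp), t, ⟨by simpa using hl,
          fun y hy => ht y (by simp [hy])⟩, rfl⟩

/-- Small sets are padded by repeating an element, for which the set has to be nonempty. -/
theorem exists_tuple {X : List ℕ} {Z : Finset ℕ} {b : ℕ} (hZ : Z.Nonempty) (hb : Z.card ≤ b)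
    (hZX : ∀ z ∈ Z, z ∈ X) : ∃ t ∈ tuples X b, t.toFinset = Z := by
  obtain ⟨z, hz⟩ := hZ
  refine ⟨Z.toList ++ List.replicate (b - Z.card) z, mem_tuples.2 ⟨?_, ?_⟩, ?_⟩
  · simp; omega
  · intro x hx
    rcases List.mem_append.1 hx with h | h
    · exact hZX x (Finset.mem_toList.1 h)
    · rw [List.eq_of_mem_replicate h]; exact hZX z hz
  · ext x
    simp only [List.mem_toFinset, List.mem_append, Finset.mem_toList, List.mem_replicate]
    constructor
    · rintro (h | ⟨_, rfl⟩)
      · exact h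
      · exact hz
    · exact Or.inl

section

variable {C : GraphClass} {O : List Bool → Bool} {M : ℕ × List Bool} {n i b : ℕ} {S X : List ℕ}

theorem toFinset_filter_nbrs (H Z : List ℕ) :
    (H.filter fun u => Z.any fun z => adjB M z u).toFinset =
      nbrsIn (matrixGraph M) H.toFinset Z.toFinset := by
  ext u
  simp only [List.mem_toFinset, List.mem_filter, nbrsIn, Finset.mem_filter, List.any_eq_true]
  rfl

/-- `blocksOn_iff` turns blocking into a comparison of the cover numbers of H and of H without the
neighbours. By heredity both graphs are in the class, so `optNum` is defined on them. -/
theorem blocksB_iff (hiso : C.IsoInvariant) (hher : C.Hereditary) (hrob : C.Robust)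
    (hO : DecidesVC C O M n) {H Z : List ℕ} (hH : H.Nodup) (hn : H.length ≤ n)
    (hC : InClass (C.elim i) (matrixGraph M) H.toFinset) :
    blocksB (optNum O M i) M H Z = true ↔
      BlocksOn (matrixGraph M) H.toFinset (nbrsIn (matrixGraph M) H.toFinset Z.toFinset) := by
  have hsub : nbrsIn (matrixGraph M) H.toFinset Z.toFinset ⊆ H.toFinset := by
    intro u hu; simp only [nbrsIn, Finset.mem_filter] at hu; exact hu.1
  have hrest : (H.filter fun u => !Z.any fun z => adjB M z u).toFinset =
      H.toFinset \ nbrsIn (matrixGraph M) H.toFinset Z.toFinset := by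
    rw [← toFinset_filter_nbrs]
    ext u
    simp only [List.mem_toFinset, List.mem_filter, Finset.mem_sdiff, Bool.not_eq_true',
      ← Bool.not_eq_true]
    tauto
  rw [blocksOn_iff hsub, blocksB, optNum_eq hiso hher hrob hO i hH hn, if_pos hC,
    optNum_eq hiso hher hrob hO i (hH.filter _) ((List.length_filter_le _ _).trans hn), hrest,
    if_pos (hC.elim_mono hiso hher hrob Finset.sdiff_subset), ← toFinset_filter_nbrs,
    List.toFinset_card_of_nodup (hH.filter _)]
  simp only [Option.elim_some, Nat.ble_eq]
  omega

theorem keptReps_sublist : (keptReps O M i b S X).Sublist (reps M S) := List.filter_sublist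

theorem pivot_sublist (H : List ℕ) : (pivot O M i H).Sublist H := by
  unfold pivot
  cases (baseNum O M H).isSome
  · exact (List.take_sublist _ _).trans List.filter_sublist
  · exact List.nil_sublist _

theorem length_pivot_le (H : List ℕ) : (pivot O M i H).length ≤ 1 := by
  unfold pivot
  cases (baseNum O M H).isSome
  · simp
  · simp

theorem mem_kept_subset {h v : ℕ} (hh : h ∈ keptReps O M i b S X) (hv : v ∈ compList M S h) :
    v ∈ S :=
  (compList_sublist (reps_sublist.subset (keptReps_sublist.subset hh))).subset hv

theorem pivots_subset {v : ℕ} (hv : v ∈ pivots O M i b S X) : v ∈ S := by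
  obtain ⟨h, hh, hv⟩ := List.mem_flatMap.1 hv
  exact mem_kept_subset hh ((pivot_sublist _).subset hv)

theorem pairwise_disjoint_kept (hS : S.Nodup) :
    (keptReps O M i b S X).Pairwise (fun u v => (compList M S u).Disjoint (compList M S v)) := by
  have hnd : (keptReps O M i b S X).Nodup := (keptReps_sublist.trans reps_sublist).nodup hS
  refine List.Pairwise.imp_of_mem (fun {u v} hu hv huv => ?_) hnd
  have hu := keptReps_sublist.subset hu
  have hv := keptReps_sublist.subset hv
  have := compOn_disjoint (reps_pairwise hu hv huv)
  intro w hwu hwv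
  rw [mem_compList (reps_sublist.subset hu)] at hwu
  rw [mem_compList (reps_sublist.subset hv)] at hwv
  exact Finset.disjoint_left.1 this hwu hwv

theorem Layout.levelStep (h : Layout n S X) (c : ℕ) :
    Layout n (levelStep O M i b (S, X, c)).1 (levelStep O M i b (S, X, c)).2.1 := by
  have hcomp : ∀ r ∈ keptReps O M i b S X, (compList M S r).Sublist S := fun r hr =>
    compList_sublist (reps_sublist.subset (keptReps_sublist.subset hr))
  have hnd : ((keptReps O M i b S X).flatMap fun h => compList M S h).Nodup :=
    List.nodup_flatMap.2 ⟨fun r hr => (hcomp r hr).nodup h.nodup, pairwise_disjoint_kept h.nodup⟩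
  have hsub : ∀ v ∈ (keptReps O M i b S X).flatMap fun h => compList M S h, v ∈ S := by
    intro v hv
    obtain ⟨r, hr, hv⟩ := List.mem_flatMap.1 hv
    exact mem_kept_subset hr hv
  refine ⟨hnd.filter _, ?_, ?_, ?_⟩
  · refine List.nodup_append.2 ⟨h.nodup_mod, List.nodup_flatMap.2 ⟨fun r hr => ?_, ?_⟩, ?_⟩
    · exact ((pivot_sublist _).trans (hcomp r hr)).nodup h.nodup
    · refine (pairwise_disjoint_kept h.nodup).imp fun {u v} huv => ?_
      exact List.disjoint_of_subset_left (pivot_sublist _).subset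
        (List.disjoint_of_subset_right (pivot_sublist _).subset huv)
    · rintro x hx y hy rfl
      exact h.disjoint x (pivots_subset hy) hx
  · intro v hv hv'
    simp only [_root_.levelStep, List.mem_filter, Bool.not_eq_true', ← Bool.not_eq_true,
      memB_iff] at hv
    rcases List.mem_append.1 hv' with h' | h'
    · exact h.disjoint v (hsub v hv.1) h'
    · exact hv.2 h'
  · refine ((List.length_filter_le _ _).trans (hnd.subperm hsub).length_le).trans h.length_le

/-- Every kept component owns a tuple of its own and contributes at most one pivot, and there are
|X|^b tuples. -/
theorem length_levelStep_modulator_le (hS : S.Nodup) (c : ℕ) :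
    (levelStep O M i b (S, X, c)).2.1.length ≤ X.length + X.length ^ b := by
  simp only [levelStep, List.length_append, Nat.add_le_add_iff_left]
  have h1 : (pivots O M i b S X).length ≤ (keptReps O M i b S X).length := by
    rw [pivots, List.length_flatMap]
    have := List.sum_le_card_nsmul ((keptReps O M i b S X).map
      fun h => (pivot O M i (compList M S h)).length) 1 (by
        simp only [List.forall_mem_map]
        exact fun r _ => length_pivot_le _)
    simpa using this
  rw [← length_tuples]
  exact h1.trans (length_owners_le (reps_sublist.nodup hS))

/-- The closed set of tuples from the auction meets the conditions of `coverNum_delete_pieces`, so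
deletion changes the cover number by the recorded cost. Moving pivots keeps the vertex set and
brings every remaining component to distance i. -/
theorem levelStep_spec (hiso : C.IsoInvariant) (hher : C.Hereditary) (hrob : C.Robust)
    (hO : DecidesVC C O M n) (hb : BlockBound (C.elim (i + 1)) b) (h : Layout n S X)
    (hC : InClass (C.elim (i + 1)) (matrixGraph M) S.toFinset) (c : ℕ)
    (s' : List ℕ × List ℕ × ℕ) (hs' : s' = levelStep O M i b (S, X, c)) :
    InClass (C.elim i) (matrixGraph M) s'.1.toFinset ∧
    (∀ v, v ∈ s'.1 ∨ v ∈ s'.2.1 → v ∈ S ∨ v ∈ X) ∧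
    coverNum (matrixGraph M) (s'.2.1.toFinset ∪ s'.1.toFinset) + s'.2.2 =
      coverNum (matrixGraph M) (X.toFinset ∪ S.toFinset) + c := by
  set G := matrixGraph M with hG
  set P : ℕ → Finset ℕ := compOn G S.toFinset with hP
  set rel : ℕ → ℕ → Bool := fun h j =>
    blocksB (optNum O M (i + 1)) M (compList M S h) (((tuples X b).drop j).headD []) with hrel
  set J := (reps M S).toFinset with hJ
  set U := (droppedReps O M i b S X).toFinset with hU
  have hlist : ∀ r ∈ reps M S, (compList M S r).toFinset = P r := fun r hr =>
    toFinset_compList (reps_sublist.subset hr)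
  have hnodup : ∀ r ∈ reps M S, (compList M S r).Nodup := fun r hr =>
    (compList_sublist (reps_sublist.subset hr)).nodup h.nodup
  have hlen : ∀ r ∈ reps M S, (compList M S r).length ≤ n := fun r hr =>
    (compList_sublist (reps_sublist.subset hr)).length_le.trans h.length_le
  have hPC : ∀ r, InClass (C.elim (i + 1)) G (P r) := fun r =>
    hC.elim_mono hiso hher hrob compOn_subset
  have hrel_iff : ∀ r ∈ reps M S, ∀ j, rel r j = true ↔
      BlocksOn G (P r) (nbrsIn G (P r) (((tuples X b).drop j).headD []).toFinset) := by
    intro r hr j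
    rw [← hlist r hr]
    exact blocksB_iff hiso hher hrob hO (hnodup r hr) (hlen r hr) (by rw [hlist r hr]; exact hPC r)
  have hkept : J \ U = (keptReps O M i b S X).toFinset := by
    ext r
    simp only [hJ, hU, Finset.mem_sdiff, List.mem_toFinset, droppedReps, keptReps, List.mem_filter,
      Bool.not_eq_true', ← Bool.not_eq_true]
    tauto
  have hdis : ∀ i ∈ J, ∀ j ∈ J, i ≠ j → Disjoint (P i) (P j) := fun u hu v hv huv =>
    compOn_disjoint (reps_pairwise (List.mem_toFinset.1 hu) (List.mem_toFinset.1 hv) huv)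
  have hnoe : ∀ i ∈ J, ∀ j ∈ J, i ≠ j → NoEdges G (P i) (P j) := fun u hu v hv huv =>
    noEdges_compOn_compOn (reps_pairwise (List.mem_toFinset.1 hu) (List.mem_toFinset.1 hv) huv)
  have hUJ : U ⊆ J := by
    intro r hr
    rw [hU, List.mem_toFinset] at hr
    exact List.mem_toFinset.2 (List.mem_filter.1 hr).1
  have htuple : ∀ j < (tuples X b).length, ((tuples X b).drop j).headD [] ∈ tuples X b := by
    intro j hj
    have : ((tuples X b).drop j).headD [] = (tuples X b)[j] := by
      simp [List.head?_drop, hj]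
    rw [this]; exact List.getElem_mem hj
  obtain ⟨R, own, hinj, hR, hclosed⟩ := exists_closed_keys (N := (tuples X b).length)
    (H := reps M S) (rel := rel)
  have hdel := coverNum_delete_pieces (G := G) (X := X.toFinset) (J := J) (U := U) (P := P) (R := R)
    (Z := fun j => (((tuples X b).drop j).headD []).toFinset) (owner := own) hdis hnoe
    (fun r _ => by
      rw [Finset.disjoint_left]
      intro v hv hv'
      exact h.disjoint v (List.mem_toFinset.1 (compOn_subset hv')) (List.mem_toFinset.1 hv))
    hUJ hinj
    (fun j hj => by
      obtain ⟨_, h1, _, h2⟩ := hR j hj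
      rw [hkept, List.mem_toFinset]
      exact List.mem_filter.2 ⟨h1, h2⟩)
    (fun j hj v hv => by
      rw [List.mem_toFinset] at hv ⊢
      exact (mem_tuples.1 (htuple j (hR j hj).1)).2 v hv)
    (fun j hj => (hrel_iff _ (hR j hj).2.1 j).1 (hR j hj).2.2.1)
    (fun r hr Y hYX hY => by
      have hrJ : r ∈ reps M S := by
        rcases hr with hr | hr
        · exact List.mem_toFinset.1 (hUJ hr)
        · obtain ⟨j, hj, rfl⟩ := Finset.mem_image.1 hr
          exact (hR j hj).2.1
      have hr' : ownsKey (auction (tuples X b).length (reps M S) rel) r = false ∨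
          r ∈ R.image own := by
        refine hr.imp_left fun hr => ?_
        have := (List.mem_filter.1 (List.mem_toFinset.1 hr)).2
        rw [Bool.not_eq_true'] at this
        exact this
      -- At most b vertices of Y suffice to block: the blocking set is shrunk to size b, and each of
      -- its vertices is assigned a neighbour in Y. These neighbours form a tuple.
      obtain ⟨Y', hY', hB, hcard⟩ := hb ℕ G (P r) (nbrsIn G (P r) Y) (fun u hu => by
        simp only [nbrsIn, Finset.mem_filter] at hu; exact hu.1) (hPC r) hY
      have hz : ∀ y ∈ Y', ∃ z ∈ Y, G.Adj z y := fun y hy => by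
        have := hY' hy
        simp only [nbrsIn, Finset.mem_filter] at this
        exact this.2
      choose! z hzY hzy using hz
      have hne : Y'.Nonempty := by
        rw [Finset.nonempty_iff_ne_empty]
        rintro rfl
        exact not_blocksOn_empty hB
      obtain ⟨t, ht, htZ⟩ := exists_tuple (X := X) (hne.image z)
        (Finset.card_image_le.trans hcard) (fun x hx => by
          obtain ⟨y, hy, rfl⟩ := Finset.mem_image.1 hx
          exact List.mem_toFinset.1 (hYX (hzY y hy)))
      obtain ⟨j, hj, hjt⟩ := List.mem_iff_getElem.1 ht
      have hjt' : ((tuples X b).drop j).headD [] = t := by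
        rw [← hjt]; simp [List.head?_drop, hj]
      refine ⟨j, hclosed r hrJ hr' j hj ((hrel_iff r hrJ j).2 ?_), ?_⟩
      · rw [hjt', htZ]
        refine hB.mono fun y hy => ?_
        have := hY' hy
        simp only [nbrsIn, Finset.mem_filter] at this ⊢
        exact ⟨this.1, z y, Finset.mem_image_of_mem z hy, hzy y hy⟩
      · rw [hjt', htZ]
        intro x hx
        obtain ⟨y, hy, rfl⟩ := Finset.mem_image.1 hx
        exact hzY y hy)
  have hJS : J.biUnion P = S.toFinset := biUnion_reps
  rw [hJS] at hdel
  subst hs'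
  set piv := pivots O M i b S X with hpiv
  have hS' : (levelStep O M i b (S, X, c)).1.toFinset =
      (J \ U).biUnion fun r => P r \ piv.toFinset := by
    rw [hkept]
    ext v
    simp only [levelStep, List.mem_toFinset, List.mem_filter, List.mem_flatMap, Finset.mem_biUnion,
      Bool.not_eq_true', ← Bool.not_eq_true, memB_iff, Finset.mem_sdiff]
    constructor
    · rintro ⟨⟨r, hr, hv⟩, hv'⟩
      refine ⟨r, hr, ?_, hv'⟩
      rw [← hlist r (keptReps_sublist.subset hr)]
      exact List.mem_toFinset.2 hv
    · rintro ⟨r, hr, hv, hv'⟩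
      rw [← hlist r (keptReps_sublist.subset hr)] at hv
      exact ⟨⟨r, hr, List.mem_toFinset.1 hv⟩, hv'⟩
  have hpivP : ∀ v ∈ piv, v ∈ (J \ U).biUnion P := by
    intro v hv
    obtain ⟨r, hr, hv⟩ := List.mem_flatMap.1 hv
    refine Finset.mem_biUnion.2 ⟨r, hkept ▸ List.mem_toFinset.2 hr, ?_⟩
    rw [← hlist r (keptReps_sublist.subset hr)]
    exact List.mem_toFinset.2 ((pivot_sublist _).subset hv)
  -- Pivots only change sides, so the vertex set loses nothing but the deleted components.
  have hunion : (levelStep O M i b (S, X, c)).2.1.toFinset ∪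
      (levelStep O M i b (S, X, c)).1.toFinset = X.toFinset ∪ (J \ U).biUnion P := by
    rw [hS']
    ext v
    simp only [levelStep, ← hpiv, List.toFinset_append, Finset.mem_union, List.mem_toFinset,
      Finset.mem_biUnion, Finset.mem_sdiff (s := P _)]
    constructor
    · rintro ((hv | hv) | ⟨r, hr, hv, _⟩)
      · exact Or.inl hv
      · exact Or.inr (Finset.mem_biUnion.1 (hpivP v hv))
      · exact Or.inr ⟨r, hr, hv⟩
    · rintro (hv | ⟨r, hr, hv⟩)
      · exact Or.inl (Or.inl hv)
      · by_cases hv' : v ∈ piv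
        · exact Or.inl (Or.inr hv')
        · exact Or.inr ⟨r, hr, hv, hv'⟩
  refine ⟨?_, ?_, ?_⟩
  · rw [hS']
    refine inClass_biUnion hiso hher hrob (fun u hu v hv huv a ha b hb => ?_) fun r hr => ?_
    · exact hnoe u (Finset.mem_sdiff.1 hu).1 v (Finset.mem_sdiff.1 hv).1 huv a
        (Finset.mem_sdiff.1 ha).1 b (Finset.mem_sdiff.1 hb).1
    · rw [hkept, List.mem_toFinset] at hr
      have hr' := keptReps_sublist.subset hr
      have hconn : (G.induce (P r : Set ℕ)).Connected :=
        connected_compOn (List.mem_toFinset.2 (reps_sublist.subset hr'))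
      -- Components in C need no pivot; any other one has a vertex leading to distance i, and
      -- `pivot` finds such a vertex.
      by_cases h0 : InClass C G (P r)
      · exact h0.elim.elim_mono hiso hher hrob Finset.sdiff_subset
      · obtain ⟨v, hv, hvC⟩ := ((inClass_elim_succ_iff hiso hconn).1 (hPC r)).resolve_left h0
        have hbase : baseNum O M (compList M S r) = none := by
          rw [baseNum_eq hO (hnodup r hr') (hlen r hr'), hlist r hr', if_neg h0]
        have hopt : ∀ w, (optNum O M i ((compList M S r).filter fun u => !u.beq w)).isSome = true ↔
            InClass (C.elim i) G ((P r).erase w) := by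
          intro w
          rw [optNum_eq hiso hher hrob hO i ((hnodup r hr').filter _)
            ((List.length_filter_le _ _).trans (hlen r hr')), List.toFinset_filter_ne, hlist r hr']
          split_ifs with hw
          · simpa using hw
          · simpa using hw
        have hpr : pivot O M i (compList M S r) = ((compList M S r).filter fun v =>
            (optNum O M i ((compList M S r).filter fun u => !u.beq v)).isSome).take 1 := by
          rw [pivot, hbase]; rfl
        have hvl : v ∈ (compList M S r).filter fun v =>
            (optNum O M i ((compList M S r).filter fun u => !u.beq v)).isSome := by
          rw [List.mem_filter, hopt]
          rw [← hlist r hr', List.mem_toFinset] at hv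
          exact ⟨hv, hvC⟩
        obtain ⟨w, l, hwl⟩ : ∃ w l, ((compList M S r).filter fun v =>
            (optNum O M i ((compList M S r).filter fun u => !u.beq v)).isSome) = w :: l := by
          cases hcase : ((compList M S r).filter fun v =>
            (optNum O M i ((compList M S r).filter fun u => !u.beq v)).isSome) with
          | nil => rw [hcase] at hvl; simp at hvl
          | cons w l => exact ⟨w, l, rfl⟩
        have hw : InClass (C.elim i) G ((P r).erase w) := by
          have : w ∈ (compList M S r).filter fun v =>
              (optNum O M i ((compList M S r).filter fun u => !u.beq v)).isSome := by
            rw [hwl]; simp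
          exact (hopt w).1 (List.mem_filter.1 this).2
        have hwp : w ∈ piv := by
          refine List.mem_flatMap.2 ⟨r, hr, ?_⟩
          rw [hpr, hwl]; simp
        refine hw.elim_mono hiso hher hrob fun u hu => ?_
        rw [Finset.mem_sdiff, List.mem_toFinset] at hu
        exact Finset.mem_erase.2 ⟨fun heq => hu.2 (heq ▸ hwp), hu.1⟩
  · intro v hv
    have h1 : v ∈ X.toFinset ∪ (J \ U).biUnion P := by
      rw [← hunion, Finset.mem_union, List.mem_toFinset, List.mem_toFinset]
      exact hv.symm
    rw [Finset.mem_union, List.mem_toFinset] at h1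
    refine h1.symm.imp_left fun h1 => ?_
    obtain ⟨r, _, hv⟩ := Finset.mem_biUnion.1 h1
    exact List.mem_toFinset.1 (compOn_subset hv)
  · rw [hunion, hdel]
    have : (levelStep O M i b (S, X, c)).2.2 = c + ∑ r ∈ U, coverNum G (P r) := by
      simp only [levelStep, Nat.add_left_cancel_iff]
      have hnd : (droppedReps O M i b S X).Nodup :=
        (List.filter_sublist.trans reps_sublist).nodup h.nodup
      rw [hU, List.sum_toFinset _ hnd]
      congr 1
      refine List.map_congr_left fun r hr => ?_
      have hr' : r ∈ reps M S := (List.mem_filter.1 hr).1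
      rw [optNum_eq hiso hher hrob hO _ (hnodup r hr') (hlen r hr'), hlist r hr', if_pos (hPC r)]
      rfl
    rw [this]; omega

end

/-! ### The reduction between the modulators -/

/-- Lowers the elimination distance to `0`. -/
def reduceLevels (O : List Bool → Bool) (M : ℕ × List Bool) (b : ℕ → ℕ) :
    ℕ → List ℕ × List ℕ × ℕ → List ℕ × List ℕ × ℕ
  | 0, s => s
  | i + 1, s => reduceLevels O M b i (levelStep O M i (b (i + 1)) s)

/-- The vertices outside the modulator of the instance encoded by a string. -/
def outsideOf (x : List Bool) : List ℕ :=
  (List.range (parse x).1.1).filter fun v => !memB (parse x).2.1 v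

/-- The state reached from an encoded instance. -/
def reducedState (O : List Bool → Bool) (b : ℕ → ℕ) (d : ℕ) (x : List Bool) :
    List ℕ × List ℕ × ℕ :=
  reduceLevels O (parse x).1 b d (outsideOf x, (parse x).2.1, 0)

/-- Reduces an instance with a modulator to elimination distance `d` to one with a modulator to the
base class, and fails on instances that are recognized as negative. -/
def reduction (O : List Bool → Bool) (b : ℕ → ℕ) (d : ℕ) (y : List Bool × ℕ) :
    Option (List Bool × ℕ) :=
  cond ((eqBits (encodeSub (parse y.1).1 (List.range (parse y.1).1.1) (parse y.1).2.1
        (parse y.1).2.2) y.1 && (parse y.1).2.1.length.beq y.2) &&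
      ((optNum O (parse y.1).1 d (outsideOf y.1)).isSome &&
        (reducedState O b d y.1).2.2.ble (parse y.1).2.2))
    (some (encodeSub (parse y.1).1 ((reducedState O b d y.1).2.1 ++ (reducedState O b d y.1).1)
      (reducedState O b d y.1).2.1 ((parse y.1).2.2 - (reducedState O b d y.1).2.2),
      (reducedState O b d y.1).2.1.length)) none

/-- Replaces an instance whose modulator is not one to the base class. -/
def postCheck (O : List Bool → Bool) (y : List Bool × ℕ) : List Bool × ℕ :=
  cond (O (encodeSub (parse y.1).1 (outsideOf y.1) [] (parse y.1).1.1)) y ([], 0)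

/-- The composition of the reduction, a kernel `A`, and the final check. -/
def assemble (O : List Bool → Bool) (A : List Bool × ℕ → List Bool × ℕ) (b : ℕ → ℕ) (d : ℕ)
    (y : List Bool × ℕ) : List Bool × ℕ :=
  (reduction O b d y).elim ([], 0) fun z => postCheck O (A z)

namespace PolyTime

theorem reduceLevels' {O : α → List Bool → Bool} {M : α → ℕ × List Bool} {b : ℕ → ℕ} {i : ℕ}
    {s : α → List ℕ × List ℕ × ℕ} (hO : PolyTime fun p : α × List Bool => O p.1 p.2)
    (hM : PolyTime M) (hs : PolyTime s) :
    PolyTime (fun a => reduceLevels (O a) (M a) b i (s a)) := by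
  induction i generalizing s with
  | zero => exact hs
  | succ i ih => exact ih (levelStep' hO hM hs)

@[fun_prop]
theorem outsideOf' {x : α → List Bool} (hx : PolyTime x) : PolyTime (fun a => outsideOf (x a)) := by
  unfold outsideOf; fun_prop

theorem reduction' {O : α → List Bool → Bool} {b : ℕ → ℕ} {d : ℕ} {y : α → List Bool × ℕ}
    (hO : PolyTime fun p : α × List Bool => O p.1 p.2) (hy : PolyTime y) :
    PolyTime (fun a => reduction (O a) b d (y a)) := by
  have hst : PolyTime fun a => reducedState (O a) b d (y a).1 := by
    unfold reducedState
    exact reduceLevels' hO (by fun_prop) (by fun_prop)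
  have hopt : PolyTime fun a => optNum (O a) (parse (y a).1).1 d (outsideOf (y a).1) :=
    optNum' hO (by fun_prop) (by fun_prop)
  unfold reduction
  exact cond' (and' (by fun_prop) (and' (option_isSome hopt) (by fun_prop))) (by fun_prop)
    (by fun_prop)

theorem postCheck' {O : α → List Bool → Bool} {y : α → List Bool × ℕ}
    (hO : PolyTime fun p : α × List Bool => O p.1 p.2) (hy : PolyTime y) :
    PolyTime (fun a => postCheck (O a) (y a)) := by
  unfold postCheck
  exact cond' (hO.comp' (f := fun a => (a, encodeSub (parse (y a).1).1 (outsideOf (y a).1) []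
    (parse (y a).1).1.1)) (by fun_prop)) hy (by fun_prop)

theorem assemble' {O : α → List Bool → Bool} {A : α → List Bool × ℕ → List Bool × ℕ}
    {b : ℕ → ℕ} {d : ℕ} {y : α → List Bool × ℕ}
    (hO : PolyTime fun p : α × List Bool => O p.1 p.2)
    (hA : PolyTime fun p : α × (List Bool × ℕ) => A p.1 p.2) (hy : PolyTime y) :
    PolyTime (fun a => assemble (O a) (A a) b d (y a)) := by
  unfold assemble
  exact option_elim (reduction' hO hy) (by fun_prop) (postCheck'
    (hO.comp' (f := fun p : (α × (List Bool × ℕ)) × List Bool => (p.1.1, p.2)) (by fun_prop)) hA)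

end PolyTime

/-! ### Correctness of the reduction and of the final check -/

theorem nil_not_mem_vertexCoverByModulator (D : GraphClass) (l : ℕ) :
    ([], l) ∉ vertexCoverByModulator D := by
  rintro ⟨I, hI, -⟩
  have := congrArg List.length hI
  simp [VCInstance.encode] at this

theorem outputBound_nil (f g : ℕ) : OutputBound f g ([], 0) := by
  refine ⟨Nat.zero_le _, Nat.zero_le _, fun I hI => ?_⟩
  have := congrArg List.length hI
  simp [VCInstance.encode] at this

theorem OutputBound.mono {f g f' g' : ℕ} {y : List Bool × ℕ} (h : OutputBound f g y) (hf : f ≤ f')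
    (hg : g ≤ g') : OutputBound f' g' y :=
  ⟨h.1.trans hf, h.2.1.trans hf, fun I hI => (h.2.2 I hI).trans hg⟩

theorem parse_size_le (x : List Bool) : (parse x).1.1 ≤ x.length := splitTrue_fst_le x

theorem length_encodeSub (M : ℕ × List Bool) (S X : List ℕ) (k : ℕ) :
    (encodeSub M S X k).length = S.length + k + 2 + S.length + S.length * S.length := by
  simp [encodeSub, List.length_flatMap]; ring

section

variable {C : GraphClass} {O : List Bool → Bool} {M : ℕ × List Bool} {n i d : ℕ} {S X : List ℕ}
  {b : ℕ → ℕ} {x : List Bool} {l : ℕ}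

/-- A decision procedure for instances without modulator decides membership in the class. -/
theorem decidesVC_of_forall (hiso : C.IsoInvariant) {m : ℕ}
    (hO : ∀ y : List Bool, y.length ≤ m → (O y = true ↔ (y, 0) ∈ vertexCoverByModulator C))
    (hm : n * n + 3 * n + 2 ≤ m) : DecidesVC C O M n := by
  intro S hS hn k hk
  rw [hO, encodeSub_mem_iff hiso hS]
  · simp [memB]
  -- The length is |S| + k + 2 + |S| + |S|², with |S| and k at most n.
  · rw [length_encodeSub]
    have := Nat.mul_le_mul hn hn
    omega

theorem reduceLevels_layout (h : Layout n S X) (c : ℕ) :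
    Layout n (reduceLevels O M b i (S, X, c)).1 (reduceLevels O M b i (S, X, c)).2.1 := by
  induction i generalizing S X c with
  | zero => exact h
  | succ i ih => exact ih (h.levelStep c) _

theorem reduceLevels_spec (hiso : C.IsoInvariant) (hher : C.Hereditary) (hrob : C.Robust)
    (hO : DecidesVC C O M n) (hb : ∀ j ∈ Finset.Icc 1 i, BlockBound (C.elim j) (b j))
    (h : Layout n S X) (hC : InClass (C.elim i) (matrixGraph M) S.toFinset) (c : ℕ)
    (s : List ℕ × List ℕ × ℕ) (hs : s = reduceLevels O M b i (S, X, c)) :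
    InClass C (matrixGraph M) s.1.toFinset ∧
    coverNum (matrixGraph M) (s.2.1.toFinset ∪ s.1.toFinset) + s.2.2 =
      coverNum (matrixGraph M) (X.toFinset ∪ S.toFinset) + c := by
  induction i generalizing S X c with
  | zero =>
    subst hs
    exact ⟨(inClass_elim_zero_iff hrob).1 hC, rfl⟩
  | succ i ih =>
    obtain ⟨h1, -, h3⟩ := levelStep_spec hiso hher hrob hO (hb (i + 1) (by simp)) h hC c _ rfl
    have h4 := ih (fun j hj => hb j (by simp at hj ⊢; omega)) (h.levelStep c) h1 _ hs
    exact ⟨h4.1, h4.2.trans h3⟩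

/-- The growth of the modulator. -/
theorem exists_length_reduceLevels_le (b : ℕ → ℕ) (hb : ∀ j ∈ Finset.Icc 1 d, 1 ≤ b j) :
    ∃ K : ℕ, ∀ (O : List Bool → Bool) (M : ℕ × List Bool) (n : ℕ) (S X : List ℕ) (c : ℕ),
      Layout n S X → (reduceLevels O M b d (S, X, c)).2.1.length ≤
        K * X.length ^ (∏ j ∈ Finset.Icc 1 d, b j) := by
  induction d with
  | zero => exact ⟨1, fun O M n S X c _ => by simp [reduceLevels]⟩
  | succ d ih =>
    obtain ⟨K, hK⟩ := ih fun j hj => hb j (by simp at hj ⊢; omega)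
    refine ⟨K * 2 ^ (∏ j ∈ Finset.Icc 1 d, b j), fun O M n S X c h => ?_⟩
    have h1 := hK O M n _ _ (levelStep O M d (b (d + 1)) (S, X, c)).2.2
      (h.levelStep (O := O) (M := M) (i := d) (b := b (d + 1)) c)
    refine h1.trans ?_
    have h2 := length_levelStep_modulator_le (O := O) (M := M) (i := d) (b := b (d + 1)) (X := X)
      h.nodup c
    -- Since b (d + 1) ≥ 1, the new modulator has at most 2 · |X|^b(d + 1) vertices; the power of 2
    -- goes into the constant.
    have h3 : X.length ≤ X.length ^ b (d + 1) :=
      Nat.le_self_pow (Nat.one_le_iff_ne_zero.1 (hb (d + 1) (by simp))) _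
    rw [Finset.prod_Icc_succ_top (by omega), mul_assoc, mul_comm (∏ j ∈ Finset.Icc 1 d, b j),
      pow_mul, ← mul_pow]
    gcongr
    omega

theorem outsideOf_layout (x : List Bool) :
    Layout (parse x).1.1 (outsideOf x) (parse x).2.1 := by
  refine ⟨List.nodup_range.filter _, parse_modulator_nodup x, fun v hv => ?_, ?_⟩
  · simp only [outsideOf, List.mem_filter, Bool.not_eq_true', ← Bool.not_eq_true, memB_iff] at hv
    exact hv.2
  · exact (List.length_filter_le _ _).trans (by simp)

theorem toFinset_outsideOf (x : List Bool) : (outsideOf x).toFinset =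
    (List.range (parse x).1.1).toFinset \ (parse x).2.1.toFinset := by
  ext v
  simp only [outsideOf, List.mem_toFinset, List.mem_filter, Finset.mem_sdiff, Bool.not_eq_true',
    ← Bool.not_eq_true, memB_iff]

theorem filter_memB_parse (x : List Bool) :
    ((List.range (parse x).1.1).filter (memB (parse x).2.1)) = (parse x).2.1 := by
  have h : ∃ p : ℕ → Bool, (parse x).2.1 = (List.range (parse x).1.1).filter p := ⟨_, rfl⟩
  obtain ⟨p, hp⟩ := h
  conv_rhs => rw [hp]
  refine List.filter_congr fun v hv => ?_
  rw [Bool.eq_iff_iff, memB_iff, hp, List.mem_filter]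
  simp [hv]

/-- Membership of a valid string in the problem. -/
theorem mem_iff_of_valid {D : GraphClass} (hD : D.IsoInvariant)
    (hx : encodeSub (parse x).1 (List.range (parse x).1.1) (parse x).2.1 (parse x).2.2 = x) :
    (x, l) ∈ vertexCoverByModulator D ↔ (parse x).2.1.length = l ∧
      InClass D (matrixGraph (parse x).1) (outsideOf x).toFinset ∧
      coverNum (matrixGraph (parse x).1) (List.range (parse x).1.1).toFinset ≤ (parse x).2.2 := by
  conv_lhs => rw [← hx]
  rw [encodeSub_mem_iff hD List.nodup_range, filter_memB_parse, ← toFinset_outsideOf]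

theorem valid_of_mem {D : GraphClass} (h : (x, l) ∈ vertexCoverByModulator D) :
    encodeSub (parse x).1 (List.range (parse x).1.1) (parse x).2.1 (parse x).2.2 = x := by
  obtain ⟨I, rfl, -⟩ := h
  exact encodeSub_parse_encode I

/-- Comparing the input with the re-encoded parse rejects strings that encode nothing, the length
test fixes the parameter, and `optNum` verifies the modulator. On the other inputs the cover number
drops exactly by the recorded cost, by `reduceLevels_spec`. -/
theorem reduction_spec (hiso : C.IsoInvariant) (hher : C.Hereditary) (hrob : C.Robust)
    (hO : DecidesVC C O (parse x).1 (parse x).1.1)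
    (hb : ∀ j ∈ Finset.Icc 1 d, BlockBound (C.elim j) (b j)) :
    (x, l) ∈ vertexCoverByModulator (C.elim d) ↔
      ∃ y, reduction O b d (x, l) = some y ∧ y ∈ vertexCoverByModulator C := by
  by_cases hx : encodeSub (parse x).1 (List.range (parse x).1.1) (parse x).2.1 (parse x).2.2 = x
  swap
  · have h1 : reduction O b d (x, l) = none := by
      rw [reduction]
      have : eqBits (encodeSub (parse x).1 (List.range (parse x).1.1) (parse x).2.1
          (parse x).2.2) x = false := by
        rw [← Bool.not_eq_true, eqBits_iff]; exact hx
      simp only [this, Bool.false_and, cond_false]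
    rw [h1]
    constructor
    · exact fun h => absurd (valid_of_mem h) hx
    · rintro ⟨y, hy, -⟩; cases hy
  have hL := outsideOf_layout x
  rw [mem_iff_of_valid (isoInvariant_elim hiso d) hx, reduction]
  simp only [(eqBits_iff _ _).2 hx, Bool.true_and]
  by_cases hl : (parse x).2.1.length = l
  swap
  · have : (parse x).2.1.length.beq l = false := by
      rw [← Bool.not_eq_true, Nat.beq_eq]; exact hl
    simp [this, hl]
  simp only [hl, Nat.beq_refl, Bool.true_and, true_and]
  rw [optNum_eq hiso hher hrob hO d hL.nodup hL.length_le]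
  by_cases hC : InClass (C.elim d) (matrixGraph (parse x).1) (outsideOf x).toFinset
  swap
  · simp [hC]
  rw [if_pos hC]
  simp only [hC, Option.isSome_some, Bool.true_and, true_and]
  have hlay := reduceLevels_layout (O := O) (M := (parse x).1) (b := b) (i := d) hL 0
  obtain ⟨hCs, hcov⟩ := reduceLevels_spec hiso hher hrob hO hb hL hC 0 _ rfl
  change Layout _ (reducedState O b d x).1 (reducedState O b d x).2.1 at hlay
  change InClass C _ (reducedState O b d x).1.toFinset at hCs
  change coverNum _ ((reducedState O b d x).2.1.toFinset ∪ (reducedState O b d x).1.toFinset) +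
    (reducedState O b d x).2.2 = _ at hcov
  generalize reducedState O b d x = s at *
  have hXV : (parse x).2.1.toFinset ⊆ (List.range (parse x).1.1).toFinset := by
    intro v hv
    rw [List.mem_toFinset] at hv ⊢
    exact List.mem_range.2 (parse_modulator_lt x v hv)
  rw [toFinset_outsideOf, Finset.union_sdiff_of_subset hXV, add_zero] at hcov
  -- A cost above the budget proves the instance negative. Without the test, truncated subtraction
  -- could make the reduced instance positive.
  by_cases hk : s.2.2 ≤ (parse x).2.2
  · have hk' : s.2.2.ble (parse x).2.2 = true := by rw [Nat.ble_eq]; exact hk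
    rw [hk', cond_true]
    simp only [Option.some.injEq, exists_eq_left']
    have hnd : (s.2.1 ++ s.1).Nodup := List.nodup_append.2 ⟨hlay.nodup_mod, hlay.nodup,
      fun v hv w hw h => hlay.disjoint w hw (h ▸ hv)⟩
    have e1 : ((s.2.1 ++ s.1).filter (memB s.2.1)) = s.2.1 := by
      rw [List.filter_append, List.filter_eq_self.2 fun v hv => memB_iff.2 hv,
        List.filter_eq_nil_iff.2 fun v hv h => hlay.disjoint v hv (memB_iff.1 h), List.append_nil]
    have e2 : (s.2.1 ++ s.1).toFinset \ s.2.1.toFinset = s.1.toFinset := by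
      ext v
      simp only [List.toFinset_append, Finset.mem_sdiff, Finset.mem_union, List.mem_toFinset]
      have := hlay.disjoint v
      tauto
    rw [encodeSub_mem_iff hiso hnd, e1, e2, List.toFinset_append]
    simp only [hCs, true_and]
    omega
  · have : s.2.2.ble (parse x).2.2 = false := by
      rw [← Bool.not_eq_true, Nat.ble_eq]; exact hk
    rw [this, cond_false]
    constructor
    · intro h; omega
    · rintro ⟨y, hy, -⟩; cases hy

/-- An instance that passes the tests has a modulator of size exactly l, so the growth bound becomes
one in l. The constant is the same for all oracles. -/
theorem exists_reduction_modulator_le (b : ℕ → ℕ) (hb : ∀ j ∈ Finset.Icc 1 d, 1 ≤ b j) :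
    ∃ K : ℕ, ∀ (O : List Bool → Bool) (x : List Bool) (l : ℕ) (y : List Bool × ℕ),
      reduction O b d (x, l) = some y → y.2 ≤ K * l ^ (∏ j ∈ Finset.Icc 1 d, b j) := by
  obtain ⟨K, hK⟩ := exists_length_reduceLevels_le b hb
  refine ⟨K, fun O x l y hy => ?_⟩
  rw [reduction, Bool.cond_eq_ite] at hy
  split at hy <;> rename_i hc
  swap
  · cases hy
  simp only [Bool.and_eq_true, Nat.beq_eq] at hc
  cases hy
  have := hK O (parse x).1 _ _ _ 0 (outsideOf_layout x)
  rw [hc.1.2] at this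
  exact this

/-- A kernel output may be negative only because its modulator is not one to C, and still be
positive for the larger class `C.elim d`. Such outputs are replaced by the empty string, which
encodes nothing. -/
theorem postCheck_spec (hiso : C.IsoInvariant) {y : List Bool × ℕ}
    (hO : DecidesVC C O (parse y.1).1 (parse y.1).1.1) :
    postCheck O y ∈ vertexCoverByModulator (C.elim d) ↔ y ∈ vertexCoverByModulator C := by
  have hL := outsideOf_layout y.1
  have hO' := hO _ hL.nodup hL.length_le _ le_rfl
  -- With the number of vertices as budget, the oracle tests membership in C alone.
  have hc : coverNum (matrixGraph (parse y.1).1) (outsideOf y.1).toFinset ≤ (parse y.1).1.1 :=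
    coverNum_le_card.trans ((List.toFinset_card_le _).trans hL.length_le)
  simp only [hc, and_true] at hO'
  rw [postCheck]
  by_cases h : InClass C (matrixGraph (parse y.1).1) (outsideOf y.1).toFinset
  · rw [hO'.2 h, cond_true]
    constructor
    · intro hy
      have hv := valid_of_mem hy
      have h1 := (mem_iff_of_valid (isoInvariant_elim hiso d) hv).1 hy
      exact (mem_iff_of_valid hiso hv).2 ⟨h1.1, h, h1.2.2⟩
    · intro hy
      have hv := valid_of_mem hy
      have h1 := (mem_iff_of_valid hiso hv).1 hy
      exact (mem_iff_of_valid (isoInvariant_elim hiso d) hv).2 ⟨h1.1, h.elim, h1.2.2⟩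
  · rw [Bool.eq_false_iff.2 (mt hO'.1 h), cond_false]
    constructor
    · exact fun hy => absurd hy (nil_not_mem_vertexCoverByModulator _ _)
    · intro hy
      exact absurd ((mem_iff_of_valid hiso (valid_of_mem hy)).1 hy).2.1 h

theorem outputBound_postCheck {f g : ℕ} {y : List Bool × ℕ} (h : OutputBound f g y) :
    OutputBound f g (postCheck O y) := by
  rw [postCheck]
  cases O (encodeSub (parse y.1).1 (outsideOf y.1) [] (parse y.1).1.1)
  · exact outputBound_nil f g
  · exact h

/-- All queries concern subgraphs of the input or of the kernel output, so the oracle has to be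
right up to length m only. Majority votes can guarantee just that. -/
theorem assemble_spec (hiso : C.IsoInvariant) (hher : C.Hereditary) (hrob : C.Robust)
    (hb : ∀ j ∈ Finset.Icc 1 d, BlockBound (C.elim j) (b j))
    {A : List Bool × ℕ → List Bool × ℕ} {m : ℕ}
    (hO : ∀ y : List Bool, y.length ≤ m → (O y = true ↔ (y, 0) ∈ vertexCoverByModulator C))
    (hxm : x.length * x.length + 3 * x.length + 2 ≤ m)
    (hA : ∀ y, reduction O b d (x, l) = some y →
      (A y).1.length * (A y).1.length + 3 * (A y).1.length + 2 ≤ m ∧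
      (A y ∈ vertexCoverByModulator C ↔ y ∈ vertexCoverByModulator C)) :
    assemble O A b d (x, l) ∈ vertexCoverByModulator (C.elim d) ↔
      (x, l) ∈ vertexCoverByModulator (C.elim d) := by
  have hdec : ∀ z : List Bool, z.length * z.length + 3 * z.length + 2 ≤ m →
      DecidesVC C O (parse z).1 (parse z).1.1 := by
    intro z hz
    refine decidesVC_of_forall hiso hO (le_trans ?_ hz)
    have := parse_size_le z
    gcongr
  rw [reduction_spec hiso hher hrob (hdec x hxm) hb, assemble]
  cases h : reduction O b d (x, l) with
  | none => simp [nil_not_mem_vertexCoverByModulator]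
  | some y =>
    simp only [Option.elim_some, Option.some.injEq, exists_eq_left']
    rw [postCheck_spec hiso (hdec _ (hA y h).1), (hA y h).2]

end

/-! ### Growth of the bounds -/

/-- The constant bounds the sum of the absolute values of the coefficients, and the + 1 takes care
of m = 0. A monotone bound is wanted because f need not be monotone. -/
theorem IsPolynomialFun.exists_le {f : ℕ → ℕ} {p : Polynomial ℝ}
    (hp : ∀ n : ℕ, (f n : ℝ) = p.eval (n : ℝ)) :
    ∃ c : ℕ, ∀ m, f m ≤ c * (m ^ p.natDegree + 1) := by
  obtain ⟨c, hc⟩ := exists_nat_ge (∑ i ∈ Finset.range (p.natDegree + 1), |p.coeff i|)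
  refine ⟨c, fun m => ?_⟩
  have h : (f m : ℝ) ≤ c * ((m : ℝ) ^ p.natDegree + 1) := by
    rw [hp, Polynomial.eval_eq_sum_range]
    calc ∑ i ∈ Finset.range (p.natDegree + 1), p.coeff i * (m : ℝ) ^ i
        ≤ ∑ i ∈ Finset.range (p.natDegree + 1), |p.coeff i| * ((m : ℝ) ^ p.natDegree + 1) := by
          refine Finset.sum_le_sum fun i hi => ?_
          refine mul_le_mul (le_abs_self _) ?_ (by positivity) (abs_nonneg _)
          rcases m.eq_zero_or_pos with rfl | hm
          · rcases i.eq_zero_or_pos with rfl | hi'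
            · simp
            · rw [Nat.cast_zero, zero_pow hi'.ne']; positivity
          · have : (m : ℝ) ^ i ≤ (m : ℝ) ^ p.natDegree :=
              pow_le_pow_right₀ (by exact_mod_cast hm) (Nat.lt_succ_iff.1 (Finset.mem_range.1 hi))
            linarith
      _ = (∑ i ∈ Finset.range (p.natDegree + 1), |p.coeff i|) * ((m : ℝ) ^ p.natDegree + 1) := by
          rw [Finset.sum_mul]
      _ ≤ _ := by gcongr
  exact_mod_cast h

/-- A polynomial that bounds `f` on the arguments up to `K * l ^ b`, of the order of `f (l ^ b)`. -/
theorem IsPolynomialFun.exists_bound {f : ℕ → ℕ} (hf : IsPolynomialFun f) {b : ℕ} (hb : b ≠ 0)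
    (K : ℕ) : ∃ f' : ℕ → ℕ, IsPolynomialFun f' ∧ IsBigOPow f' f b ∧
      ∀ l m, m ≤ K * l ^ b → f m ≤ f' l := by
  obtain ⟨p, hp⟩ := hf
  -- For f = 0 the majorant used below need not be O(f), so 0 itself is taken.
  by_cases h0 : p = 0
  · subst h0
    have hf0 : ∀ n, f n = 0 := fun n => by exact_mod_cast (hp n).trans Polynomial.eval_zero
    exact ⟨fun _ => 0, ⟨0, by simp⟩, by simpa [IsBigOPow] using isBigO_zero _ _,
      fun l m _ => (hf0 m).le⟩
  obtain ⟨c, hc⟩ := IsPolynomialFun.exists_le hp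
  set q : Polynomial ℝ := Polynomial.C (c * (K : ℝ) ^ p.natDegree) * Polynomial.X ^ p.natDegree +
    Polynomial.C (c : ℝ) with hq
  have hev : ∀ l : ℕ, ((c * (K ^ p.natDegree * (l ^ b) ^ p.natDegree + 1) : ℕ) : ℝ) =
      q.eval ((l : ℝ) ^ b) := by
    intro l
    simp [hq]; ring
  -- The monotone bound of f, evaluated at K · l^b. Its degree in l^b is at most that of p, so K
  -- costs only a constant factor.
  refine ⟨fun l => c * (K ^ p.natDegree * (l ^ b) ^ p.natDegree + 1),
    ⟨q.comp (Polynomial.X ^ b), fun l => ?_⟩, ?_, fun l m hm => ?_⟩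
  · rw [hev]; simp
  · have hdeg : q.degree ≤ p.degree := by
      rw [Polynomial.degree_eq_natDegree h0]
      refine (Polynomial.degree_add_le _ _).trans (max_le ?_ ?_)
      · exact Polynomial.degree_C_mul_X_pow_le _ _
      · exact Polynomial.degree_C_le.trans (by exact_mod_cast Nat.zero_le _)
    have hT : Tendsto (fun l : ℕ => (l : ℝ) ^ b) atTop atTop :=
      (tendsto_pow_atTop hb).comp tendsto_natCast_atTop_atTop
    have h := (Polynomial.isBigO_atTop_of_degree_le q p hdeg).comp_tendsto hT
    refine h.congr (fun l => (hev l).symm) fun l => ?_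
    rw [hp]; simp
  · refine (hc m).trans ?_
    dsimp only
    rw [← mul_pow]
    gcongr

/-! ### Majority votes -/

section
variable {W : Type} [Fintype W] {T : ℕ} {ε c : ℝ}

/-- The exponential moment of a single vote can be made less than `1`. -/
theorem exists_moment_lt_one (h0 : 0 ≤ ε) (h : ε < 1 / 2) :
    ∃ c : ℝ, 1 ≤ c ∧ 0 ≤ ε * c + (1 - ε) * c⁻¹ ∧ ε * c + (1 - ε) * c⁻¹ < 1 := by
  have hc : 0 < 2 - 2 * ε := by linarith
  -- For c = 2(1 − ε) the moment equals 2ε(1 − ε) + 1/2, which is below 1 because (1 − 2ε)² > 0.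
  refine ⟨2 - 2 * ε, by linarith, by have := inv_pos.2 hc; nlinarith, ?_⟩
  rw [← div_eq_mul_inv, ← lt_sub_iff_add_lt', div_lt_iff₀ hc]
  nlinarith [mul_pos (by linarith : 0 < 1 - 2 * ε) (by linarith : 0 < 1 - ε)]

open Classical in
-- Markov's inequality for an exponential moment: bad votes weigh c and good ones c⁻¹, the product
-- is at least 1 once half of the votes are bad, and the sum of the products over all outcomes
-- factors.
theorem card_majority_le (bad : W → Prop) (hc : 1 ≤ c)
    (hbad : ((Finset.univ.filter bad).card : ℝ) ≤ ε * Fintype.card W) :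
    (((Finset.univ : Finset (Fin T → W)).filter fun w =>
      T ≤ 2 * (Finset.univ.filter fun i => bad (w i)).card).card : ℝ) ≤
      ((ε * c + (1 - ε) * c⁻¹) * Fintype.card W) ^ T := by
  have hc0 : 0 < c := by linarith
  set h : W → ℝ := fun x => if bad x then c else c⁻¹ with hh
  have hpos : ∀ x, 0 ≤ h x := fun x => by
    simp only [hh]; split <;> positivity
  have hsum : ∑ x, h x ≤ (ε * c + (1 - ε) * c⁻¹) * Fintype.card W := by
    rw [hh, Finset.sum_ite, Finset.sum_const, Finset.sum_const, nsmul_eq_mul, nsmul_eq_mul]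
    have h1 : ((Finset.univ.filter bad).card : ℝ) + (Finset.univ.filter fun x => ¬ bad x).card =
        Fintype.card W := by
      exact_mod_cast Finset.card_filter_add_card_filter_not (s := Finset.univ) bad
    have h2 : c⁻¹ ≤ c := (inv_le_one_of_one_le₀ hc).trans hc
    nlinarith
  calc _ = ∑ w : Fin T → W, if T ≤ 2 * (Finset.univ.filter fun i => bad (w i)).card
          then (1 : ℝ) else 0 := by
        rw [Finset.sum_boole]
    _ ≤ ∑ w : Fin T → W, ∏ i, h (w i) := by
        refine Finset.sum_le_sum fun w _ => ?_
        split
        · rename_i hw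
          rw [hh, Finset.prod_ite, Finset.prod_const, Finset.prod_const, inv_pow]
          have h1 := Finset.card_filter_add_card_filter_not (s := Finset.univ)
            (fun i : Fin T => bad (w i))
          rw [Finset.card_univ, Fintype.card_fin] at h1
          rw [← div_eq_mul_inv, le_div_iff₀ (by positivity), one_mul]
          exact pow_le_pow_right₀ hc (by omega)
        · exact Finset.prod_nonneg fun i _ => hpos _
    _ = (∑ x, h x) ^ T := (Fintype.sum_pow h T).symm
    _ ≤ _ := pow_le_pow_left₀ (Finset.sum_nonneg fun x _ => hpos x) hsum T

open Classical in
/-- With many votes, all the majorities are right for most outcomes. -/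
theorem exists_all_majorities {ι : Type} (Y : Finset ι) (bad : ι → W → Prop) (hc : 1 ≤ c)
    (hbad : ∀ y ∈ Y, ((Finset.univ.filter (bad y)).card : ℝ) ≤ ε * Fintype.card W) :
    ∃ E : Finset (Fin T → W),
      (1 - Y.card * (ε * c + (1 - ε) * c⁻¹) ^ T) * (Fintype.card W : ℝ) ^ T ≤ E.card ∧
      ∀ w ∈ E, ∀ y ∈ Y, 2 * (Finset.univ.filter fun i => bad y (w i)).card < T := by
  obtain ⟨E, hE⟩ : ∃ E : Finset (Fin T → W), ∀ w, w ∈ E ↔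
      ∀ y ∈ Y, 2 * (Finset.univ.filter fun i => bad y (w i)).card < T :=
    ⟨Finset.univ.filter fun w => ∀ y ∈ Y, 2 * (Finset.univ.filter fun i => bad y (w i)).card < T,
      fun w => by simp⟩
  refine ⟨E, ?_, fun w hw => (hE w).1 hw⟩
  have h1 := Finset.card_add_card_compl E
  rw [Fintype.card_fun, Fintype.card_fin] at h1
  -- Union bound over Y.
  have h2 : Eᶜ ⊆ Y.biUnion fun y => (Finset.univ : Finset (Fin T → W)).filter fun w =>
        T ≤ 2 * (Finset.univ.filter fun i => bad y (w i)).card := by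
    intro w hw
    rw [Finset.mem_compl, hE] at hw
    push Not at hw
    simpa using hw
  have h3 : (Eᶜ.card : ℝ) ≤ Y.card * ((ε * c + (1 - ε) * c⁻¹) * Fintype.card W) ^ T := by
    refine (Nat.cast_le.2 ((Finset.card_le_card h2).trans Finset.card_biUnion_le)).trans ?_
    rw [Nat.cast_sum, ← nsmul_eq_mul]
    exact Finset.sum_le_card_nsmul _ _ _ fun y hy => card_majority_le (bad y) hc (hbad y hy)
  have h4 := congrArg (Nat.cast (R := ℝ)) h1
  rw [mul_pow] at h3
  push_cast at h4
  rw [sub_mul, one_mul, mul_assoc]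
  linarith

/-- The bit strings of length at most `m`. -/
def shortStrings (m : ℕ) : Finset (List Bool) :=
  (Finset.range (m + 1)).biUnion fun n =>
    (Finset.univ : Finset (Fin n → Bool)).image List.ofFn

theorem mem_shortStrings {m : ℕ} {y : List Bool} : y ∈ shortStrings m ↔ y.length ≤ m := by
  simp only [shortStrings, Finset.mem_biUnion, Finset.mem_range, Finset.mem_image,
    Finset.mem_univ, true_and]
  constructor
  · rintro ⟨n, hn, w, rfl⟩
    simpa using Nat.lt_succ_iff.1 hn
  · exact fun h => ⟨y.length, by omega, y.get, List.ofFn_get y⟩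

theorem card_shortStrings_le (m : ℕ) : (shortStrings m).card ≤ 2 ^ (m + 1) := by
  have h : ∀ n, ∑ i ∈ Finset.range n, 2 ^ i ≤ 2 ^ n := by
    intro n
    induction n with
    | zero => simp
    | succ n ih => rw [Finset.sum_range_succ, pow_succ]; omega
  refine Finset.card_biUnion_le.trans (le_trans (Finset.sum_le_sum fun n _ => ?_) (h (m + 1)))
  exact Finset.card_image_le.trans (by simp)

/-- The number of votes. -/
theorem exists_votes {μ δ : ℝ} (h0 : 0 ≤ μ) (h1 : μ < 1) (hδ : 0 < δ) :
    ∃ s : ℕ, ∀ m : ℕ, 2 ^ (m + 1) * μ ^ (s * (m + 1)) ≤ δ := by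
  -- With 2μ^s ≤ min δ 1, a number of votes proportional to m + 1 outweighs the 2^(m + 1) possible
  -- queries.
  obtain ⟨s, hs⟩ := exists_pow_lt_of_lt_one (show 0 < min δ 1 / 2 by positivity) h1
  refine ⟨s, fun m => ?_⟩
  rw [pow_mul, ← mul_pow]
  have h2 : 2 * μ ^ s ≤ min δ 1 := by linarith
  have h3 : 0 ≤ 2 * μ ^ s := by positivity
  calc (2 * μ ^ s) ^ (m + 1) ≤ 2 * μ ^ s :=
        pow_le_of_le_one h3 (h2.trans (min_le_right _ _)) (by omega)
    _ ≤ δ := h2.trans (min_le_left _ _)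

end

/-! ### Blocks of random bits -/

/-- The bits of a string in the block with index `i`, of length `B`. -/
def blockOf (B : ℕ) (r : List Bool) (i : ℕ) : List Bool := (r.drop (i * B)).take B

/-- The string cut or padded to length `n`. -/
def fitTo (n : ℕ) (r : List Bool) : List Bool := (r ++ List.replicate n false).take n

@[simp] theorem length_fitTo (n : ℕ) (r : List Bool) : (fitTo n r).length = n := by
  simp [fitTo]

/-- Strings of `T + 1` blocks. -/
def blocksEquiv (T B : ℕ) : (Fin (T * B + B) → Bool) ≃ (Fin T → Fin B → Bool) × (Fin B → Bool) :=
  (Fin.appendEquiv (T * B) B).symm.trans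
    (Equiv.prodCongr ((Equiv.arrowCongr finProdFinEquiv.symm (Equiv.refl Bool)).trans
      (Equiv.curry _ _ _)) (Equiv.refl _))

theorem blocksEquiv_symm_apply (T B : ℕ) (w : (Fin T → Fin B → Bool) × (Fin B → Bool)) :
    (blocksEquiv T B).symm w = Fin.append (fun p => w.1 p.divNat p.modNat) w.2 := rfl

theorem blockOf_blocksEquiv_symm (T B : ℕ) (w : (Fin T → Fin B → Bool) × (Fin B → Bool))
    (i : Fin T) :
    blockOf B (List.ofFn ((blocksEquiv T B).symm w)) i = List.ofFn (w.1 i) := by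
  have hi : (i + 1) * B ≤ T * B := Nat.mul_le_mul_right _ i.2
  rw [add_mul, one_mul] at hi
  rw [blocksEquiv_symm_apply]
  refine List.ext_getElem ?_ fun j h1 h2 => ?_
  · simp [blockOf]; omega
  · rw [List.length_ofFn] at h2
    simp only [blockOf, List.getElem_take, List.getElem_drop, List.getElem_ofFn]
    have e : (⟨i * B + j, by omega⟩ : Fin (T * B + B)) =
      Fin.castAdd B (⟨i * B + j, by omega⟩ : Fin (T * B)) := rfl
    rw [e, Fin.append_left]
    have e1 : Fin.divNat (⟨i * B + j, by omega⟩ : Fin (T * B)) = i := by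
      apply Fin.ext
      change (i * B + j) / B = i
      rw [mul_comm, Nat.mul_add_div (by omega), Nat.div_eq_of_lt h2, add_zero]
    have e2 : Fin.modNat (⟨i * B + j, by omega⟩ : Fin (T * B)) = ⟨j, h2⟩ := by
      apply Fin.ext
      change (i * B + j) % B = j
      rw [mul_comm, Nat.mul_add_mod, Nat.mod_eq_of_lt h2]
    rw [e1, e2]

theorem blockOf_blocksEquiv_symm_last (T B : ℕ) (w : (Fin T → Fin B → Bool) × (Fin B → Bool)) :
    blockOf B (List.ofFn ((blocksEquiv T B).symm w)) T = List.ofFn w.2 := by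
  rw [blocksEquiv_symm_apply, List.ofFn_fin_append, blockOf, List.drop_left' (by simp),
    List.take_of_length_le (by simp)]

/-- Events that depend on an initial segment. -/
theorem ncard_fitTo {n B : ℕ} (h : n ≤ B) (E : List Bool → Prop) :
    {w : Fin B → Bool | E (fitTo n (List.ofFn w))}.ncard =
      {w : Fin n → Bool | E (List.ofFn w)}.ncard * 2 ^ (B - n) := by
  obtain ⟨c, rfl⟩ := Nat.exists_eq_add_of_le h
  have h1 : {w : Fin (n + c) → Bool | E (fitTo n (List.ofFn w))} =
      Fin.appendEquiv n c '' ({w : Fin n → Bool | E (List.ofFn w)} ×ˢ Set.univ) := by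
    rw [Equiv.image_eq_preimage_symm]
    ext w
    obtain ⟨⟨u, v⟩, rfl⟩ := (Fin.appendEquiv n c).surjective w
    have : fitTo n (List.ofFn (Fin.appendEquiv n c (u, v))) = List.ofFn u := by
      simp [fitTo, Fin.appendEquiv, List.ofFn_fin_append]
    simp only [Set.mem_ofPred_eq, this, Set.mem_preimage, Equiv.symm_apply_apply, Set.mem_prod,
      Set.mem_univ, and_true]
  rw [h1, Set.ncard_image_of_injective _ (Equiv.injective _), Set.ncard_prod, Set.ncard_univ,
    Nat.card_eq_fintype_card, Fintype.card_fun, Fintype.card_fin, Fintype.card_bool,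
    Nat.add_sub_cancel_left]

/-- Unread bits do not change a probability, so runs that need different numbers of bits can share
one block length. -/
theorem mul_le_ncard_fitTo {n B : ℕ} (h : n ≤ B) {E : List Bool → Prop} {p : ℝ}
    (hp : p * 2 ^ n ≤ ({w : Fin n → Bool | E (List.ofFn w)}.ncard : ℝ)) :
    p * 2 ^ B ≤ ({w : Fin B → Bool | E (fitTo n (List.ofFn w))}.ncard : ℝ) := by
  rw [ncard_fitTo h]
  push_cast
  obtain ⟨c, rfl⟩ := Nat.exists_eq_add_of_le h
  rw [pow_add, Nat.add_sub_cancel_left, ← mul_assoc]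
  exact mul_le_mul_of_nonneg_right hp (by positivity)

/-! ### Sizes of the reduced instances -/

theorem splitTrue_snd_length_le (x : List Bool) : (splitTrue x).2.length ≤ x.length := by
  have key : ∀ (j : ℕ) (p : ℕ × List Bool),
      ((fun p : ℕ × List Bool => cond (p.2.headD false) (p.1 + 1, p.2.tail) p)^[j] p).2.length ≤
        p.2.length := by
    intro j
    induction j with
    | zero => intro p; simp
    | succ j ih =>
      intro p
      rw [Function.iterate_succ_apply]
      refine (ih _).trans ?_
      cases p.2.headD false <;> simp
  simpa [splitTrue] using key x.length (0, x)

theorem parse_budget_le (x : List Bool) : (parse x).2.2 ≤ x.length := by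
  refine (splitTrue_fst_le _).trans (le_trans ?_ (splitTrue_snd_length_le x))
  rw [List.length_tail]
  exact Nat.sub_le _ _

/-- The bound is uniform in the oracle: number and length of the random blocks are fixed from |x| +
l, before the votes determine the reduced instance. -/
theorem exists_reduction_size_le {d : ℕ} (b : ℕ → ℕ) (hb : ∀ j ∈ Finset.Icc 1 d, 1 ≤ b j) :
    ∃ p : Polynomial ℕ, ∀ (O : List Bool → Bool) (x : List Bool) (l : ℕ) (y : List Bool × ℕ),
      reduction O b d (x, l) = some y →
        y.1.length ≤ p.eval (x.length + l) ∧ y.2 ≤ p.eval (x.length + l) := by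
  obtain ⟨K, hK⟩ := exists_reduction_modulator_le b hb
  set D := ∏ j ∈ Finset.Icc 1 d, b j
  -- Bounds the number of vertices: at most K · l^D in the modulator and at most |x| outside.
  set s : Polynomial ℕ := Polynomial.C K * Polynomial.X ^ D + Polynomial.X with hs
  refine ⟨s + Polynomial.X + 2 + s + s * s, fun O x l y hy => ?_⟩
  have h1 := hK O x l y hy
  have h2 : K * l ^ D ≤ K * (x.length + l) ^ D := by gcongr; omega
  have hsN : s.eval (x.length + l) = K * (x.length + l) ^ D + (x.length + l) := by simp [hs]
  have h3 : ∃ X S k, y = (encodeSub (parse x).1 (X ++ S) X k, X.length) ∧ S.length ≤ x.length ∧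
      k ≤ x.length := by
    rw [reduction, Bool.cond_eq_ite] at hy
    split at hy
    · cases hy
      refine ⟨_, _, _, rfl, ?_, (Nat.sub_le _ _).trans (parse_budget_le x)⟩
      exact (reduceLevels_layout (outsideOf_layout x) 0).length_le.trans (parse_size_le x)
    · cases hy
  obtain ⟨X, S, k, rfl, hS, hk⟩ := h3
  dsimp only at h1 ⊢
  have h4 : (X ++ S).length ≤ s.eval (x.length + l) := by
    rw [hsN, List.length_append]; omega
  have h5 := Nat.mul_le_mul h4 h4
  simp only [Polynomial.eval_add, Polynomial.eval_mul, Polynomial.eval_X, Polynomial.eval_ofNat]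
  rw [length_encodeSub]
  constructor
  · omega
  · rw [hsN] at *; omega

/-! ### Programs for kernels -/

namespace PolyTime

/-- A program that is only known to be correct on prepared inputs. -/
theorem of_prepared {f : α → β} {g : α → γ} (hg : PolyTime g) {P : Prog} {p : Polynomial ℕ}
    (h : ∀ a, ∃ t ≤ p.eval (sz a), Runs P (enc (g a)) (enc (f a)) t) : PolyTime f := by
  obtain ⟨Q, q, hQ⟩ := hg
  refine ⟨.comp Q P, Polynomial.X + q + p, fun a => ?_⟩
  obtain ⟨s, hs, h1⟩ := hQ a
  obtain ⟨t, ht, h2⟩ := h a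
  refine ⟨_, ?_, Runs.comp h1 h2⟩
  simp only [Polynomial.eval_add, Polynomial.eval_X]
  change sz a + s + t ≤ _
  omega

theorem add_le_sz_input (z : List Bool × ℕ) : z.1.length + z.2 ≤ sz z := by
  obtain ⟨x, l⟩ := z
  have := length_le_sz x
  rw [sz_mk, sz_nat]
  dsimp only
  omega

theorem sz_input_le (z : List Bool × ℕ) : sz z ≤ 4 * (z.1.length + z.2) + 3 := by
  obtain ⟨x, l⟩ := z
  have := sz_bits_le x
  rw [sz_mk, sz_nat]
  dsimp only
  omega

theorem exists_prog {F : List Bool × ℕ → List Bool × ℕ} (hF : PolyTime F) :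
    ∃ (P : Prog) (p : Polynomial ℕ), ∀ (x : List Bool) (l : ℕ),
      ∃ t ≤ p.eval (x.length + l), Runs P (Data.ofInput (x, l)) (Data.ofInput (F (x, l))) t := by
  obtain ⟨P, p, h⟩ := hF
  refine ⟨P, p.comp (4 * Polynomial.X + 3), fun x l => ?_⟩
  obtain ⟨t, ht, hr⟩ := h (x, l)
  rw [enc_input, enc_input] at hr
  refine ⟨t, ht.trans ?_, hr⟩
  simp only [Polynomial.eval_comp, Polynomial.eval_add, Polynomial.eval_mul, Polynomial.eval_X,
    Polynomial.eval_ofNat]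
  exact p.eval_nat_mono (sz_input_le (x, l))

theorem exists_prog_random {F : (List Bool × ℕ) × List Bool → List Bool × ℕ} (hF : PolyTime F)
    (q : Polynomial ℕ) : ∃ (P : Prog) (p : Polynomial ℕ), ∀ (x : List Bool) (l : ℕ)
      (r : List Bool), r.length = q.eval (x.length + l) → ∃ t ≤ p.eval (x.length + l),
        Runs P (.pair (Data.ofInput (x, l)) (Data.ofBits r)) (Data.ofInput (F ((x, l), r))) t := by
  obtain ⟨P, p, h⟩ := hF
  refine ⟨P, p.comp (4 * Polynomial.X + 3 + (4 * q + 1) + 1), fun x l r hl => ?_⟩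
  obtain ⟨t, ht, hr⟩ := h ((x, l), r)
  rw [enc_input] at hr
  have e : enc ((x, l), r) = .pair (Data.ofInput (x, l)) (Data.ofBits r) := by
    rw [← enc_input, ← enc_bits]; rfl
  rw [e] at hr
  refine ⟨t, ht.trans ?_, hr⟩
  simp only [Polynomial.eval_comp, Polynomial.eval_add, Polynomial.eval_mul, Polynomial.eval_X,
    Polynomial.eval_ofNat, Polynomial.eval_one]
  refine p.eval_nat_mono ?_
  have h1 := sz_input_le (x, l)
  have h2 := sz_bits_le r
  rw [sz_mk]
  dsimp only at h1
  rw [← hl]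
  omega

end PolyTime

/-! ### Composition with a deterministic kernel -/

/-- The positive outputs of size at most `f`. -/
def smallMembers (Q : ParamProblem) (f : ℕ) : Set (List Bool × ℕ) :=
  {y | y ∈ Q ∧ y.1.length ≤ f ∧ y.2 ≤ f}

theorem finite_smallMembers (Q : ParamProblem) (f : ℕ) : (smallMembers Q f).Finite := by
  refine ((shortStrings f) ×ˢ (Finset.range (f + 1))).finite_toSet.subset fun y hy => ?_
  rw [Finset.mem_coe, Finset.mem_product, mem_shortStrings, Finset.mem_range]
  exact ⟨hy.2.1, Nat.lt_succ_iff.2 hy.2.2⟩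

section
variable {C : GraphClass} {d : ℕ} {b : ℕ → ℕ} {f g f' g' : ℕ → ℕ}

open Classical in
/-- Composition of the reduction with a deterministic kernel. -/
theorem HasKernel.elim (hiso : C.IsoInvariant) (hher : C.Hereditary) (hrob : C.Robust)
    (hb : ∀ j ∈ Finset.Icc 1 d, BlockBound (C.elim j) (b j))
    (hf : ∀ O x l y, reduction O b d (x, l) = some y → f y.2 ≤ f' l ∧ g y.2 ≤ g' l)
    (h : HasKernel (vertexCoverByModulator C) f g) :
    HasKernel (vertexCoverByModulator (C.elim d)) f' g' := by
  obtain ⟨P, A, p, hP⟩ := h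
  have hA : PolyTime A := by
    refine ⟨P, p, fun z => ?_⟩
    obtain ⟨t, ht, hr⟩ := (hP z.1 z.2).1
    exact ⟨t, ht.trans (p.eval_nat_mono (PolyTime.add_le_sz_input z)),
      by rw [enc_input, enc_input]; exact hr⟩
  -- At parameter 0 all outputs have size at most f 0, so finitely many occur. A table of the
  -- positive ones decides the instances without modulator.
  set O : List Bool → Bool := fun y =>
    decide (A (y, 0) ∈ smallMembers (vertexCoverByModulator C) (f 0)) with hO
  have hOP : PolyTime O := PolyTime.decide_mem_finite (finite_smallMembers _ _)
    (hA.comp' (f := fun y : List Bool => (y, 0)) (by fun_prop))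
  have hOs : ∀ y, O y = true ↔ (y, 0) ∈ vertexCoverByModulator C := by
    intro y
    obtain ⟨-, h2, h3⟩ := hP y 0
    rw [hO, decide_eq_true_iff, ← h3]
    exact ⟨fun h => h.1, fun h => ⟨h, h2.1, h2.2.1⟩⟩
  have hF : PolyTime (assemble O A b d) :=
    PolyTime.assemble' (O := fun _ => O) (A := fun _ => A)
      (hOP.comp' (f := fun p : (List Bool × ℕ) × List Bool => p.2) (by fun_prop))
      (hA.comp' (f := fun p : (List Bool × ℕ) × (List Bool × ℕ) => p.2) (by fun_prop))
      (by fun_prop)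
  obtain ⟨R, r, hR⟩ := hF.exists_prog
  refine ⟨R, assemble O A b d, r, fun x l => ⟨hR x l, ?_, ?_⟩⟩
  · rw [assemble]
    cases hy : reduction O b d (x, l) with
    | none => exact outputBound_nil _ _
    | some y =>
      exact outputBound_postCheck ((hP y.1 y.2).2.1.mono (hf _ _ _ _ hy).1 (hf _ _ _ _ hy).2)
  -- The oracle is right on all strings, so any m above the required bounds will do.
  · refine assemble_spec hiso hher hrob hb (m := x.length * x.length + 3 * x.length + 2 +
      ((reduction O b d (x, l)).elim 0 fun y =>
        (A y).1.length * (A y).1.length + 3 * (A y).1.length + 2))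
      (fun y _ => hOs y) (Nat.le_add_right _ _) fun y hy => ⟨?_, (hP y.1 y.2).2.2⟩
    rw [hy]
    exact Nat.le_add_left _ _

end

/-! ### The randomized case -/

/-- Whether more than half of the votes are positive. -/
def majority (T : ℕ) (p : ℕ → Bool) : Bool :=
  !(2 * ((List.range T).filter p).length).ble T

theorem majority_congr {T : ℕ} {p p' : ℕ → Bool} (h : ∀ i < T, p i = p' i) :
    majority T p = majority T p' := by
  rw [majority, majority, List.filter_congr fun i hi => h i (List.mem_range.1 hi)]

theorem length_filter_range (T : ℕ) (p : ℕ → Bool) :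
    ((List.range T).filter p).length =
      (Finset.univ.filter fun i : Fin T => p i = true).card := by
  have h : ((List.range T).filter p).toFinset =
      (Finset.univ.filter fun i : Fin T => p i = true).map Fin.valEmbedding := by
    ext i
    simp only [List.mem_toFinset, List.mem_filter, List.mem_range, Finset.mem_map,
      Finset.mem_filter, Finset.mem_univ, true_and, Fin.valEmbedding_apply]
    exact ⟨fun h => ⟨⟨i, h.1⟩, h.2, rfl⟩, by rintro ⟨j, hj, rfl⟩; exact ⟨j.2, hj⟩⟩
  rw [← List.toFinset_card_of_nodup (List.nodup_range.filter _), h, Finset.card_map]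

open Classical in
theorem majority_iff {T : ℕ} {p : ℕ → Bool} {q : Prop}
    (h : 2 * (Finset.univ.filter fun i : Fin T => ¬ (p i = true ↔ q)).card < T) :
    majority T p = true ↔ q := by
  have h1 : majority T p = true ↔
      T < 2 * (Finset.univ.filter fun i : Fin T => p i = true).card := by
    rw [majority, Bool.not_eq_true', ← Bool.not_eq_true, Nat.ble_eq, length_filter_range, not_le]
  rw [h1]
  by_cases hq : q
  · simp only [hq, iff_true] at h ⊢
    have h2 : (Finset.univ.filter fun i : Fin T => p i = true).card +
        (Finset.univ.filter fun i : Fin T => ¬ p i = true).card = T := by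
      have h0 : T = (Finset.univ : Finset (Fin T)).card := by simp
      conv_rhs => rw [h0]
      convert Finset.card_filter_add_card_filter_not _
    omega
  · simp only [hq, iff_false, not_not] at h ⊢
    omega

theorem exists_fitTo_eq_ofFn (n : ℕ) (r : List Bool) :
    ∃ w : Fin n → Bool, fitTo n r = List.ofFn w :=
  ⟨fun i => (fitTo n r)[i]'(by simp), by
    refine List.ext_getElem (by simp) fun i h1 h2 => ?_
    simp⟩

open Classical in
-- Counting fibre by fibre; the independence of the votes from the random bits of the kernel is used
-- in this form.
theorem mul_le_ncard_of_fibers {U V : Type} [Fintype U] [Fintype V] (E : Finset U)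
    (R : U × V → Prop) {p : ℝ} (h : ∀ u ∈ E, p ≤ ({v | R (u, v)}.ncard : ℝ)) :
    E.card * p ≤ ({w | R w}.ncard : ℝ) := by
  have h1 : ({w | R w}.ncard : ℝ) = ∑ u, ({v | R (u, v)}.ncard : ℝ) := by
    simp only [Set.ncard_eq_toFinset_card', Set.toFinset_ofPred]
    simp only [← Finset.sum_boole, Fintype.sum_prod_type]
  rw [h1, ← nsmul_eq_mul]
  refine (Finset.card_nsmul_le_sum _ _ _ h).trans ?_
  exact Finset.sum_le_sum_of_subset_of_nonneg (Finset.subset_univ _) fun _ _ _ => by positivity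

namespace PolyTime

@[fun_prop]
theorem blockOf' {B i : α → ℕ} {r : α → List Bool} (hB : PolyTime B) (hr : PolyTime r)
    (hi : PolyTime i) : PolyTime (fun a => blockOf (B a) (r a) (i a)) := by
  unfold blockOf; fun_prop

@[fun_prop]
theorem fitTo' {n : α → ℕ} {r : α → List Bool} (hn : PolyTime n) (hr : PolyTime r) :
    PolyTime (fun a => fitTo (n a) (r a)) := by
  unfold fitTo; fun_prop

theorem majority' {T : α → ℕ} {p : α → ℕ → Bool} (hT : PolyTime T)
    (hp : PolyTime fun a : α × ℕ => p a.1 a.2) : PolyTime (fun a => majority (T a) (p a)) := by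
  unfold majority
  have : PolyTime fun a => (List.range (T a)).filter (p a) := list_filter (by fun_prop) hp
  fun_prop

end PolyTime

/-- The majority over `T` blocks of random bits of the votes whether the output of `A` lies in
`S`. -/
noncomputable def voteOracle (A : List Bool × ℕ → List Bool → List Bool × ℕ) (S : Set (List Bool × ℕ))
    (T B : ℕ) (r y : List Bool) : Bool :=
  open Classical in majority T fun i => decide (A (y, 0) (blockOf B r i) ∈ S)

open Classical in
-- Later queries depend on earlier answers, so the votes have to be right for all strings up to
-- length m simultaneously.
theorem exists_good_votes {T B m : ℕ} {ε c δ : ℝ} (hc : 1 ≤ c) (hμ0 : 0 ≤ ε * c + (1 - ε) * c⁻¹)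
    (bad : List Bool → (Fin B → Bool) → Prop)
    (hbad : ∀ y : List Bool, y.length ≤ m → (1 - ε) * 2 ^ B ≤ ({w | ¬ bad y w}.ncard : ℝ))
    (hδ : 2 ^ (m + 1) * (ε * c + (1 - ε) * c⁻¹) ^ T ≤ δ) :
    ∃ E : Finset (Fin T → Fin B → Bool), (1 - δ) * (2 ^ B : ℝ) ^ T ≤ E.card ∧
      ∀ u ∈ E, ∀ y ∈ shortStrings m,
        2 * (Finset.univ.filter fun i => bad y (u i)).card < T := by
  have hW : (Fintype.card (Fin B → Bool) : ℝ) = 2 ^ B := by simp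
  have hcount : ∀ y ∈ shortStrings m, ((Finset.univ.filter (bad y)).card : ℝ) ≤
      ε * Fintype.card (Fin B → Bool) := by
    intro y hy
    have h1 := hbad y (mem_shortStrings.1 hy)
    have h2 := Set.ncard_add_ncard_compl {w : Fin B → Bool | ¬ bad y w}
    have h3 : {w : Fin B → Bool | ¬ bad y w}ᶜ =
        ((Finset.univ.filter (bad y) : Finset (Fin B → Bool)) : Set (Fin B → Bool)) := by
      ext w
      simp
    rw [h3, Set.ncard_coe_finset, Nat.card_eq_fintype_card] at h2
    have h4 := congrArg (Nat.cast (R := ℝ)) h2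
    rw [hW] at h4 ⊢
    push_cast at h4
    linarith
  obtain ⟨E, h1, hE⟩ := exists_all_majorities (T := T) (shortStrings m) bad hc hcount
  rw [hW] at h1
  have h3 : ((shortStrings m).card : ℝ) ≤ 2 ^ (m + 1) := by
    exact_mod_cast card_shortStrings_le _
  have h4 := (mul_le_mul_of_nonneg_right h3 (pow_nonneg hμ0 T)).trans hδ
  have h5 : (0 : ℝ) ≤ (2 ^ B) ^ T := by positivity
  exact ⟨E, (mul_le_mul_of_nonneg_right (sub_le_sub_left h4 1) h5).trans h1, hE⟩

/-- The votes may fail with probability ε' − ε and the kernel with ε: (1 − (ε' − ε))(1 − ε) = 1 − ε'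
+ (ε' − ε)ε. -/
theorem mul_pow_le_mul {ε ε' e : ℝ} {T B : ℕ} (hε0 : 0 ≤ ε) (hε1 : ε ≤ 1) (hε' : ε ≤ ε')
    (he : (1 - (ε' - ε)) * (2 ^ B) ^ T ≤ e) :
    (1 - ε') * 2 ^ (T * B + B) ≤ e * ((1 - ε) * 2 ^ B) := by
  have h1 : (0 : ℝ) ≤ (1 - ε) * 2 ^ B := mul_nonneg (by linarith) (by positivity)
  have h2 : (2 : ℝ) ^ (T * B + B) = (2 ^ B) ^ T * 2 ^ B := by
    rw [pow_add, mul_comm T B, pow_mul]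
  have h4 : 1 - ε' ≤ (1 - (ε' - ε)) * (1 - ε) := by nlinarith
  calc (1 - ε') * 2 ^ (T * B + B) ≤ (1 - (ε' - ε)) * (1 - ε) * ((2 ^ B) ^ T * 2 ^ B) := by
        rw [h2]; exact mul_le_mul_of_nonneg_right h4 (by positivity)
    _ = (1 - (ε' - ε)) * (2 ^ B) ^ T * ((1 - ε) * 2 ^ B) := by ring
    _ ≤ e * ((1 - ε) * 2 ^ B) := mul_le_mul_of_nonneg_right he h1

section
variable {C : GraphClass} {d : ℕ} {b : ℕ → ℕ} {f g f' g' : ℕ → ℕ} {ε ε' : ℝ}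

open Classical in
/-- The success probability of the composed algorithm. -/
theorem ncard_assemble_ge (hiso : C.IsoInvariant) (hher : C.Hereditary) (hrob : C.Robust)
    (hb : ∀ j ∈ Finset.Icc 1 d, BlockBound (C.elim j) (b j))
    {A : List Bool × ℕ → List Bool → List Bool × ℕ} {S : Set (List Bool × ℕ)} {x : List Bool}
    {l T B m : ℕ} {c : ℝ} (hε0 : 0 ≤ ε) (hε1 : ε ≤ 1) (hε' : ε ≤ ε')
    (hc : 1 ≤ c) (hμ0 : 0 ≤ ε * c + (1 - ε) * c⁻¹)
    (hμ : 2 ^ (m + 1) * (ε * c + (1 - ε) * c⁻¹) ^ T ≤ ε' - ε)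
    (hS : ∀ y r, A (y, 0) r ∈ S ↔ A (y, 0) r ∈ vertexCoverByModulator C)
    (hxm : x.length * x.length + 3 * x.length + 2 ≤ m)
    (hsmall : ∀ y : List Bool, y.length ≤ m → (1 - ε) * 2 ^ B ≤
      ({w : Fin B → Bool | A (y, 0) (List.ofFn w) ∈ vertexCoverByModulator C ↔
        (y, 0) ∈ vertexCoverByModulator C}.ncard : ℝ))
    (hred : ∀ O z, reduction O b d (x, l) = some z →
      ((1 - ε) * 2 ^ B ≤ ({w : Fin B → Bool | A z (List.ofFn w) ∈ vertexCoverByModulator C ↔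
        z ∈ vertexCoverByModulator C}.ncard : ℝ)) ∧
      ∀ r, (A z r).1.length * (A z r).1.length + 3 * (A z r).1.length + 2 ≤ m) :
    (1 - ε') * 2 ^ (T * B + B) ≤ ({r : Fin (T * B + B) → Bool |
      assemble (voteOracle A S T B (List.ofFn r)) (fun z => A z (blockOf B (List.ofFn r) T))
        b d (x, l) ∈ vertexCoverByModulator (C.elim d) ↔
      (x, l) ∈ vertexCoverByModulator (C.elim d)}.ncard : ℝ) := by
  set Q := vertexCoverByModulator C with hQ
  obtain ⟨bad, hbad⟩ : ∃ bad : List Bool → (Fin B → Bool) → Prop,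
      ∀ y w, bad y w ↔ ¬ (A (y, 0) (List.ofFn w) ∈ Q ↔ (y, 0) ∈ Q) := ⟨_, fun _ _ => Iff.rfl⟩
  obtain ⟨E, hEc, hE⟩ := exists_good_votes (T := T) hc hμ0 bad (fun y hy => by
    simpa only [hbad, not_not] using hsmall y hy) hμ
  obtain ⟨R, hR⟩ : ∃ R : List Bool → Prop, ∀ r, R r ↔
      (assemble (voteOracle A S T B r) (fun z => A z (blockOf B r T)) b d (x, l) ∈
      vertexCoverByModulator (C.elim d) ↔ (x, l) ∈ vertexCoverByModulator (C.elim d)) :=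
    ⟨_, fun _ => Iff.rfl⟩
  -- The voting blocks u are fixed first. They determine the oracle, hence the reduced instance,
  -- while the last block remains uniformly random for the kernel.
  have hfib : ∀ u ∈ E, (1 - ε) * 2 ^ B ≤
      ({v : Fin B → Bool | R (List.ofFn ((blocksEquiv T B).symm (u, v)))}.ncard : ℝ) := by
    intro u hu
    obtain ⟨O, hO⟩ : ∃ O, O =
      voteOracle A S T B (List.ofFn ((blocksEquiv T B).symm (u, fun _ => false))) := ⟨_, rfl⟩
    have hOeq : ∀ v, voteOracle A S T B (List.ofFn ((blocksEquiv T B).symm (u, v))) = O := by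
      intro v
      funext y
      rw [hO, voteOracle, voteOracle]
      refine majority_congr fun i hi => ?_
      rw [blockOf_blocksEquiv_symm T B (u, v) ⟨i, hi⟩, blockOf_blocksEquiv_symm T B _ ⟨i, hi⟩]
    have hOs : ∀ y : List Bool, y.length ≤ m → (O y = true ↔ (y, 0) ∈ Q) := by
      intro y hy
      rw [hO, voteOracle]
      refine majority_iff ?_
      have h1 := hE u hu y (mem_shortStrings.2 hy)
      refine lt_of_le_of_lt (Nat.mul_le_mul_left 2 (Finset.card_le_card fun i hi => ?_)) h1
      simp only [Finset.mem_filter, Finset.mem_univ, true_and, decide_eq_true_iff,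
        blockOf_blocksEquiv_symm, hS] at hi
      rw [Finset.mem_filter, hbad]
      exact ⟨Finset.mem_univ _, hi⟩
    have hspec : ∀ v, (∀ z, reduction O b d (x, l) = some z →
        (A z (List.ofFn v) ∈ Q ↔ z ∈ Q)) → R (List.ofFn ((blocksEquiv T B).symm (u, v))) := by
      intro v hv
      rw [hR, hOeq, blockOf_blocksEquiv_symm_last]
      exact assemble_spec hiso hher hrob hb hOs hxm fun z hz => ⟨(hred O z hz).2 _, hv z hz⟩
    -- If the reduction fails, the output is right for all random bits; otherwise success of the
    -- kernel on z is enough.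
    cases hz : reduction O b d (x, l) with
    | none =>
      have h1 : {v : Fin B → Bool | R (List.ofFn ((blocksEquiv T B).symm (u, v)))} = Set.univ := by
        refine Set.eq_univ_of_forall fun v => hspec v fun z h => ?_
        rw [hz] at h
        cases h
      rw [h1, Set.ncard_univ, Nat.card_eq_fintype_card, Fintype.card_fun, Fintype.card_fin,
        Fintype.card_bool]
      push_cast
      exact mul_le_of_le_one_left (by positivity) (by linarith)
    | some z =>
      refine (hred O z hz).1.trans (Nat.cast_le.2 (Set.ncard_le_ncard (fun v hv => hspec v ?_)
        (Set.toFinite _)))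
      intro z' hz'
      rw [hz] at hz'
      cases hz'
      exact hv
  have hfin := mul_le_ncard_of_fibers E (fun w => R (List.ofFn ((blocksEquiv T B).symm w))) hfib
  have htrans : {w | R (List.ofFn ((blocksEquiv T B).symm w))}.ncard =
      {r : Fin (T * B + B) → Bool | R (List.ofFn r)}.ncard := by
    rw [← Set.ncard_image_of_injective _ (blocksEquiv T B).symm.injective,
      Equiv.image_symm_eq_preimage]
    congr 1
    ext r
    simp
  rw [htrans] at hfin
  simp only [← hR]
  exact (mul_pow_le_mul hε0 hε1 hε' hEc).trans hfin

/-- A success probability cannot exceed 1. -/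
theorem HasRandomizedKernel.nonneg {Q : ParamProblem} (h : HasRandomizedKernel Q f g ε) :
    0 ≤ ε := by
  obtain ⟨P, A, p, q, hP⟩ := h
  have h1 := (hP [] 0).2
  generalize q.eval (([] : List Bool).length + 0) = n at h1
  have h2 : {r : Fin n → Bool | A ([], 0) (List.ofFn r) ∈ Q ↔ ([], 0) ∈ Q}.ncard ≤ 2 ^ n :=
    (Set.ncard_le_card _).trans (by simp)
  have h3 := h1.trans (Nat.cast_le.2 h2)
  push_cast at h3
  have h4 : (0 : ℝ) < 2 ^ n := by positivity
  by_contra hneg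
  nlinarith

/-- The algorithm of a randomized kernel, extended to random strings of arbitrary length. -/
theorem HasRandomizedKernel.exists_total {Q : ParamProblem} (h : HasRandomizedKernel Q f g ε) :
    ∃ (A : List Bool × ℕ → List Bool → List Bool × ℕ) (q : Polynomial ℕ),
      (PolyTime fun a : (List Bool × ℕ) × List Bool => A a.1 a.2) ∧
      (∀ z r, OutputBound (f z.2) (g z.2) (A z r)) ∧
      ∀ z B, q.eval (z.1.length + z.2) ≤ B → (1 - ε) * 2 ^ B ≤
        ({w : Fin B → Bool | A z (List.ofFn w) ∈ Q ↔ z ∈ Q}.ncard : ℝ) := by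
  obtain ⟨P, A, p, q, hP⟩ := h
  -- Random strings are cut or padded to the length the program expects on z, so that it can run on
  -- blocks of any length.
  refine ⟨fun z r => A z (fitTo (q.eval (z.1.length + z.2)) r), q, ?_, fun z r => ?_,
    fun z B hB => mul_le_ncard_fitTo hB (E := fun r => A z r ∈ Q ↔ z ∈ Q) (hP z.1 z.2).2⟩
  · refine PolyTime.of_prepared (P := P) (p := p) (g := fun a : (List Bool × ℕ) × List Bool =>
      (a.1, fitTo (q.eval (a.1.1.length + a.1.2)) a.2)) (by fun_prop) fun a => ?_
    obtain ⟨w, hw⟩ := exists_fitTo_eq_ofFn (q.eval (a.1.1.length + a.1.2)) a.2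
    obtain ⟨t, ht, hr⟩ := ((hP a.1.1 a.1.2).1 w).1
    refine ⟨t, ht.trans (p.eval_nat_mono ((PolyTime.add_le_sz_input a.1).trans ?_)), ?_⟩
    · have h1 : sz a = _ := sz_mk a.1 a.2
      omega
    · rw [enc_input]
      dsimp only
      rw [hw]
      have e : enc (a.1, List.ofFn w) = .pair (Data.ofInput a.1) (Data.ofBits (List.ofFn w)) := by
        rw [← enc_input, ← enc_bits]; rfl
      rw [e]
      exact hr
  · obtain ⟨w, hw⟩ := exists_fitTo_eq_ofFn (q.eval (z.1.length + z.2)) r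
    have := ((hP z.1 z.2).1 w).2
    rw [← hw] at this
    exact this

theorem PolyTime.voteOracle' {A : List Bool × ℕ → List Bool → List Bool × ℕ}
    {S : Set (List Bool × ℕ)} (hS : S.Finite)
    (hA : PolyTime fun a : (List Bool × ℕ) × List Bool => A a.1 a.2) {T B : α → ℕ}
    {r y : α → List Bool} (hT : PolyTime T) (hB : PolyTime B) (hr : PolyTime r)
    (hy : PolyTime y) : PolyTime fun a => voteOracle A S (T a) (B a) (r a) (y a) := by
  unfold voteOracle
  refine PolyTime.majority' hT (PolyTime.decide_mem_finite hS ?_)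
  refine hA.comp' (f := fun e : α × ℕ => ((y e.1, 0), blockOf (B e.1) (r e.1) e.2)) ?_
  fun_prop

/-- Composition of the reduction with a randomized kernel. -/
theorem HasRandomizedKernel.elim (hiso : C.IsoInvariant) (hher : C.Hereditary) (hrob : C.Robust)
    (hb : ∀ j ∈ Finset.Icc 1 d, BlockBound (C.elim j) (b j))
    (hb1 : ∀ j ∈ Finset.Icc 1 d, 1 ≤ b j) {F : Polynomial ℕ} (hF : ∀ m, f m ≤ F.eval m)
    (hf : ∀ O x l y, reduction O b d (x, l) = some y → f y.2 ≤ f' l ∧ g y.2 ≤ g' l)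
    (hε : ε < 1 / 2) (hε' : ε < ε')
    (h : HasRandomizedKernel (vertexCoverByModulator C) f g ε) :
    HasRandomizedKernel (vertexCoverByModulator (C.elim d)) f' g' ε' := by
  have hε0 := h.nonneg
  obtain ⟨A, q, hAP, hAb, hAc⟩ := h.exists_total
  obtain ⟨R, hR⟩ := exists_reduction_size_le b hb1
  obtain ⟨c, hc, hμ0, hμ1⟩ := exists_moment_lt_one hε0 hε
  obtain ⟨s, hs⟩ := exists_votes hμ0 hμ1 (sub_pos.2 hε')
  -- Bounds the length of every query, about the input or about the kernel output, whose length is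
  -- at most F(R(N)).
  obtain ⟨m, hm⟩ : ∃ m : Polynomial ℕ, ∀ N, m.eval N = N * N + 3 * N + 2 +
      (F.eval (R.eval N) * F.eval (R.eval N) + 3 * F.eval (R.eval N) + 2) :=
    ⟨Polynomial.X * Polynomial.X + 3 * Polynomial.X + 2 +
      (F.comp R * F.comp R + 3 * F.comp R + 2), fun N => by simp⟩
  -- One block length for all runs: queries have length at most m and parameter 0, and the reduced
  -- instance has length and parameter at most R(N).
  obtain ⟨B, hB⟩ : ∃ B : Polynomial ℕ, ∀ N, B.eval N = q.eval (m.eval N + R.eval N + R.eval N) :=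
    ⟨q.comp (m + R + R), fun N => by simp⟩
  obtain ⟨T, hT⟩ : ∃ T : Polynomial ℕ, ∀ N, T.eval N = s * (m.eval N + 1) :=
    ⟨Polynomial.C s * (m + 1), fun N => by simp⟩
  obtain ⟨O, hO⟩ : ∃ O : (List Bool × ℕ) × List Bool → List Bool → Bool, ∀ a, O a =
      voteOracle A (smallMembers (vertexCoverByModulator C) (f 0)) (T.eval (a.1.1.length + a.1.2))
        (B.eval (a.1.1.length + a.1.2)) a.2 := ⟨_, fun _ => rfl⟩
  obtain ⟨K, hK⟩ : ∃ K : (List Bool × ℕ) × List Bool → List Bool × ℕ → List Bool × ℕ, ∀ a, K a =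
      fun z => A z (blockOf (B.eval (a.1.1.length + a.1.2)) a.2
        (T.eval (a.1.1.length + a.1.2))) := ⟨_, fun _ => rfl⟩
  have hOP : PolyTime fun a : ((List Bool × ℕ) × List Bool) × List Bool => O a.1 a.2 := by
    simp only [hO]
    exact PolyTime.voteOracle' (finite_smallMembers _ _) hAP (by fun_prop) (by fun_prop)
      (by fun_prop) (by fun_prop)
  have hKP : PolyTime fun a : ((List Bool × ℕ) × List Bool) × (List Bool × ℕ) => K a.1 a.2 := by
    simp only [hK]
    exact hAP.comp' (f := fun e : ((List Bool × ℕ) × List Bool) × (List Bool × ℕ) =>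
      (e.2, blockOf (B.eval (e.1.1.1.length + e.1.1.2)) e.1.2
        (T.eval (e.1.1.1.length + e.1.1.2)))) (by fun_prop)
  have hprog : PolyTime fun a : (List Bool × ℕ) × List Bool => assemble (O a) (K a) b d a.1 :=
    PolyTime.assemble' hOP hKP (by fun_prop)
  obtain ⟨P, p, hP⟩ := hprog.exists_prog_random (T * B + B)
  refine ⟨P, fun z r => assemble (O (z, r)) (K (z, r)) b d z, p, T * B + B, fun x l =>
    ⟨fun w => ⟨hP x l _ (by simp), ?_⟩, ?_⟩⟩
  · simp only [assemble, hK]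
    cases hy : reduction (O ((x, l), List.ofFn w)) b d (x, l) with
    | none => exact outputBound_nil _ _
    | some y =>
      exact outputBound_postCheck ((hAb y _).mono (hf _ _ _ _ hy).1 (hf _ _ _ _ hy).2)
  · simp only [hO, hK]
    have e : (T * B + B).eval (x.length + l) =
        T.eval (x.length + l) * B.eval (x.length + l) + B.eval (x.length + l) := by simp
    rw [e]
    have hmN := hm (x.length + l)
    have hBN := hB (x.length + l)
    have hTN := hT (x.length + l)
    refine ncard_assemble_ge (m := m.eval (x.length + l)) hiso hher hrob hb hε0 (by linarith)
      hε'.le hc hμ0 ?_ ?_ ?_ ?_ ?_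
    · rw [hTN]
      exact hs _
    · intro y r
      have h2 := hAb (y, 0) r
      exact ⟨fun h => h.1, fun h => ⟨h, h2.1, h2.2.1⟩⟩
    · have h1 : x.length ≤ x.length + l := Nat.le_add_right _ _
      have h2 := Nat.mul_le_mul h1 h1
      omega
    · intro y hy
      refine hAc (y, 0) _ ?_
      rw [hBN]
      exact q.eval_nat_mono (by dsimp only; omega)
    · intro O' z hz
      have h1 := hR _ _ _ _ hz
      refine ⟨hAc z _ ?_, fun r => ?_⟩
      · rw [hBN]
        exact q.eval_nat_mono (by omega)
      · have h3 : (A z r).1.length ≤ F.eval (R.eval (x.length + l)) :=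
          (hAb z _).1.trans ((hF _).trans (F.eval_nat_mono h1.2))
        have h4 := Nat.mul_le_mul h3 h3
        omega

end

/-- Time bounds are polynomials over ℕ, whereas f is given by one over ℝ. -/
theorem exists_polynomial_le {f : ℕ → ℕ} (hf : IsPolynomialFun f) :
    ∃ F : Polynomial ℕ, ∀ m, f m ≤ F.eval m := by
  obtain ⟨p, hp⟩ := hf
  obtain ⟨c, hc⟩ := IsPolynomialFun.exists_le hp
  exact ⟨Polynomial.C c * (Polynomial.X ^ p.natDegree + 1), fun m => by simpa using hc m⟩

end Programs

/-! ### Kernels for modulators to bounded elimination distance -/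

theorem theorem5 (C : GraphClass) (hiso : C.IsoInvariant) (hher : C.Hereditary)
    (hrob : C.Robust) (hbeta : C.beta < ⊤) (d : ℕ) :
    (∀ i ∈ Finset.Icc 1 d, (C.elim i).beta < ⊤) ∧
    (∀ f g : ℕ → ℕ, IsPolynomialFun f → IsPolynomialFun g →
      HasKernel (vertexCoverByModulator C) f g →
      ∃ f' g' : ℕ → ℕ, IsPolynomialFun f' ∧ IsPolynomialFun g' ∧
        IsBigOPow f' f (kernelExponent C d) ∧ IsBigOPow g' g (kernelExponent C d) ∧
        HasKernel (vertexCoverByModulator (C.elim d)) f' g') ∧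
    (∀ f g : ℕ → ℕ, IsPolynomialFun f → IsPolynomialFun g →
      ∀ ε : ℝ, ε < 1 / 2 → HasRandomizedKernel (vertexCoverByModulator C) f g ε →
      ∃ f' g' : ℕ → ℕ, IsPolynomialFun f' ∧ IsPolynomialFun g' ∧
        IsBigOPow f' f (kernelExponent C d) ∧ IsBigOPow g' g (kernelExponent C d) ∧
        ∀ ε' : ℝ, ε < ε' → HasRandomizedKernel (vertexCoverByModulator (C.elim d)) f' g' ε') := by
  have hfin : ∀ i, (C.elim i).beta < ⊤ := beta_elim_lt_top hiso hher hrob hbeta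
  have hb : ∀ j ∈ Finset.Icc 1 d, BlockBound (C.elim j) (C.elim j).beta.toNat :=
    fun j _ => blockBound_of_beta_lt_top (hfin j)
  have hb1 : ∀ j ∈ Finset.Icc 1 d, 1 ≤ (C.elim j).beta.toNat := by
    intro j hj
    obtain ⟨i, rfl⟩ := Nat.exists_eq_succ_of_ne_zero
      (Nat.one_le_iff_ne_zero.1 (Finset.mem_Icc.1 hj).1)
    exact one_le_beta_elim_succ hiso hrob (hfin _)
  have hexp : kernelExponent C d ≠ 0 :=
    Finset.prod_ne_zero_iff.2 fun j hj => Nat.one_le_iff_ne_zero.1 (hb1 j hj)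
  -- A single constant for all oracles, so that f' and g' can be chosen before ε'.
  obtain ⟨K, hK⟩ := exists_reduction_modulator_le (fun j => (C.elim j).beta.toNat) hb1
  refine ⟨fun i _ => hfin i, fun f g hf hg h => ?_, fun f g hf hg ε hε h => ?_⟩
  · obtain ⟨f', hf1, hf2, hf3⟩ := hf.exists_bound hexp K
    obtain ⟨g', hg1, hg2, hg3⟩ := hg.exists_bound hexp K
    exact ⟨f', g', hf1, hg1, hf2, hg2, h.elim hiso hher hrob hb fun O x l y hy =>
      ⟨hf3 l _ (hK O x l y hy), hg3 l _ (hK O x l y hy)⟩⟩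
  · obtain ⟨f', hf1, hf2, hf3⟩ := hf.exists_bound hexp K
    obtain ⟨g', hg1, hg2, hg3⟩ := hg.exists_bound hexp K
    obtain ⟨F, hF⟩ := exists_polynomial_le hf
    exact ⟨f', g', hf1, hg1, hf2, hg2, fun ε' hε' => h.elim hiso hher hrob hb hb1 hF
      (fun O x l y hy => ⟨hf3 l _ (hK O x l y hy), hg3 l _ (hK O x l y hy)⟩) hε hε'⟩
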